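/- **Notation.** Let $\mathbb R_n$ be the real Clifford algebra with units $e_1,\dots,e_n$, $e_ie_j+e_je_i=-2\delta_{ij}$. Identify $(x_0,\dots,x_n)\in\mathbb R^{n+1}$ with the paravector $x=x_0+\underline x$, $\underline x=\sum_{i=1}^n x_ie_i$, and put $\overline x=x_0-\underline x$. Let $\mathbb S$ be the sphere of unit 1-vectors, $\mathbb C_I=\mathbb R+I\mathbb R$ for $I\in\mathbb S$, and $[x]=\{x_0+I|\underline x|: I\in\mathbb S\}$. A set $U\subseteq\mathbb R^{n+1}$ is axially symmetric if $[x]\subseteq U$ for all $x\in U$; put $\mathcal U=\{(u,v)\in\mathbb R^2: u+\mathbb S v\subseteq U\}$. A function $f:U\to\mathbb R_n$ is of left (right) axial form if $f(u+Iv)=\alpha(u,v)+I\beta(u,v)$ (resp. $\alpha(u,v)+\beta(u,v)I$) for all $(u,v)\in\mathcal U$, $I\in\mathbb S$, with $\alpha,\beta:\mathcal U\to\mathbb R_n$, $\alpha(u,-v)=\alpha(u,v)$, $\beta(u,-v)=-\beta(u,v)$. If $U$ is open and axially symmetric and $\alpha,\beta$ can moreover be chosen real differentiable with $\partial_u\alpha-\partial_v\beta=0$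 and $\partial_v\alpha+\partial_u\beta=0$, then $f$ is left (right) slice hyperholomorphic on $U$. Let $D=\partial_{x_0}+\sum_{i=1}^n e_i\partial_{x_i}$, $\overline D=\partial_{x_0}-\sum_{i=1}^n e_i\partial_{x_i}$, $\Delta=\sum_{i=0}^n\partial_{x_i}^2$; these operators can act from the left ($Df$) or, with the units multiplied on the right, from the right ($fD$). A function $f$ is left (right) axially polyanalytic of order $m$ on $U$ if it is of class $C^m$, of left (right) axial form, and $D^mf=0$ (resp. $fD^m=0$) on $U$. A slice Cauchy domain is an axially symmetric open set $U$ such that for every $I\in\mathbb S$ the boundary $\partial(U\cap\mathbb C_I)$ in $\mathbb C_I$ is a finite union of pairwise disjoint piecewise $C^1$ Jordan curves, positively oriented, i.e. with total winding number $1$ around the points of $U\cap\mathbb C_I$ and $0$ around the points of $\mathbb C_I$ outside its closure. For $n$ odd put $h_n=(n-1)/2$, $\gamma_n=\Gamma\left(\frac{n+1}{2}\right)^2 2^{n-1}(-1)^{h_n}$, and for $s\notin[x]$ $$F_n^L(s,x)=\gamma_n(s-\overline x)(s^2-2x_0s+|x|^2)^{-\frac{n+1}2},\qquad F_n^R(s,x)=\gamma_n(s^2-2x_0s+|x|^2)^{-\frac{n+1}2}(s-\overline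 x),$$ $$P^L_\ell(s,x)=\frac{(-1)^{\ell-h_n}}{(h_n-\ell)!}F_n^L(s,x)(s-x_0)^{h_n-\ell},\qquad P^R_\ell(s,x)=\frac{(-1)^{\ell-h_n}}{(h_n-\ell)!}(s-x_0)^{h_n-\ell}F_n^R(s,x).$$ **Theorem (Integral representation of axially polyanalytic functions).** Let $n$ be odd, $0\le\ell\le h_n-1$, let $U\subset\mathbb R^{n+1}$ be a bounded slice Cauchy domain, and for $I\in\mathbb S$ put $ds_I=ds(-I)$. 1. If $f$ is left slice hyperholomorphic on a set $W\supseteq\overline U$, then $f$ is $C^\infty$ on $W$, the function $\Delta^\ell\overline D^{h_n-\ell}f$ is left axially polyanalytic of order $h_n-\ell+1$ on $W$, and for every $I\in\mathbb S$ and $x\in U$ $$\Delta^\ell\overline D^{h_n-\ell}f(x)=\frac1{2\pi}\int_{\partial(U\cap\mathbb C_I)}P^L_\ell(s,x)\,ds_I\,f(s).$$ 2. If $f$ is right slice hyperholomorphic on a set $W\supseteq\overline U$, then $f$ is $C^\infty$ on $W$, the function $f\Delta^\ell\overline D^{h_n-\ell}$ is right axially polyanalytic of order $h_n-\ell+1$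 on $W$, and for every $I\in\mathbb S$ and $x\in U$ $$f\Delta^\ell\overline D^{h_n-\ell}(x)=\frac1{2\pi}\int_{\partial(U\cap\mathbb C_I)}f(s)\,ds_I\,P^R_\ell(s,x).$$ 3. The integrands are integrable, and the integrals depend neither on $I\in\mathbb S$ nor on $U$: if $U,U'$ are bounded slice Cauchy domains with closures in $W$, $I,I'\in\mathbb S$ and $x\in U\cap U'$, the integrals over $\partial(U\cap\mathbb C_I)$ and $\partial(U'\cap\mathbb C_{I'})$ agree. 4. The integrals are independent of the kernel of $\Delta^\ell\overline D^{h_n-\ell}$: if $f,g$ are left (right) slice hyperholomorphic on sets containing $\overline U$ and $\Delta^\ell\overline D^{h_n-\ell}(f-g)=0$ (resp. $(f-g)\Delta^\ell\overline D^{h_n-\ell}=0$) on $U$, then $f$ and $g$ have the same integrals for all $x\in U$ and $I\in\mathbb S$. 5. That kernel consists of polynomials: if $f$ is left (right) slice hyperholomorphic on a connected axially symmetric open set $W$, then $\Delta^\ell\overline D^{h_n-\ell}f=0$ (resp. $f\Delta^\ell\overline D^{h_n-\ell}=0$) on $W$ if and only if there are $\alpha_0,\dots,\alpha_{h_n+\ell-1}\in\mathbb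 R_n$ with $f(x)=\sum_{\nu=0}^{h_n+\ell-1}x^\nu\alpha_\nu$ (resp. $f(x)=\sum_{\nu=0}^{h_n+\ell-1}\alpha_\nu x^\nu$) for all $x\in W$. -/

import Mathlib

open scoped ContDiff

noncomputable section

namespace Polyanalytic

/-! ### The Clifford algebra and paravectors -/

/-- The quadratic form `v ↦ -(v₁² + ⋯ + vₙ²)` on `ℝⁿ`. -/
def negForm (n : ℕ) : QuadraticForm ℝ (Fin n → ℝ) :=
  QuadraticMap.weightedSumSquares ℝ (fun _ : Fin n => (-1 : ℝ))

/-- The real Clifford algebra with `n` imaginary units, `eᵢ eⱼ + eⱼ eᵢ = -2 δᵢⱼ`. -/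
abbrev Cl (n : ℕ) : Type := CliffordAlgebra (negForm n)

/-- A real linear isomorphism of the Clifford algebra with the Euclidean space `ℝ^(2ⁿ)`. -/
def coordEquiv (n : ℕ) : Cl n ≃ₗ[ℝ] EuclideanSpace ℝ (Finset (Fin n)) :=
  (CliffordAlgebra.equivExterior (negForm n)).trans
    ((Pi.basisFun ℝ (Fin n)).ExteriorAlgebra.equivFun.trans
      (WithLp.linearEquiv 2 ℝ (Finset (Fin n) → ℝ)).symm)

/-- A norm on the finite-dimensional real vector space `Cl n`. It only serves to speak about
derivatives and integrals of functions with values in `Cl n`, which do not depend on the norm. -/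
instance instNormedAddCommGroupCl (n : ℕ) : NormedAddCommGroup (Cl n) :=
  NormedAddCommGroup.induced (Cl n) (EuclideanSpace ℝ (Finset (Fin n)))
    (coordEquiv n) (coordEquiv n).injective

instance instNormedSpaceCl (n : ℕ) : NormedSpace ℝ (Cl n) :=
  NormedSpace.induced ℝ (Cl n) (EuclideanSpace ℝ (Finset (Fin n))) (coordEquiv n)

/-- The space `ℝ^(n+1)` of the points `(x₀, x₁, …, xₙ)`. -/
abbrev Para (n : ℕ) : Type := EuclideanSpace ℝ (Fin (n + 1))

variable {n : ℕ}

/-- The vector `(v₁, …, vₙ)` as the 1-vector `v₁ e₁ + ⋯ + vₙ eₙ`. -/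
def vec (v : EuclideanSpace ℝ (Fin n)) : Cl n := CliffordAlgebra.ι (negForm n) (fun i => v i)

/-- The vector part `(x₁, …, xₙ)` of `x`. -/
def vecPart (x : Para n) : EuclideanSpace ℝ (Fin n) := WithLp.toLp 2 (fun i => x i.succ)

/-- The point `x` as the paravector `x₀ + x₁ e₁ + ⋯ + xₙ eₙ`. -/
def toCl (x : Para n) : Cl n := algebraMap ℝ (Cl n) (x 0) + vec (vecPart x)

/-- The conjugate paravector `x₀ - x₁ e₁ - ⋯ - xₙ eₙ`. -/
def toClConj (x : Para n) : Cl n := algebraMap ℝ (Cl n) (x 0) - vec (vecPart x)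

/-- The sphere of unit 1-vectors. -/
def unitSphere (n : ℕ) : Set (EuclideanSpace ℝ (Fin n)) := Metric.sphere 0 1

/-- The point `u + I v` of `ℝ^(n+1)`. -/
def slicePoint (I : EuclideanSpace ℝ (Fin n)) (u v : ℝ) : Para n :=
  WithLp.toLp 2 (Fin.cons u (fun i => v * I i))

/-- The sphere `[x]`. -/
def sphereOf (x : Para n) : Set (Para n) :=
  {y | ∃ I ∈ unitSphere n, y = slicePoint I (x 0) ‖vecPart x‖}

/-- Axial symmetry. -/
def AxiallySymmetric (U : Set (Para n)) : Prop := ∀ x ∈ U, sphereOf x ⊆ U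

/-- The set `{(u, v) : u + 𝕊 v ⊆ U}`. -/
def paramSet (U : Set (Para n)) : Set (ℝ × ℝ) :=
  {p | ∀ I ∈ unitSphere n, slicePoint I p.1 p.2 ∈ U}

/-! ### Slice functions, functions of axial form -/

/-- The even-odd conditions on `𝒰`. -/
def EvenOdd (𝒰 : Set (ℝ × ℝ)) (α β : ℝ × ℝ → Cl n) : Prop :=
  ∀ p ∈ 𝒰, α (p.1, -p.2) = α p ∧ β (p.1, -p.2) = -β p

/-- The Cauchy-Riemann equations on `𝒰`, for real differentiable `α` and `β`. -/
def CauchyRiemann (𝒰 : Set (ℝ × ℝ)) (α β : ℝ × ℝ → Cl n) : Prop :=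
  ∀ p ∈ 𝒰, DifferentiableAt ℝ α p ∧ DifferentiableAt ℝ β p ∧
    fderiv ℝ α p (1, 0) - fderiv ℝ β p (0, 1) = 0 ∧
    fderiv ℝ α p (0, 1) + fderiv ℝ β p (1, 0) = 0

/-- `f (u + I v) = α (u, v) + I β (u, v)`; this is both the form of a left slice function and
the left axial form `A(x₀, |x̲|) + ω B(x₀, |x̲|)`, `ω = x̲ / |x̲|`. -/
def LeftForm (U : Set (Para n)) (f : Para n → Cl n) (α β : ℝ × ℝ → Cl n) : Prop :=
  ∀ p ∈ paramSet U, ∀ I ∈ unitSphere n, f (slicePoint I p.1 p.2) = α p + vec I * β p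

/-- `f (u + I v) = α (u, v) + β (u, v) I`. -/
def RightForm (U : Set (Para n)) (f : Para n → Cl n) (α β : ℝ × ℝ → Cl n) : Prop :=
  ∀ p ∈ paramSet U, ∀ I ∈ unitSphere n, f (slicePoint I p.1 p.2) = α p + β p * vec I

/-- Left slice hyperholomorphic functions on the axially symmetric open set `U`. -/
def LeftSliceHyperholomorphic (U : Set (Para n)) (f : Para n → Cl n) : Prop :=
  IsOpen U ∧ AxiallySymmetric U ∧ ∃ α β : ℝ × ℝ → Cl n,
    LeftForm U f α β ∧ EvenOdd (paramSet U) α β ∧ CauchyRiemann (paramSet U) α β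

/-- Right slice hyperholomorphic functions on the axially symmetric open set `U`. -/
def RightSliceHyperholomorphic (U : Set (Para n)) (f : Para n → Cl n) : Prop :=
  IsOpen U ∧ AxiallySymmetric U ∧ ∃ α β : ℝ × ℝ → Cl n,
    RightForm U f α β ∧ EvenOdd (paramSet U) α β ∧ CauchyRiemann (paramSet U) α β

/-! ### The differential operators -/

/-- The partial derivative `∂f/∂xᵢ`, `i = 0, …, n`. -/
def pderiv (i : Fin (n + 1)) (f : Para n → Cl n) (x : Para n) : Cl n :=
  fderiv ℝ f x (EuclideanSpace.single i 1)

/-- The imaginary unit `eᵢ`. -/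
def imUnit (i : Fin n) : Cl n := vec (EuclideanSpace.single i 1)

/-- `D f = ∂f/∂x₀ + ∑ eᵢ ∂f/∂xᵢ`. -/
def dirac (f : Para n → Cl n) (x : Para n) : Cl n :=
  pderiv 0 f x + ∑ i : Fin n, imUnit i * pderiv i.succ f x

/-- `D̄ f = ∂f/∂x₀ - ∑ eᵢ ∂f/∂xᵢ`. -/
def diracConj (f : Para n → Cl n) (x : Para n) : Cl n :=
  pderiv 0 f x - ∑ i : Fin n, imUnit i * pderiv i.succ f x

/-- `f D = ∂f/∂x₀ + ∑ ∂f/∂xᵢ eᵢ`. -/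
def diracRight (f : Para n → Cl n) (x : Para n) : Cl n :=
  pderiv 0 f x + ∑ i : Fin n, pderiv i.succ f x * imUnit i

/-- `f D̄ = ∂f/∂x₀ - ∑ ∂f/∂xᵢ eᵢ`. -/
def diracConjRight (f : Para n → Cl n) (x : Para n) : Cl n :=
  pderiv 0 f x - ∑ i : Fin n, pderiv i.succ f x * imUnit i

/-- The Laplacian in the `n + 1` variables `x₀, …, xₙ`. -/
def lap (f : Para n → Cl n) : Para n → Cl n := Laplacian.laplacian f

/-- The Sce exponent `hₙ = (n - 1) / 2`, for odd `n`. -/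
def sce (n : ℕ) : ℕ := (n - 1) / 2

/-- `Δ^ℓ D̄^(hₙ - ℓ) f`. -/
def leftOp (ℓ : ℕ) (f : Para n → Cl n) : Para n → Cl n :=
  lap^[ℓ] (diracConj^[sce n - ℓ] f)

/-- `f Δ^ℓ D̄^(hₙ - ℓ)`. -/
def rightOp (ℓ : ℕ) (f : Para n → Cl n) : Para n → Cl n :=
  diracConjRight^[sce n - ℓ] (lap^[ℓ] f)

/-- Left axially polyanalytic functions of order `m` on `U`. -/
def LeftAxiallyPolyanalytic (m : ℕ) (U : Set (Para n)) (f : Para n → Cl n) : Prop :=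
  ContDiffOn ℝ m f U ∧
  (∃ A B : ℝ × ℝ → Cl n, LeftForm U f A B ∧ EvenOdd (paramSet U) A B) ∧
  ∀ x ∈ U, (dirac^[m] f) x = 0

/-- Right axially polyanalytic functions of order `m` on `U`. -/
def RightAxiallyPolyanalytic (m : ℕ) (U : Set (Para n)) (f : Para n → Cl n) : Prop :=
  ContDiffOn ℝ m f U ∧
  (∃ A B : ℝ × ℝ → Cl n, RightForm U f A B ∧ EvenOdd (paramSet U) A B) ∧
  ∀ x ∈ U, (diracRight^[m] f) x = 0

/-! ### Slice Cauchy domains -/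

/-- A piecewise continuously differentiable Jordan curve, parametrized by `[0, 1]`. -/
def IsPiecewiseC1Jordan (γ : ℝ → ℂ) : Prop :=
  ContinuousOn γ (Set.Icc 0 1) ∧ γ 0 = γ 1 ∧ Set.InjOn γ (Set.Ico 0 1) ∧
  ∃ (k : ℕ) (t : Fin (k + 1) → ℝ), StrictMono t ∧ t 0 = 0 ∧ t (Fin.last k) = 1 ∧
    ∀ i : Fin k, ContDiffOn ℝ 1 γ (Set.Icc (t i.castSucc) (t i.succ))

/-- The winding number of `γ` around `z`. -/
def windingNumber (γ : ℝ → ℂ) (z : ℂ) : ℂ :=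
  (1 / (2 * Real.pi * Complex.I)) * ∫ t in (0 : ℝ)..1, deriv γ t / (γ t - z)

/-- The curves `γ₁, …, γₘ` are the positively oriented boundary of `Ω ⊆ ℂ`: they are pairwise
disjoint piecewise continuously differentiable Jordan curves, their union is `∂Ω`, and together
they wind once around each point of `Ω` and do not wind around the points outside `Ω ∪ ∂Ω`. -/
def IsOrientedBoundary {m : ℕ} (γ : Fin m → ℝ → ℂ) (Ω : Set ℂ) : Prop :=
  (∀ j, IsPiecewiseC1Jordan (γ j)) ∧
  (∀ i j, i ≠ j → Disjoint (γ i '' Set.Icc 0 1) (γ j '' Set.Icc 0 1)) ∧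
  (⋃ j, γ j '' Set.Icc 0 1) = frontier Ω ∧
  (∀ z ∈ Ω, ∑ j, windingNumber (γ j) z = 1) ∧
  (∀ z ∉ closure Ω, ∑ j, windingNumber (γ j) z = 0)

/-- `U ∩ ℂ_I`, with `ℂ_I = ℝ + I ℝ` identified with `ℂ`. -/
def sliceSet (I : EuclideanSpace ℝ (Fin n)) (U : Set (Para n)) : Set ℂ :=
  {z | slicePoint I z.re z.im ∈ U}

/-- Slice Cauchy domains. -/
def IsSliceCauchyDomain (U : Set (Para n)) : Prop :=
  IsOpen U ∧ AxiallySymmetric U ∧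
  ∀ I ∈ unitSphere n, ∃ (m : ℕ) (γ : Fin m → ℝ → ℂ), IsOrientedBoundary γ (sliceSet I U)

/-! ### Kernels and integrals -/

/-- `γₙ = Γ((n+1)/2)² 2^(n-1) (-1)^((n-1)/2)`, for odd `n`. -/
def gammaConst (n : ℕ) : ℝ :=
  Real.Gamma (((n : ℝ) + 1) / 2) ^ 2 * 2 ^ (n - 1) * (-1) ^ sce n

/-- `s² - 2 Re(x) s + |x|²`. -/
def pseudoCauchy (s x : Para n) : Cl n :=
  toCl s ^ 2 - (2 * x 0) • toCl s + algebraMap ℝ (Cl n) (‖x‖ ^ 2)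

/-- `F_n^L(s, x) = γₙ (s - x̄) (s² - 2 Re(x) s + |x|²)^(-(n+1)/2)`, for odd `n` and `s ∉ [x]`. -/
def leftF (s x : Para n) : Cl n :=
  gammaConst n • ((toCl s - toClConj x) * Ring.inverse (pseudoCauchy s x) ^ ((n + 1) / 2))

/-- `F_n^R(s, x) = γₙ (s² - 2 Re(x) s + |x|²)^(-(n+1)/2) (s - x̄)`, for odd `n` and `s ∉ [x]`. -/
def rightF (s x : Para n) : Cl n :=
  gammaConst n • (Ring.inverse (pseudoCauchy s x) ^ ((n + 1) / 2) * (toCl s - toClConj x))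

/-- The constant `(-1)^(ℓ - hₙ) / (hₙ - ℓ)!`, for `ℓ ≤ hₙ`. -/
def kernelConst (n ℓ : ℕ) : ℝ :=
  (-1 : ℝ) ^ ((ℓ : ℤ) - (sce n : ℤ)) / ((sce n - ℓ).factorial : ℝ)

/-- The left kernel `P^L_ℓ(s, x)`. -/
def leftP (ℓ : ℕ) (s x : Para n) : Cl n :=
  kernelConst n ℓ • (leftF s x * (toCl s - algebraMap ℝ (Cl n) (x 0)) ^ (sce n - ℓ))

/-- The right kernel `P^R_ℓ(s, x)`. -/
def rightP (ℓ : ℕ) (s x : Para n) : Cl n :=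
  kernelConst n ℓ • ((toCl s - algebraMap ℝ (Cl n) (x 0)) ^ (sce n - ℓ) * rightF s x)

/-- The point of the curve `γ`, viewed in `ℂ_I`, at the parameter `t`. -/
def curvePoint (I : EuclideanSpace ℝ (Fin n)) (γ : ℝ → ℂ) (t : ℝ) : Para n :=
  slicePoint I (γ t).re (γ t).im

/-- The density at `t` of `ds_I = ds (-I)` along the curve `γ`, viewed in `ℂ_I`. -/
def dsI (I : EuclideanSpace ℝ (Fin n)) (γ : ℝ → ℂ) (t : ℝ) : Cl n :=
  toCl (slicePoint I (deriv γ t).re (deriv γ t).im) * (-vec I)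

/-- The integrand of `∫_γ P^L_ℓ(s, x) ds_I f(s)`. -/
def leftIntegrand (ℓ : ℕ) (I : EuclideanSpace ℝ (Fin n)) (γ : ℝ → ℂ) (f : Para n → Cl n)
    (x : Para n) (t : ℝ) : Cl n :=
  leftP ℓ (curvePoint I γ t) x * dsI I γ t * f (curvePoint I γ t)

/-- The integrand of `∫_γ f(s) ds_I P^R_ℓ(s, x)`. -/
def rightIntegrand (ℓ : ℕ) (I : EuclideanSpace ℝ (Fin n)) (γ : ℝ → ℂ) (f : Para n → Cl n)
    (x : Para n) (t : ℝ) : Cl n :=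
  f (curvePoint I γ t) * dsI I γ t * rightP ℓ (curvePoint I γ t) x

/-- `(1/2π) ∫ P^L_ℓ(s, x) ds_I f(s)` over the curves `γ₁, …, γₘ` in `ℂ_I`. -/
def leftIntegral (ℓ : ℕ) (I : EuclideanSpace ℝ (Fin n)) {m : ℕ} (γ : Fin m → ℝ → ℂ)
    (f : Para n → Cl n) (x : Para n) : Cl n :=
  (1 / (2 * Real.pi)) • ∑ j, ∫ t in (0 : ℝ)..1, leftIntegrand ℓ I (γ j) f x t

/-- `(1/2π) ∫ f(s) ds_I P^R_ℓ(s, x)` over the curves `γ₁, …, γₘ` in `ℂ_I`. -/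
def rightIntegral (ℓ : ℕ) (I : EuclideanSpace ℝ (Fin n)) {m : ℕ} (γ : Fin m → ℝ → ℂ)
    (f : Para n → Cl n) (x : Para n) : Cl n :=
  (1 / (2 * Real.pi)) • ∑ j, ∫ t in (0 : ℝ)..1, rightIntegrand ℓ I (γ j) f x t

end Polyanalytic

end

open Polyanalytic

noncomputable section

namespace Polyanalytic

open MeasureTheory Set Filter Topology Metric
open scoped Interval

/-! ### Path integrals and Cauchy's formula for cycles -/

section CauchyFormula

variable {E : Type*} [NormedAddCommGroup E] [NormedSpace ℂ E]

/-! A left slice hyperholomorphic `f = α + Iβ` has the stem `ψ = α + iβ`, a holomorphic function on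
a conjugation-invariant open set of the plane with values in the complexified Clifford algebra. Put
`h = sce n`, `Q = (s - x₀)² + |x̲|²` and `q_{a,k}(x) = (2πi)⁻¹ ∮ (s - x₀)^a Q^(-k) ψ(s) ds`. The
zeros of `Q` are `x₀ ± i|x̲|`, and Cauchy's formula at these two points, together with the parity of
`α` and `β`, gives `f = q_{1,1} + x̲ q_{0,1}`. Only `x₀` and `|x̲|²` enter the integrals, so `f` is
smooth, also across the real axis.

The rest is algebra with `F_{a,k} = q_{a+1,k} + x̲ q_{a,k}` (`axialFun`). Differentiation under the
integral gives `D F_{a,k} = -a F_{a-1,k} + (2k - n - 1) q_{a,k}`. As `D̄ D = Δ`, it follows that `Δ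
F_{0,k} = 2k (2k - n - 1) F_{0,k+1}`. Moreover `D̄^m F_{0,k}` is a multiple of `F_{m,k+m}` if `n + 1
= 2(k + m)`. Hence `Δ^ℓ D̄^(h-ℓ)` takes `f = F_{0,1}` to a multiple of `F_{h-ℓ,h+1}`
(`IsKernelFamily.leftOp_axialFun`). At the level `k = h + 1` the operator `D` merely lowers `a`, so
`a + 1` applications annihilate `F_{a,h+1}`: this is polyanalyticity.

The integrand with the kernel `P_ℓ` is the image of a complex integrand under the linear map that
replaces `i` by `I` (`leftIntegrand_eq`). The integral is thus the wanted value plus a term from the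
imaginary parts of the `q_{a,k}`. The imaginary part of `F_{0,1}` is zero; the operator identity
holds for its family too, so the imaginary part of `F_{h-ℓ,h+1}` is zero as well, and the reflection
of `x̲` separates its components (`leftOp_eq_leftIntegral`). The independence statements follow,
since the operator side knows neither `I` nor `U`.

For the kernel of the operator, `F_{h-ℓ,h+1} = 0` forces `q_{a,k} = 0` whenever `a + h + ℓ + 1 ≤ 2k`
(`IsRadialFamily.vanishesBelow`). Each `∂₀` gains one in this inequality, so `∂₀^(h+ℓ) f = 0`. If
`∂₀^(j+1) f = 0` then `∂₀^j f` is a constant `c`, and subtraction of `x^j c / j!` starts an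
induction. Conversely, `x^ν c` has degree `ν` in the coordinates, and the operator has order `h +
ℓ`.

The right-sided statements follow from the left-sided ones by reversion, which reverses products and
fixes paravectors. -/

/-- Continuous paths on `[0, 1]` with an integrable derivative. -/
structure IsGoodPath (γ : ℝ → ℂ) : Prop where
  cont : ContinuousOn γ (Icc 0 1)
  integrable : IntervalIntegrable (deriv γ) volume 0 1

lemma uIoc_zero_one_subset : Ι (0 : ℝ) 1 ⊆ Icc 0 1 := by
  rw [uIoc_of_le zero_le_one]; exact Ioc_subset_Icc_self

lemma IsGoodPath.isCompact {γ : ℝ → ℂ} (h : IsGoodPath γ) : IsCompact (γ '' Icc 0 1) :=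
  isCompact_Icc.image_of_continuousOn h.cont

lemma IsGoodPath.intervalIntegrable {γ : ℝ → ℂ} (h : IsGoodPath γ) {F : ℂ → E}
    (hF : ContinuousOn F (γ '' Icc 0 1)) :
    IntervalIntegrable (fun t => deriv γ t • F (γ t)) volume 0 1 := by
  refine h.integrable.smul_continuousOn ?_
  rw [uIcc_of_le zero_le_one]
  exact hF.comp h.cont (mapsTo_image _ _)

lemma IsGoodPath.norm_integral_le {γ : ℝ → ℂ} (h : IsGoodPath γ) {F : ℂ → E} {C : ℝ}
    (hF : ∀ t ∈ Icc (0 : ℝ) 1, ‖F (γ t)‖ ≤ C) :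
    ‖∫ t in (0 : ℝ)..1, deriv γ t • F (γ t)‖ ≤ (∫ t in (0 : ℝ)..1, ‖deriv γ t‖) * C := by
  rw [← intervalIntegral.integral_mul_const]
  refine intervalIntegral.norm_integral_le_of_norm_le zero_le_one ?_ (h.integrable.norm.mul_const C)
  refine Eventually.of_forall fun t ht => ?_
  rw [norm_smul]
  exact mul_le_mul_of_nonneg_left (hF t (Ioc_subset_Icc_self ht)) (norm_nonneg _)

/-- Differentiation of a path integral with respect to a parameter. -/
lemma IsGoodPath.hasFDerivAt_integral {γ : ℝ → ℂ} (h : IsGoodPath γ)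
    {X : Type*} [NormedAddCommGroup X] [NormedSpace ℝ X]
    {G : X → ℂ → E} {G' : X → ℂ → X →L[ℝ] E} {x₀ : X} {s : Set X} (hs : s ∈ 𝓝 x₀) {C : ℝ}
    (hG : ∀ x ∈ s, ContinuousOn (G x) (γ '' Icc 0 1))
    (hG' : ContinuousOn (G' x₀) (γ '' Icc 0 1))
    (hd : ∀ t ∈ Icc (0 : ℝ) 1, ∀ x ∈ s, HasFDerivAt (fun y => G y (γ t)) (G' x (γ t)) x)
    (hb : ∀ t ∈ Icc (0 : ℝ) 1, ∀ x ∈ s, ‖G' x (γ t)‖ ≤ C) :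
    HasFDerivAt (fun x => ∫ t in (0 : ℝ)..1, deriv γ t • G x (γ t))
      (∫ t in (0 : ℝ)..1, deriv γ t • G' x₀ (γ t)) x₀ := by
  refine intervalIntegral.hasFDerivAt_integral_of_dominated_of_fderiv_le
    (bound := fun t => ‖deriv γ t‖ * C) (F' := fun x t => deriv γ t • G' x (γ t)) hs ?_ ?_ ?_ ?_ ?_ ?_
  · filter_upwards [hs] with x hx
    exact ((h.intervalIntegrable (hG x hx)).def').aestronglyMeasurable
  · exact h.intervalIntegrable (hG x₀ (mem_of_mem_nhds hs))
  · exact ((h.intervalIntegrable hG').def').aestronglyMeasurable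
  · refine Eventually.of_forall fun t ht x hx => ?_
    rw [norm_smul]
    exact mul_le_mul_of_nonneg_left (hb t (uIoc_zero_one_subset ht) x hx) (norm_nonneg _)
  · exact h.integrable.norm.mul_const C
  · refine Eventually.of_forall fun t ht x hx => ?_
    exact (hd t (uIoc_zero_one_subset ht) x hx).const_smul _

lemma IsGoodPath.differentiableAt_integral {γ : ℝ → ℂ} (h : IsGoodPath γ)
    {G : ℂ → ℂ → E} {z₀ : ℂ} {s : Set ℂ} (hs : s ∈ 𝓝 z₀) {C : ℝ}
    (hG : ∀ z ∈ s, ContinuousOn (G z) (γ '' Icc 0 1))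
    (hd : ∀ t ∈ Icc (0 : ℝ) 1, ∀ z ∈ s, DifferentiableAt ℂ (fun y => G y (γ t)) z)
    (hb : ∀ t ∈ Icc (0 : ℝ) 1, ∀ z ∈ s, ‖deriv (fun y => G y (γ t)) z‖ ≤ C) :
    DifferentiableAt ℂ (fun z => ∫ t in (0 : ℝ)..1, deriv γ t • G z (γ t)) z₀ := by
  have meas : ∀ z ∈ s, AEStronglyMeasurable (fun t => deriv γ t • G z (γ t))
      (volume.restrict (Ι 0 1)) := fun z hz =>
    ((h.intervalIntegrable (hG z hz)).def').aestronglyMeasurable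
  refine (intervalIntegral.hasDerivAt_integral_of_dominated_loc_of_deriv_le
    (bound := fun t => ‖deriv γ t‖ * C)
    (F' := fun z t => deriv γ t • deriv (fun y => G y (γ t)) z) hs ?_ ?_ ?_ ?_ ?_ ?_).2.differentiableAt
  · filter_upwards [hs] with x hx using meas x hx
  · exact h.intervalIntegrable (hG z₀ (mem_of_mem_nhds hs))
  -- The derivative is measurable in `t` as a pointwise limit of difference quotients along `z₀ +
  -- 1/(k+1)`; the shift by `N` keeps these points in `s`.
  · have hlim : Tendsto (fun k : ℕ => z₀ + 1 / ((k : ℂ) + 1)) atTop (𝓝 z₀) := by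
      simpa using tendsto_const_nhds.add (tendsto_one_div_add_atTop_nhds_zero_nat (𝕜 := ℂ))
    have hne : ∀ k : ℕ, z₀ + 1 / ((k : ℂ) + 1) ≠ z₀ := fun k => by
      have : ((k : ℂ) + 1) ≠ 0 := by exact_mod_cast Nat.succ_ne_zero k
      simpa using this
    obtain ⟨N, hN⟩ := eventually_atTop.mp (hlim.eventually hs)
    refine aestronglyMeasurable_of_tendsto_ae (atTop : Filter ℕ)
      (f := fun k t => (z₀ + 1 / (((k + N : ℕ) : ℂ) + 1) - z₀)⁻¹ •
        (deriv γ t • G (z₀ + 1 / (((k + N : ℕ) : ℂ) + 1)) (γ t) - deriv γ t • G z₀ (γ t)))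
      (fun k => ((meas _ (hN _ (Nat.le_add_left _ _))).sub
        (meas _ (mem_of_mem_nhds hs))).const_smul _) ?_
    refine (ae_restrict_iff' measurableSet_uIoc).mpr (Eventually.of_forall fun t ht => ?_)
    have hdt := (hd t (uIoc_zero_one_subset ht) z₀ (mem_of_mem_nhds hs)).hasDerivAt.const_smul
      (deriv γ t)
    rw [hasDerivAt_iff_tendsto_slope] at hdt
    have hlim2 : Tendsto (fun k : ℕ => z₀ + 1 / (((k + N : ℕ) : ℂ) + 1)) atTop (𝓝[≠] z₀) :=
      tendsto_nhdsWithin_iff.mpr ⟨hlim.comp (tendsto_add_atTop_nat N),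
        Eventually.of_forall fun k => hne _⟩
    refine (hdt.comp hlim2).congr fun k => ?_
    simp [slope_def_module]
  · refine Eventually.of_forall fun t ht x hx => ?_
    rw [norm_smul]
    exact mul_le_mul_of_nonneg_left (hb t (uIoc_zero_one_subset ht) x hx) (norm_nonneg _)
  · exact h.integrable.norm.mul_const C
  · refine Eventually.of_forall fun t ht x hx => ?_
    exact ((hd t (uIoc_zero_one_subset ht) x hx).hasDerivAt).const_smul (deriv γ t)

/-- The symmetry carries regularity in the second argument over to the base point, which is the
variable in Dixon's argument. -/
lemma dslope_symm {f : ℂ → E} (a b : ℂ) : dslope f a b = dslope f b a := by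
  rcases eq_or_ne a b with rfl | h
  · rfl
  · rw [dslope_of_ne _ h.symm, dslope_of_ne _ h, slope_comm]

/-- Difference quotients of a holomorphic function are bounded on compact sets. -/
lemma exists_bound_dslope {ψ : ℂ → E} {V K B : Set ℂ} (hV : IsOpen V)
    (hψ : DifferentiableOn ℂ ψ V) (hK : IsCompact K) (hKV : K ⊆ V) (hB : IsCompact B)
    (hBV : B ⊆ V) : ∃ C, ∀ w ∈ K, ∀ z ∈ B, ‖dslope ψ w z‖ ≤ C := by
  obtain ⟨δ, hδ, hδV⟩ := hK.exists_cthickening_subset_open hV hKV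
  have hT : IsCompact (cthickening δ K ∪ B) := hK.cthickening.union hB
  obtain ⟨M, hM⟩ := hT.exists_bound_of_continuousOn
    (hψ.continuousOn.mono (union_subset hδV hBV))
  have hKT : K ⊆ cthickening δ K := self_subset_cthickening K
  refine ⟨2 * M / δ, fun w hw z hz => ?_⟩
  have hMw := hM w (Or.inl (hKT hw))
  -- Near the diagonal the Schwarz lemma applies on the ball of radius `δ`, where `ψ` moves by at
  -- most `2M`; away from it the denominator is at least `δ`.
  rcases lt_or_ge (dist z w) δ with hd | hd
  · have hball : ball w δ ⊆ cthickening δ K := fun y hy =>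
      mem_cthickening_of_dist_le y w δ K hw (le_of_lt hy)
    refine Complex.norm_dslope_le_div_of_mapsTo_ball (hψ.mono (hball.trans hδV)) (fun y hy => ?_) hd
    rw [mem_closedBall, dist_eq_norm]
    have := hM y (Or.inl (hball hy))
    linarith [norm_sub_le (ψ y) (ψ w)]
  · have hne : z ≠ w := by rintro rfl; simp at hd; linarith
    rw [dslope_of_ne _ hne, slope_def_module, norm_smul, norm_inv, ← dist_eq_norm z w,
      inv_mul_eq_div]
    have h1 : ‖ψ z - ψ w‖ ≤ 2 * M := by linarith [norm_sub_le (ψ z) (ψ w), hM z (Or.inr hz)]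
    have h2 : 0 ≤ 2 * M := (norm_nonneg _).trans h1
    exact div_le_div₀ h2 h1 hδ hd

variable [CompleteSpace E]

/-- The difference quotients are bounded uniformly for points of the path and `z` near `z₀`;
Cauchy's estimate on circles of radius `ε / 4` bounds their derivatives in `z`, which permits
differentiation under the integral. -/
lemma IsGoodPath.differentiableAt_integral_dslope {γ : ℝ → ℂ} (h : IsGoodPath γ) {V : Set ℂ}
    (hV : IsOpen V) {ψ : ℂ → E} (hψ : DifferentiableOn ℂ ψ V) (hγ : γ '' Icc 0 1 ⊆ V)
    {z₀ : ℂ} (hz₀ : z₀ ∈ V) :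
    DifferentiableAt ℂ (fun z => ∫ t in (0 : ℝ)..1, deriv γ t • dslope ψ z (γ t)) z₀ := by
  obtain ⟨ε, hε, hεV⟩ := Metric.isOpen_iff.mp hV z₀ hz₀
  obtain ⟨C, hC⟩ := exists_bound_dslope (B := closedBall z₀ (ε / 2)) hV hψ h.isCompact hγ
    (isCompact_closedBall _ _) ((closedBall_subset_ball (by linarith)).trans hεV)
  have hsub : ball z₀ (ε / 4) ⊆ V := (ball_subset_ball (by linarith)).trans hεV
  have hdiff : ∀ w ∈ V, DifferentiableOn ℂ (fun z => dslope ψ z w) V := fun w hw => by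
    simp_rw [fun z => dslope_symm (f := ψ) z w]
    exact (Complex.differentiableOn_dslope (hV.mem_nhds hw)).mpr hψ
  refine h.differentiableAt_integral (C := C / (ε / 4)) (s := ball z₀ (ε / 4))
    (ball_mem_nhds _ (by linarith)) (fun z hz => ?_) (fun t ht z hz => ?_) (fun t ht z hz => ?_)
  · exact ((continuousOn_dslope (hV.mem_nhds (hsub hz))).mpr ⟨hψ.continuousOn,
      (hψ z (hsub hz)).differentiableAt (hV.mem_nhds (hsub hz))⟩).mono hγ
  · exact (hdiff _ (hγ (mem_image_of_mem _ ht))).differentiableAt (hV.mem_nhds (hsub hz))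
  · have hcl : closedBall z (ε / 4) ⊆ closedBall z₀ (ε / 2) :=
      closedBall_subset_closedBall' (by rw [mem_ball] at hz; linarith)
    refine Complex.norm_deriv_le_of_forall_mem_sphere_norm_le (by linarith) ?_ (fun y hy => ?_)
    · refine DifferentiableOn.diffContOnCl ?_
      rw [closure_ball _ (by linarith)]
      exact (hdiff _ (hγ (mem_image_of_mem _ ht))).mono
        (hcl.trans ((closedBall_subset_ball (by linarith)).trans hεV))
    · rw [dslope_symm]
      exact hC _ (mem_image_of_mem _ ht) _ (hcl (sphere_subset_closedBall hy))

/-- The integral of `F` over the cycle formed by the paths `γ₁, …, γₘ`. -/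
def cycleIntegral {m : ℕ} (γ : Fin m → ℝ → ℂ) (F : ℂ → E) : E :=
  ∑ j, ∫ t in (0 : ℝ)..1, deriv (γ j) t • F (γ j t)

/-- A cycle in `V` that winds once around the points of `O`, and does not wind around the points
outside `V`. -/
structure IsCauchyCycle {m : ℕ} (γ : Fin m → ℝ → ℂ) (V O : Set ℂ) : Prop where
  good : ∀ j, IsGoodPath (γ j)
  mem : ∀ j, ∀ t ∈ Icc (0 : ℝ) 1, γ j t ∈ V
  isOpen : IsOpen O
  subset : O ⊆ V
  notMem : ∀ j, ∀ t ∈ Icc (0 : ℝ) 1, γ j t ∉ O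
  wind : ∀ z ∈ O, cycleIntegral γ (fun w => (w - z)⁻¹) = 2 * Real.pi * Complex.I
  exists_exterior : ∃ Z : Set ℂ, IsOpen Z ∧ V ∪ Z = univ ∧ Bornology.IsBounded Zᶜ ∧
    (∀ j, ∀ t ∈ Icc (0 : ℝ) 1, γ j t ∉ Z) ∧
    ∀ z ∈ Z, cycleIntegral γ (fun w => (w - z)⁻¹) = 0

omit [CompleteSpace E] in
lemma cycleIntegral_congr {m : ℕ} {γ : Fin m → ℝ → ℂ} {F G : ℂ → E}
    (h : ∀ j, ∀ t ∈ Icc (0 : ℝ) 1, F (γ j t) = G (γ j t)) :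
    cycleIntegral γ F = cycleIntegral γ G := by
  refine Finset.sum_congr rfl fun j _ => intervalIntegral.integral_congr fun t ht => ?_
  rw [uIcc_of_le zero_le_one] at ht
  simp only [h j t ht]

lemma cycleIntegral_dslope {m : ℕ} {γ : Fin m → ℝ → ℂ} (hγ : ∀ j, IsGoodPath (γ j)) {V : Set ℂ}
    {ψ : ℂ → E} (hψ : ContinuousOn ψ V) (hV : ∀ j, ∀ t ∈ Icc (0 : ℝ) 1, γ j t ∈ V) {z : ℂ}
    (hz : ∀ j, ∀ t ∈ Icc (0 : ℝ) 1, γ j t ≠ z) :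
    cycleIntegral γ (dslope ψ z) = cycleIntegral γ (fun w => (w - z)⁻¹ • ψ w) -
      cycleIntegral γ (fun w => (w - z)⁻¹) • ψ z := by
  unfold cycleIntegral
  rw [Finset.sum_smul, ← Finset.sum_sub_distrib]
  refine Finset.sum_congr rfl fun j _ => ?_
  have hc : ContinuousOn (fun w => (w - z)⁻¹) (γ j '' Icc 0 1) := by
    refine ContinuousOn.inv₀ (by fun_prop) ?_
    rintro _ ⟨t, ht, rfl⟩
    exact sub_ne_zero.mpr (hz j t ht)
  have hψ' : ContinuousOn ψ (γ j '' Icc 0 1) := hψ.mono (by rintro _ ⟨t, ht, rfl⟩; exact hV j t ht)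
  rw [← intervalIntegral.integral_smul_const, ← intervalIntegral.integral_sub
    ((hγ j).intervalIntegrable (F := fun w => (w - z)⁻¹ • ψ w) (hc.smul hψ'))
    (IntervalIntegrable.smul_continuousOn
      ((hγ j).intervalIntegrable (F := fun w => (w - z)⁻¹) hc) (g := fun _ => ψ z)
      continuousOn_const)]
  refine intervalIntegral.integral_congr fun t ht => ?_
  rw [uIcc_of_le zero_le_one] at ht
  simp only [dslope_of_ne _ (hz j t ht), slope_def_module, smul_sub, smul_assoc]

/-- Cauchy's integral formula for cycles (Dixon's proof). -/
theorem IsCauchyCycle.cauchy {m : ℕ} {γ : Fin m → ℝ → ℂ} {V O : Set ℂ}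
    (h : IsCauchyCycle γ V O) (hV : IsOpen V) {ψ : ℂ → E} (hψ : DifferentiableOn ℂ ψ V)
    {z : ℂ} (hz : z ∈ O) :
    cycleIntegral γ (fun w => (w - z)⁻¹ • ψ w) = (2 * Real.pi * Complex.I : ℂ) • ψ z := by
  obtain ⟨Z, hZo, hVZ, hZb, hγZ, hZ0⟩ := h.exists_exterior
  have hγV : ∀ j, γ j '' Icc 0 1 ⊆ V := fun j => by rintro _ ⟨t, ht, rfl⟩; exact h.mem j t ht
  classical
  let h₁ : ℂ → E := fun z => cycleIntegral γ (dslope ψ z)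
  let h₂ : ℂ → E := fun z => cycleIntegral γ (fun w => (w - z)⁻¹ • ψ w)
  -- On `V ∩ Z` the winding number is zero, so both integrals agree there and `H` is entire. As `Zᶜ`
  -- is bounded, `H` tends to `0` at infinity, hence `H = 0` by Liouville.
  let H : ℂ → E := fun z => if z ∈ Z then h₂ z else h₁ z
  have hne : ∀ z ∈ Z, ∀ j, ∀ t ∈ Icc (0 : ℝ) 1, γ j t ≠ z := fun z hz j t ht e =>
    hγZ j t ht (e ▸ hz)
  have h12 : ∀ z ∈ V, H z = h₁ z := fun z hzV => by
    by_cases hzZ : z ∈ Z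
    · simp only [H, hzZ, if_true, h₁, h₂]
      rw [cycleIntegral_dslope h.good hψ.continuousOn h.mem (hne z hzZ), hZ0 z hzZ, zero_smul,
        sub_zero]
    · simp only [H, hzZ, if_false]
  have d₁ : ∀ z ∈ V, DifferentiableAt ℂ h₁ z := fun z hzV => by
    have : h₁ = fun z => ∑ j, ∫ t in (0 : ℝ)..1, deriv (γ j) t • dslope ψ z (γ j t) := rfl
    rw [this]
    exact DifferentiableAt.fun_sum fun j _ =>
      (h.good j).differentiableAt_integral_dslope hV hψ (hγV j) hzV
  have bound : ∃ M, 0 ≤ M ∧ ∀ j, ∀ t ∈ Icc (0 : ℝ) 1, ‖ψ (γ j t)‖ ≤ M ∧ ‖γ j t‖ ≤ M := by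
    have hc : IsCompact (⋃ j, γ j '' Icc 0 1) := isCompact_iUnion fun j => (h.good j).isCompact
    obtain ⟨M₁, hM₁⟩ := hc.exists_bound_of_continuousOn (hψ.continuousOn.mono (iUnion_subset hγV))
    obtain ⟨M₂, hM₂⟩ := hc.exists_bound_of_continuousOn (f := fun z : ℂ => z) continuousOn_id
    refine ⟨max 0 (max M₁ M₂), le_max_left _ _, fun j t ht => ?_⟩
    have hm : γ j t ∈ ⋃ j, γ j '' Icc 0 1 := mem_iUnion.mpr ⟨j, mem_image_of_mem _ ht⟩
    exact ⟨(hM₁ _ hm).trans (by simp), (hM₂ _ hm).trans (by simp)⟩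
  obtain ⟨M, hM0, hM⟩ := bound
  have d₂ : ∀ z ∈ Z, DifferentiableAt ℂ h₂ z := fun z hzZ => by
    obtain ⟨ε, hε, hεZ⟩ := Metric.isOpen_iff.mp hZo z hzZ
    refine DifferentiableAt.fun_sum fun j _ => (h.good j).differentiableAt_integral
      (G := fun z w => (w - z)⁻¹ • ψ w) (s := ball z (ε / 2)) (C := ((ε / 2) ^ 2)⁻¹ * M)
      (ball_mem_nhds z (by linarith)) (fun y hy => ?_) (fun t ht y hy => ?_) (fun t ht y hy => ?_)
    · refine ContinuousOn.smul (ContinuousOn.inv₀ (by fun_prop) ?_) (hψ.continuousOn.mono (hγV j))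
      rintro _ ⟨t, ht, rfl⟩
      exact sub_ne_zero.mpr (hne y (hεZ (ball_subset_ball (by linarith) hy)) j t ht)
    · have : γ j t - y ≠ 0 := sub_ne_zero.mpr
        (hne y (hεZ (ball_subset_ball (by linarith) hy)) j t ht)
      fun_prop (disch := assumption)
    · have hy0 : γ j t - y ≠ 0 := sub_ne_zero.mpr
        (hne y (hεZ (ball_subset_ball (by linarith) hy)) j t ht)
      have hd : HasDerivAt (fun y => (γ j t - y)⁻¹ • ψ (γ j t))
          ((-(-1) / (γ j t - y) ^ 2) • ψ (γ j t)) y :=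
        (((hasDerivAt_id y).const_sub (γ j t)).fun_inv hy0).smul_const _
      rw [hd.deriv, norm_smul]
      refine mul_le_mul ?_ (hM j t ht).1 (norm_nonneg _) (by positivity)
      have hge : ε / 2 ≤ ‖γ j t - y‖ := by
        have h1 : ε ≤ dist (γ j t) z := by
          by_contra hlt
          exact hγZ j t ht (hεZ (not_le.mp hlt))
        have h2 : dist (γ j t) z ≤ dist (γ j t) y + dist y z := dist_triangle _ _ _
        rw [mem_ball] at hy
        rw [← dist_eq_norm]
        linarith
      rw [neg_neg, norm_div, norm_one, norm_pow, one_div]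
      exact inv_anti₀ (by positivity) (pow_le_pow_left₀ (by positivity) hge 2)
  have hH : Differentiable ℂ H := fun z => by
    have hz : z ∈ V ∪ Z := hVZ ▸ mem_univ z
    rcases hz with hz | hz
    · refine (d₁ z hz).congr_of_eventuallyEq ?_
      filter_upwards [hV.mem_nhds hz] with y hy using h12 y hy
    · refine (d₂ z hz).congr_of_eventuallyEq ?_
      filter_upwards [hZo.mem_nhds hz] with y hy
      simp [H, hy]
  have hlim : Tendsto H (cocompact ℂ) (𝓝 0) := by
    set Λ := ∑ j, ∫ t in (0 : ℝ)..1, ‖deriv (γ j) t‖ with hΛ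
    have hT : Tendsto (fun z : ℂ => Λ * ((‖z‖ - M)⁻¹ * M)) (cocompact ℂ) (𝓝 0) := by
      have : Tendsto (fun z : ℂ => ‖z‖ - M) (cocompact ℂ) atTop :=
        tendsto_atTop_add_const_right _ _ tendsto_norm_cocompact_atTop
      simpa using (this.inv_tendsto_atTop.mul_const M).const_mul Λ
    refine squeeze_zero_norm' ?_ hT
    have e1 : ∀ᶠ z in cocompact ℂ, z ∈ Z := by
      rw [← Metric.cobounded_eq_cocompact]
      have := Bornology.isBounded_def.mp hZb
      rwa [compl_compl] at this
    have e2 : ∀ᶠ z : ℂ in cocompact ℂ, M < ‖z‖ :=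
      tendsto_norm_cocompact_atTop.eventually_gt_atTop M
    filter_upwards [e1, e2] with z hz1 hz2
    simp only [H, hz1, if_true, h₂, cycleIntegral]
    rw [hΛ, Finset.sum_mul]
    refine (norm_sum_le _ _).trans (Finset.sum_le_sum fun j _ => ?_)
    refine (h.good j).norm_integral_le (F := fun w => (w - z)⁻¹ • ψ w) fun t ht => ?_
    rw [norm_smul, norm_inv]
    refine mul_le_mul ?_ (hM j t ht).1 (norm_nonneg _) (by rw [inv_nonneg]; linarith)
    refine inv_anti₀ (by linarith) ?_
    rw [norm_sub_rev]
    linarith [norm_sub_norm_le z (γ j t), (hM j t ht).2]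
  have h0 := hH.apply_eq_of_tendsto_cocompact z hlim
  rw [h12 z (h.subset hz)] at h0
  simp only [h₁] at h0
  rw [cycleIntegral_dslope h.good hψ.continuousOn h.mem (fun j t ht e => h.notMem j t ht (e ▸ hz)),
    h.wind z hz, sub_eq_zero] at h0
  exact h0

end CauchyFormula

variable {n : ℕ}

/-! ### Existence of cycles -/

/-- Inside the interval `deriv` agrees with the continuous `derivWithin`; its values at the two
endpoints do not matter. -/
lemma integrableOn_deriv_of_contDiffOn {γ : ℝ → ℂ} {a b : ℝ} (hab : a < b)
    (h : ContDiffOn ℝ 1 γ (Icc a b)) : IntegrableOn (deriv γ) (Icc a b) := by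
  rw [integrableOn_Icc_iff_integrableOn_Ioo]
  have hc : ContinuousOn (derivWithin γ (Icc a b)) (Icc a b) :=
    h.continuousOn_derivWithin (uniqueDiffOn_Icc hab) le_rfl
  refine (hc.integrableOn_Icc.mono_set Ioo_subset_Icc_self).congr_fun (fun t ht => ?_)
    measurableSet_Ioo
  exact derivWithin_of_mem_nhds (Icc_mem_nhds ht.1 ht.2)

lemma IsPiecewiseC1Jordan.isGoodPath {γ : ℝ → ℂ} (h : IsPiecewiseC1Jordan γ) : IsGoodPath γ := by
  obtain ⟨hc, -, -, k, t, ht, h0, h1, hd⟩ := h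
  refine ⟨hc, ?_⟩
  rw [intervalIntegrable_iff_integrableOn_Ioc_of_le zero_le_one]
  have hcov : ∀ j : Fin (k + 1), Ioc 0 (t j) ⊆ ⋃ i : Fin k, Icc (t i.castSucc) (t i.succ) := by
    intro j
    induction j using Fin.induction with
    | zero => simp [h0]
    | succ i ih =>
      intro x hx
      rcases le_or_gt x (t i.castSucc) with hle | hgt
      · exact ih ⟨hx.1, hle⟩
      · exact mem_iUnion.mpr ⟨i, hgt.le, hx.2⟩
  have := hcov (Fin.last k)
  rw [h1] at this
  refine IntegrableOn.mono_set ?_ this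
  rw [integrableOn_finite_iUnion]
  exact fun i => integrableOn_deriv_of_contDiffOn (ht Fin.castSucc_lt_succ) (hd i)

/-- The complement of `closure Ω` serves as the exterior: together with any neighbourhood `V` of the
closure it covers the plane. -/
lemma IsOrientedBoundary.isCauchyCycle {m : ℕ} {γ : Fin m → ℝ → ℂ} {Ω V : Set ℂ}
    (h : IsOrientedBoundary γ Ω) (ho : IsOpen Ω) (hb : Bornology.IsBounded Ω)
    (hV : closure Ω ⊆ V) : IsCauchyCycle γ V Ω := by
  obtain ⟨hj, -, hf, hw, hw0⟩ := h
  have hfr : ∀ j, ∀ t ∈ Icc (0 : ℝ) 1, γ j t ∈ frontier Ω := fun j t ht => by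
    rw [← hf]; exact mem_iUnion.mpr ⟨j, mem_image_of_mem _ ht⟩
  have hpi : (2 * Real.pi * Complex.I : ℂ) ≠ 0 := Complex.two_pi_I_ne_zero
  have hsum : ∀ z, cycleIntegral γ (fun w => (w - z)⁻¹) =
      (2 * Real.pi * Complex.I) * ∑ j, windingNumber (γ j) z := fun z => by
    simp only [cycleIntegral, windingNumber, ← Finset.mul_sum, smul_eq_mul, div_eq_mul_inv, one_mul]
    rw [← mul_assoc, mul_inv_cancel₀ hpi, one_mul]
  refine ⟨fun j => (hj j).isGoodPath, fun j t ht => hV (frontier_subset_closure (hfr j t ht)), ho,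
    subset_closure.trans hV, fun j t ht hm => ?_, fun z hz => ?_, (closure Ω)ᶜ,
    isClosed_closure.isOpen_compl, ?_, ?_, fun j t ht hm => ?_, fun z hz => ?_⟩
  · have := hfr j t ht
    rw [ho.frontier_eq] at this
    exact this.2 hm
  · rw [hsum, hw z hz, mul_one]
  · exact univ_subset_iff.mp fun z _ => (em (z ∈ closure Ω)).imp (fun h => hV h) id
  · rw [compl_compl]; exact hb.closure
  · exact hm (frontier_subset_closure (hfr j t ht))
  · rw [hsum, hw0 z hz, mul_zero]

/-- The circle with centre `c` and radius `r`, parametrized by `[0, 1]`. -/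
def circlePath (c : ℂ) (r t : ℝ) : ℂ := circleMap c r (2 * Real.pi * t)

lemma deriv_circlePath (c : ℂ) (r t : ℝ) :
    deriv (circlePath c r) t = (2 * Real.pi) • deriv (circleMap c r) (2 * Real.pi * t) := by
  exact deriv_comp_mul_left (2 * Real.pi) (circleMap c r) t

lemma isGoodPath_circlePath (c : ℂ) (r : ℝ) : IsGoodPath (circlePath c r) := by
  refine ⟨?_, ?_⟩
  · have : Continuous (circlePath c r) := by unfold circlePath; fun_prop
    exact this.continuousOn
  · refine Continuous.intervalIntegrable ?_ _ _
    simp only [funext (deriv_circlePath c r), deriv_circleMap]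
    fun_prop

lemma integral_circlePath {E : Type*} [NormedAddCommGroup E] [NormedSpace ℂ E] (c : ℂ) (r : ℝ)
    (F : ℂ → E) :
    ∫ t in (0 : ℝ)..1, deriv (circlePath c r) t • F (circlePath c r t) = circleIntegral F c r := by
  simp only [deriv_circlePath, circlePath, smul_assoc, intervalIntegral.integral_smul]
  rw [intervalIntegral.smul_integral_comp_mul_left
    (fun θ => deriv (circleMap c r) θ • F (circleMap c r θ))]
  simp [circleIntegral]

lemma circleIntegral_inv_of_notMem {c z : ℂ} {r : ℝ} (hr : 0 < r) (hz : z ∉ closedBall c r) :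
    circleIntegral (fun w => (w - z)⁻¹) c r = 0 := by
  have hne : ∀ w ∈ closedBall c r, w - z ≠ 0 := fun w hw e => hz (by rwa [sub_eq_zero.mp e] at hw)
  refine Complex.circleIntegral_eq_zero_of_differentiable_on_off_countable hr.le countable_empty
    (ContinuousOn.inv₀ (by fun_prop) hne) fun w hw => ?_
  have := hne w (ball_subset_closedBall hw.1)
  fun_prop (disch := assumption)

lemma isCauchyCycle_circles {m : ℕ} {c : Fin m → ℂ} {r : ℝ} (hr : 0 < r) {V : Set ℂ}
    (hV : ∀ j, closedBall (c j) r ⊆ V)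
    (hd : ∀ i j, i ≠ j → Disjoint (closedBall (c i) r) (closedBall (c j) r)) :
    IsCauchyCycle (fun j => circlePath (c j) r) V (⋃ j, ball (c j) r) := by
  have hsph : ∀ j t, circlePath (c j) r t ∈ sphere (c j) r := fun j t =>
    circleMap_mem_sphere _ hr.le _
  have hci : ∀ z, cycleIntegral (fun j => circlePath (c j) r) (fun w => (w - z)⁻¹) =
      ∑ j, circleIntegral (fun w => (w - z)⁻¹) (c j) r := fun z =>
    Finset.sum_congr rfl fun j _ => integral_circlePath (E := ℂ) (c j) r fun w => (w - z)⁻¹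
  refine ⟨fun j => isGoodPath_circlePath _ _, fun j t _ => hV j (sphere_subset_closedBall (hsph j t)),
    isOpen_iUnion fun j => isOpen_ball,
    iUnion_subset fun j => ball_subset_closedBall.trans (hV j), fun j t _ hm => ?_, fun z hz => ?_,
    (⋃ j, closedBall (c j) r)ᶜ, (isClosed_iUnion_of_finite fun j => isClosed_closedBall).isOpen_compl,
    ?_, ?_, fun j t _ hm => ?_, fun z hz => ?_⟩
  · obtain ⟨i, hi⟩ := mem_iUnion.mp hm
    by_cases hij : i = j
    · subst hij
      have := hsph i t
      rw [mem_sphere] at this; rw [mem_ball] at hi; linarith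
    · exact (hd i j hij).le_bot ⟨ball_subset_closedBall hi, sphere_subset_closedBall (hsph j t)⟩
  · obtain ⟨i, hi⟩ := mem_iUnion.mp hz
    rw [hci, Finset.sum_eq_single i, circleIntegral.integral_sub_inv_of_mem_ball hi]
    · intro j _ hji
      exact circleIntegral_inv_of_notMem hr fun hj =>
        (hd j i hji).le_bot ⟨hj, ball_subset_closedBall hi⟩
    · simp
  · refine univ_subset_iff.mp fun z _ => (em (z ∈ ⋃ j, closedBall (c j) r)).imp (fun h => ?_) id
    obtain ⟨j, hj⟩ := mem_iUnion.mp h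
    exact hV j hj
  · rw [compl_compl]
    exact Bornology.isBounded_iUnion.mpr fun j => isBounded_closedBall
  · exact hm (mem_iUnion.mpr ⟨j, sphere_subset_closedBall (hsph j t)⟩)
  · rw [hci]
    exact Finset.sum_eq_zero fun j _ => circleIntegral_inv_of_notMem hr fun hj =>
      hz (mem_iUnion.mpr ⟨j, hj⟩)

/-- Regularity is local and needs no Cauchy domain: small circles about `z₁` and its conjugate
suffice, a single one if `z₁` is real. The symmetry of `O` places both zeros of `quad` in `O`. -/
lemma exists_isCauchyCycle {V : Set ℂ} (hV : IsOpen V)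
    (hsym : ∀ z ∈ V, (starRingEnd ℂ) z ∈ V) {z₁ : ℂ} (hz₁ : z₁ ∈ V) (him : 0 ≤ z₁.im) :
    ∃ (m : ℕ) (γ : Fin m → ℝ → ℂ) (O : Set ℂ), IsCauchyCycle γ V O ∧ z₁ ∈ O ∧
      ∀ z ∈ O, (starRingEnd ℂ) z ∈ O := by
  obtain ⟨ε, hε, hεV⟩ := Metric.isOpen_iff.mp hV z₁ hz₁
  have hconj : ∀ (c w : ℂ) (r : ℝ), w ∈ ball c r → (starRingEnd ℂ) w ∈ ball ((starRingEnd ℂ) c) r :=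
    fun c w r h => by
      rw [mem_ball, Complex.dist_conj_conj]; exact h
  rcases him.eq_or_lt with h0 | hpos
  · refine ⟨1, _, _, isCauchyCycle_circles (c := fun _ => z₁) (r := ε / 2) (by linarith)
      (fun j => (closedBall_subset_ball (by linarith)).trans hεV)
      (fun i j hij => (hij (Subsingleton.elim _ _)).elim), ?_, fun z hz => ?_⟩
    · exact mem_iUnion.mpr ⟨0, mem_ball_self (by linarith)⟩
    · obtain ⟨j, hj⟩ := mem_iUnion.mp hz
      have hz1 : (starRingEnd ℂ) z₁ = z₁ := Complex.conj_eq_iff_im.mpr h0.symm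
      have := hconj _ _ _ hj
      rw [hz1] at this
      exact mem_iUnion.mpr ⟨j, this⟩
  -- A radius below `z₁.im` keeps the two discs in opposite half-planes, hence disjoint.
  · set r := min (ε / 2) (z₁.im / 2) with hr
    have hr0 : 0 < r := lt_min (by linarith) (by linarith)
    have hrε : r < ε := (min_le_left _ _).trans_lt (by linarith)
    have hri : r < z₁.im := (min_le_right _ _).trans_lt (by linarith)
    have hup : ∀ w ∈ closedBall z₁ r, 0 < w.im := fun w hw => by
      have h1 : |(w - z₁).im| ≤ r := (Complex.abs_im_le_norm _).trans (by
        rwa [mem_closedBall, dist_eq_norm] at hw)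
      rw [Complex.sub_im] at h1
      linarith [(abs_le.mp h1).1]
    have hdown : ∀ w ∈ closedBall ((starRingEnd ℂ) z₁) r, (starRingEnd ℂ) w ∈ closedBall z₁ r :=
      fun w hw => by
        rw [mem_closedBall] at hw ⊢
        rw [← Complex.dist_conj_conj, Complex.conj_conj]; exact hw
    have hdisj : Disjoint (closedBall z₁ r) (closedBall ((starRingEnd ℂ) z₁) r) := by
      rw [Set.disjoint_left]
      intro w hw hw'
      have h1 := hup w hw
      have h2 := hup _ (hdown w hw')
      rw [Complex.conj_im] at h2
      linarith
    refine ⟨2, _, _, isCauchyCycle_circles (c := ![z₁, (starRingEnd ℂ) z₁]) (r := r) hr0 ?_ ?_,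
      ?_, ?_⟩
    · intro j
      fin_cases j
      · exact (closedBall_subset_ball hrε).trans hεV
      · intro w hw
        have := hsym _ (hεV ((closedBall_subset_ball hrε) (hdown w hw)))
        rwa [Complex.conj_conj] at this
    · intro i j hij
      fin_cases i <;> fin_cases j
      · exact (hij rfl).elim
      · exact hdisj
      · exact hdisj.symm
      · exact (hij rfl).elim
    · exact mem_iUnion.mpr ⟨0, mem_ball_self hr0⟩
    · intro z hz
      obtain ⟨j, hj⟩ := mem_iUnion.mp hz
      fin_cases j
      · exact mem_iUnion.mpr ⟨1, hconj _ _ _ hj⟩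
      · have := hconj _ _ _ hj
        simp only [Fin.mk_one, Fin.isValue, Matrix.cons_val_one, Matrix.cons_val_fin_one,
          Complex.conj_conj] at this
        exact mem_iUnion.mpr ⟨0, this⟩

/-! ### Families of radial functions -/

/-- The square `x₁² + ⋯ + xₙ²` of the norm of the vector part. -/
def vecNormSq (x : Para n) : ℝ := ∑ i : Fin n, x i.succ ^ 2

/-- The linear form `y ↦ x₁ y₁ + ⋯ + xₙ yₙ`. -/
def vecInner (x : Para n) : Para n →L[ℝ] ℝ :=
  ∑ i : Fin n, x i.succ • (EuclideanSpace.proj i.succ : Para n →L[ℝ] ℝ)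

/-- The linear form `y ↦ y₀`. -/
def scalarPart : Para n →L[ℝ] ℝ := EuclideanSpace.proj 0

@[simp] lemma scalarPart_apply (x : Para n) : scalarPart x = x 0 := rfl

lemma vecInner_apply (x y : Para n) : vecInner x y = ∑ i : Fin n, x i.succ * y i.succ := by
  simp [vecInner, sum_apply]

lemma vecNormSq_eq (x : Para n) : vecNormSq x = ‖vecPart x‖ ^ 2 := by
  simp [vecNormSq, EuclideanSpace.real_norm_sq_eq, vecPart]

lemma hasFDerivAt_vecNormSq (x : Para n) :
    HasFDerivAt (vecNormSq (n := n)) ((2 : ℝ) • vecInner x) x := by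
  have h : ∀ i : Fin n, HasFDerivAt (fun y : Para n => y i.succ ^ 2)
      ((2 * x i.succ) • (EuclideanSpace.proj i.succ : Para n →L[ℝ] ℝ)) x :=
    fun i => by
      have := ((EuclideanSpace.proj i.succ : Para n →L[ℝ] ℝ).hasFDerivAt (x := x)).pow 2
      simpa using! this
  have : HasFDerivAt (vecNormSq (n := n)) _ x :=
    HasFDerivAt.fun_sum (u := Finset.univ) fun i _ => h i
  refine this.congr_fderiv ?_
  simp [vecInner, Finset.smul_sum, smul_smul]

lemma continuous_vecInner : Continuous (vecInner (n := n)) := by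
  unfold vecInner
  fun_prop

lemma continuous_vecNormSq : Continuous (vecNormSq (n := n)) := by
  unfold vecNormSq
  fun_prop

/-- The linear map `y ↦ y₀ A + (x₁ y₁ + ⋯ + xₙ yₙ) B`. -/
def radialDeriv {F : Type*} [NormedAddCommGroup F] [NormedSpace ℝ F] (x : Para n) (A B : F) :
    Para n →L[ℝ] F :=
  scalarPart.smulRight A + (vecInner x).smulRight B

section Family

variable {F F' : Type*} [NormedAddCommGroup F] [NormedSpace ℝ F] [NormedAddCommGroup F']
  [NormedSpace ℝ F']

@[simp] lemma radialDeriv_apply (x y : Para n) (A B : F) :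
    radialDeriv x A B y = y 0 • A + vecInner x y • B := by
  simp [radialDeriv]

/-- Families of functions on `O` that behave like the integrals over `s` of
`(s - x₀)^a ((s - x₀)² + |x̲|²)^(-k)` against a fixed measure. -/
structure IsRadialFamily (O : Set (Para n)) (q : ℕ → ℕ → Para n → F) : Prop where
  isOpen : IsOpen O
  reflect : ∀ x ∈ O, ∀ y : Para n, y 0 = x 0 → vecNormSq y = vecNormSq x → y ∈ O
  hasFDerivAt : ∀ a k, ∀ x ∈ O, HasFDerivAt (q a k)
    (radialDeriv x ((2 * k : ℝ) • q (a + 1) (k + 1) x - (a : ℝ) • q (a - 1) k x)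
      (-(2 * k : ℝ) • q a (k + 1) x)) x
  sq : ∀ a k, ∀ x ∈ O, q (a + 2) (k + 1) x = q a k x - vecNormSq x • q a (k + 1) x
  axial : ∀ a k, ∀ x ∈ O, ∀ y : Para n, y 0 = x 0 → vecNormSq y = vecNormSq x → q a k y = q a k x

lemma IsRadialFamily.comp {O : Set (Para n)} {q : ℕ → ℕ → Para n → F} (h : IsRadialFamily O q)
    (L : F →L[ℝ] F') : IsRadialFamily O (fun a k x => L (q a k x)) := by
  refine ⟨h.isOpen, h.reflect, fun a k x hx => ?_, fun a k x hx => ?_, fun a k x hx y h0 h1 => ?_⟩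
  · refine (L.hasFDerivAt.comp x (h.hasFDerivAt a k x hx)).congr_fderiv ?_
    ext y
    simp
  · simp [h.sq a k x hx]
  · simp [h.axial a k x hx y h0 h1]

/-- The derivative of a member is built from members and linear forms, so differentiability of all
members bootstraps to smoothness. -/
lemma IsRadialFamily.contDiffOn {O : Set (Para n)} {q : ℕ → ℕ → Para n → F}
    (h : IsRadialFamily O q) (a k : ℕ) : ContDiffOn ℝ ∞ (q a k) O := by
  rw [contDiffOn_infty]
  intro N
  induction N generalizing a k with
  | zero => exact contDiffOn_zero.mpr fun x hx =>
      (h.hasFDerivAt a k x hx).continuousAt.continuousWithinAt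
  | succ N ih =>
    push_cast
    rw [contDiffOn_succ_iff_fderiv_of_isOpen h.isOpen]
    refine ⟨fun x hx => (h.hasFDerivAt a k x hx).differentiableAt.differentiableWithinAt,
      by simp, ?_⟩
    have hv : ContDiff ℝ N (vecInner (n := n)) := by unfold vecInner; fun_prop
    have key : ContDiffOn ℝ N (fun x => radialDeriv x
        ((2 * k : ℝ) • q (a + 1) (k + 1) x - (a : ℝ) • q (a - 1) k x)
        (-(2 * k : ℝ) • q a (k + 1) x)) O := by
      unfold radialDeriv
      refine ContDiffOn.add ?_ ?_
      · exact (ContinuousLinearMap.smulRightL ℝ (Para n) F scalarPart).contDiff.comp_contDiffOn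
          (((ih (a + 1) (k + 1)).const_smul (2 * k : ℝ)).sub ((ih (a - 1) k).const_smul (a : ℝ)))
      · exact ContDiffOn.clm_apply ((ContinuousLinearMap.smulRightL ℝ (Para n)
          F).contDiff.comp_contDiffOn hv.contDiffOn) ((ih a (k + 1)).const_smul (-(2 * k : ℝ)))
    exact key.congr fun x hx => (h.hasFDerivAt a k x hx).fderiv

end Family

/-! ### Integrals of the kernels -/

/-- `(s - x₀)² + |x̲|²`. -/
def quad (x : Para n) (s : ℂ) : ℂ := (s - x 0) ^ 2 + vecNormSq x

/-- `s^b (s - x₀)^a ((s - x₀)² + |x̲|²)^(-k)`. -/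
def kernelFun (b a k : ℕ) (x : Para n) (s : ℂ) : ℂ := s ^ b * (s - x 0) ^ a * (quad x s)⁻¹ ^ k

/-- The point `x₀ + i |x̲|`. -/
def upperPoint (x : Para n) : ℂ := ⟨x 0, ‖vecPart x‖⟩

/-- The factors allow Cauchy's formula at two conjugate points, whereas the definition of `quad`
contains only `|x̲|²`, which is smooth where `|x̲|` is not. -/
lemma quad_eq (x : Para n) (s : ℂ) :
    quad x s = (s - upperPoint x) * (s - (starRingEnd ℂ) (upperPoint x)) := by
  have h1 : upperPoint x = x 0 + ‖vecPart x‖ * Complex.I := by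
    rw [upperPoint, Complex.mk_eq_add_mul_I]
  have hI : Complex.I ^ 2 = -1 := Complex.I_sq
  rw [quad, vecNormSq_eq, h1]
  simp only [map_add, map_mul, Complex.conj_ofReal, Complex.conj_I, Complex.ofReal_pow]
  linear_combination ((‖vecPart x‖ : ℂ) ^ 2) * hI

lemma continuous_vecPart : Continuous (vecPart (n := n)) := by
  unfold vecPart; fun_prop

lemma continuous_upperPoint : Continuous (upperPoint (n := n)) := by
  have : upperPoint (n := n) = fun x => (x 0 : ℂ) + (‖vecPart x‖ : ℂ) * Complex.I := by
    ext1 x; rw [upperPoint, Complex.mk_eq_add_mul_I]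
  rw [this]
  have := continuous_vecPart (n := n)
  fun_prop

lemma hasFDerivAt_coord_zero (x : Para n) :
    HasFDerivAt (fun y : Para n => ((y 0 : ℝ) : ℂ)) (Complex.ofRealCLM ∘L scalarPart) x :=
  (Complex.ofRealCLM ∘L (scalarPart (n := n))).hasFDerivAt (x := x)

lemma hasFDerivAt_quad (x : Para n) (s : ℂ) :
    HasFDerivAt (fun y => quad y s) (radialDeriv x (-2 * (s - x 0)) 2) x := by
  have h1 := ((hasFDerivAt_coord_zero x).const_sub s).pow 2
  have h2 := Complex.ofRealCLM.hasFDerivAt.comp x (hasFDerivAt_vecNormSq x)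
  refine (h1.add h2).congr_fderiv ?_
  ext y
  simp
  ring

lemma hasFDerivAt_kernelFun (b a k : ℕ) (x : Para n) (s : ℂ) (hs : quad x s ≠ 0) :
    HasFDerivAt (fun y => kernelFun b a k y s)
      (radialDeriv x ((2 * k : ℝ) • kernelFun b (a + 1) (k + 1) x s -
        (a : ℝ) • kernelFun b (a - 1) k x s) (-(2 * k : ℝ) • kernelFun b a (k + 1) x s)) x := by
  have h1 := ((hasFDerivAt_coord_zero x).const_sub s).pow a
  have hq : HasDerivAt (fun q : ℂ => q⁻¹ ^ k) (-(k : ℂ) * (quad x s)⁻¹ ^ (k + 1)) (quad x s) := by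
    refine ((hasDerivAt_inv hs).fun_pow k).congr_deriv ?_
    rcases k with _ | k
    · simp
    · simp only [Nat.add_sub_cancel, inv_pow]
      field_simp
      ring
  have h2 := hq.comp_hasFDerivAt x (hasFDerivAt_quad x s)
  have h3 := (h1.const_mul (s ^ b)).mul h2
  refine h3.congr_fderiv ?_
  ext y
  simp [kernelFun]
  ring

lemma kernelFun_sq (b a k : ℕ) (x : Para n) (s : ℂ) (hs : quad x s ≠ 0) :
    kernelFun b (a + 2) (k + 1) x s =
      kernelFun b a k x s - vecNormSq x • kernelFun b a (k + 1) x s := by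
  have h : (s - x 0) ^ 2 * (quad x s)⁻¹ = 1 - vecNormSq x * (quad x s)⁻¹ := by
    rw [eq_sub_iff_add_eq, ← add_mul]
    exact mul_inv_cancel₀ hs
  rw [Complex.real_smul]
  simp only [kernelFun, pow_succ (quad x s)⁻¹, pow_add (s - x 0 : ℂ) a 2]
  linear_combination (s ^ b * (s - x 0) ^ a * (quad x s)⁻¹ ^ k) * h

/-! ### Cycle integrals of the kernels and Cauchy's formula at conjugate points -/

section Integrals

variable {E : Type*} [NormedAddCommGroup E] [NormedSpace ℂ E]

lemma cycleIntegral_add {m : ℕ} {γ : Fin m → ℝ → ℂ} (hγ : ∀ j, IsGoodPath (γ j)) {F G : ℂ → E}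
    (hF : ∀ j, ContinuousOn F (γ j '' Icc 0 1)) (hG : ∀ j, ContinuousOn G (γ j '' Icc 0 1)) :
    cycleIntegral γ (fun s => F s + G s) = cycleIntegral γ F + cycleIntegral γ G := by
  unfold cycleIntegral
  rw [← Finset.sum_add_distrib]
  refine Finset.sum_congr rfl fun j _ => ?_
  rw [← intervalIntegral.integral_add ((hγ j).intervalIntegrable (hF j))
    ((hγ j).intervalIntegrable (hG j))]
  simp only [smul_add]

lemma cycleIntegral_smul {m : ℕ} {γ : Fin m → ℝ → ℂ} (F : ℂ → E) (c : ℂ) :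
    cycleIntegral γ (fun s => c • F s) = c • cycleIntegral γ F := by
  unfold cycleIntegral
  rw [Finset.smul_sum]
  refine Finset.sum_congr rfl fun j _ => ?_
  rw [← intervalIntegral.integral_smul]
  simp only [smul_comm c]

lemma cycleIntegral_real_smul {m : ℕ} {γ : Fin m → ℝ → ℂ} (F : ℂ → E) (c : ℝ) :
    cycleIntegral γ (fun s => c • F s) = c • cycleIntegral γ F := by
  simpa using cycleIntegral_smul (γ := γ) F (c : ℂ)

lemma cycleIntegral_sub {m : ℕ} {γ : Fin m → ℝ → ℂ} (hγ : ∀ j, IsGoodPath (γ j)) {F G : ℂ → E}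
    (hF : ∀ j, ContinuousOn F (γ j '' Icc 0 1)) (hG : ∀ j, ContinuousOn G (γ j '' Icc 0 1)) :
    cycleIntegral γ (fun s => F s - G s) = cycleIntegral γ F - cycleIntegral γ G := by
  have := cycleIntegral_add hγ hF (G := fun s => (-1 : ℂ) • G s) fun j => (hG j).const_smul _
  rw [cycleIntegral_smul] at this
  simpa [sub_eq_add_neg] using this

/-- `(2πi)⁻¹ ∮ s^b (s - x₀)^a ((s - x₀)² + |x̲|²)^(-k) ψ(s) ds`. -/
def kernelIntegral {m : ℕ} (γ : Fin m → ℝ → ℂ) (ψ : ℂ → E) (b a k : ℕ) (x : Para n) : E :=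
  (2 * Real.pi * Complex.I : ℂ)⁻¹ • cycleIntegral γ (fun s => kernelFun b a k x s • ψ s)

lemma IsCauchyCycle.quad_ne_zero {m : ℕ} {γ : Fin m → ℝ → ℂ} {V O : Set ℂ}
    (h : IsCauchyCycle γ V O) (hO : ∀ z ∈ O, (starRingEnd ℂ) z ∈ O) {x : Para n}
    (hx : upperPoint x ∈ O) (j : Fin m) {s : ℂ} (hs : s ∈ γ j '' Icc 0 1) : quad x s ≠ 0 := by
  obtain ⟨t, ht, rfl⟩ := hs
  rw [quad_eq]
  refine mul_ne_zero ?_ ?_ <;> rw [sub_ne_zero] <;> intro e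
  · exact h.notMem j t ht (e ▸ hx)
  · exact h.notMem j t ht (e ▸ hO _ hx)

lemma continuousOn_kernelFun {T : Set (Para n × ℂ)} (hT : ∀ p ∈ T, quad p.1 p.2 ≠ 0) (b a k : ℕ) :
    ContinuousOn (fun p : Para n × ℂ => kernelFun b a k p.1 p.2) T := by
  have hq : Continuous fun p : Para n × ℂ => quad p.1 p.2 := by
    have := continuous_vecNormSq (n := n)
    unfold quad
    fun_prop
  unfold kernelFun
  exact ContinuousOn.mul (by fun_prop) ((hq.continuousOn.inv₀ hT).pow k)

lemma IsCauchyCycle.continuousOn_kernelFun_smul {m : ℕ} {γ : Fin m → ℝ → ℂ} {V O : Set ℂ}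
    (h : IsCauchyCycle γ V O) (hO : ∀ z ∈ O, (starRingEnd ℂ) z ∈ O) {ψ : ℂ → E}
    (hψ : ContinuousOn ψ V) (b a k : ℕ) {x : Para n} (hx : upperPoint x ∈ O) (j : Fin m) :
    ContinuousOn (fun s => kernelFun b a k x s • ψ s) (γ j '' Icc 0 1) := by
  refine ContinuousOn.smul ?_ (hψ.mono (by rintro _ ⟨t, ht, rfl⟩; exact h.mem j t ht))
  exact (continuousOn_kernelFun (T := {x} ×ˢ (γ j '' Icc 0 1)) (by
    rintro ⟨y, s⟩ ⟨rfl, hs⟩; exact h.quad_ne_zero hO hx j hs) b a k).comp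
      (f := fun s => (x, s)) (by fun_prop) fun s hs => ⟨rfl, hs⟩

variable [CompleteSpace E]

lemma IsGoodPath.integral_radialDeriv {γ : ℝ → ℂ} (hγ : IsGoodPath γ) (x : Para n) {A B : ℂ → E}
    (hA : ContinuousOn A (γ '' Icc 0 1)) (hB : ContinuousOn B (γ '' Icc 0 1)) :
    ∫ t in (0 : ℝ)..1, deriv γ t • radialDeriv x (A (γ t)) (B (γ t)) =
      radialDeriv x (∫ t in (0 : ℝ)..1, deriv γ t • A (γ t))
        (∫ t in (0 : ℝ)..1, deriv γ t • B (γ t)) := by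
  have key : ∀ t, deriv γ t • radialDeriv x (A (γ t)) (B (γ t)) =
      ContinuousLinearMap.smulRightL ℝ (Para n) E scalarPart (deriv γ t • A (γ t)) +
      ContinuousLinearMap.smulRightL ℝ (Para n) E (vecInner x) (deriv γ t • B (γ t)) := fun t => by
    ext y
    simp [smul_comm (deriv γ t)]
  have iA := hγ.intervalIntegrable hA
  have iB := hγ.intervalIntegrable hB
  simp only [key]
  rw [intervalIntegral.integral_add, ContinuousLinearMap.intervalIntegral_comp_comm _ iA,
    ContinuousLinearMap.intervalIntegral_comp_comm _ iB]
  · rfl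
  · exact ⟨ContinuousLinearMap.integrable_comp _ iA.1, ContinuousLinearMap.integrable_comp _ iA.2⟩
  · exact ⟨ContinuousLinearMap.integrable_comp _ iB.1, ContinuousLinearMap.integrable_comp _ iB.2⟩

lemma IsCauchyCycle.hasFDerivAt_kernelIntegral {m : ℕ} {γ : Fin m → ℝ → ℂ} {V O : Set ℂ}
    (h : IsCauchyCycle γ V O) (hO : ∀ z ∈ O, (starRingEnd ℂ) z ∈ O) {ψ : ℂ → E}
    (hψ : ContinuousOn ψ V) (b a k : ℕ) {x₀ : Para n} (hx₀ : upperPoint x₀ ∈ O) :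
    HasFDerivAt (kernelIntegral γ ψ b a k)
      (radialDeriv x₀ ((2 * k : ℝ) • kernelIntegral γ ψ b (a + 1) (k + 1) x₀ -
        (a : ℝ) • kernelIntegral γ ψ b (a - 1) k x₀)
        (-(2 * k : ℝ) • kernelIntegral γ ψ b a (k + 1) x₀)) x₀ := by
  set D₁ : Para n → ℂ → E := fun x s => (2 * k : ℝ) • (kernelFun b (a + 1) (k + 1) x s • ψ s) -
    (a : ℝ) • (kernelFun b (a - 1) k x s • ψ s) with hD₁
  set D₂ : Para n → ℂ → E := fun x s => -(2 * k : ℝ) • (kernelFun b a (k + 1) x s • ψ s) with hD₂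
  have hc := fun a k j => h.continuousOn_kernelFun_smul hO hψ b a k hx₀ j
  have hcD₁ : ∀ j, ContinuousOn (D₁ x₀) (γ j '' Icc 0 1) := fun j =>
    ((hc (a + 1) (k + 1) j).const_smul (2 * k : ℝ)).sub ((hc (a - 1) k j).const_smul (a : ℝ))
  have hcD₂ : ∀ j, ContinuousOn (D₂ x₀) (γ j '' Icc 0 1) := fun j =>
    (hc a (k + 1) j).const_smul (-(2 * k : ℝ))
  have hU : IsOpen (upperPoint (n := n) ⁻¹' O) := h.isOpen.preimage continuous_upperPoint
  obtain ⟨ε, hε, hεO⟩ := Metric.isOpen_iff.mp hU x₀ hx₀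
  -- For `x` in this compact ball the kernels have no pole on the paths, so their derivatives are
  -- bounded on a compact product; this is the domination needed below.
  set B := closedBall x₀ (ε / 2) with hB
  have hBO : ∀ x ∈ B, upperPoint x ∈ O := fun x hx =>
    hεO (closedBall_subset_ball (by linarith) hx)
  have hψj : ∀ j, ContinuousOn (fun p : Para n × ℂ => ψ p.2) (B ×ˢ (γ j '' Icc 0 1)) := fun j =>
    hψ.comp (by fun_prop) (by rintro ⟨x, s⟩ ⟨-, t, ht, rfl⟩; exact h.mem j t ht)
  have hker : ∀ j b a k, ContinuousOn (fun p : Para n × ℂ => kernelFun b a k p.1 p.2 • ψ p.2)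
      (B ×ˢ (γ j '' Icc 0 1)) := fun j b a k =>
    (continuousOn_kernelFun (by
      rintro ⟨x, s⟩ ⟨hx, hs⟩; exact h.quad_ne_zero hO (hBO x hx) j hs) b a k).smul (hψj j)
  have hpath : ∀ j, HasFDerivAt (fun x => ∫ t in (0 : ℝ)..1, deriv (γ j) t •
      (kernelFun b a k x (γ j t) • ψ (γ j t)))
      (radialDeriv x₀ (∫ t in (0 : ℝ)..1, deriv (γ j) t • D₁ x₀ (γ j t))
        (∫ t in (0 : ℝ)..1, deriv (γ j) t • D₂ x₀ (γ j t))) x₀ := fun j => by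
    have hcont : ContinuousOn (fun p : Para n × ℂ => radialDeriv p.1 (D₁ p.1 p.2) (D₂ p.1 p.2))
        (B ×ˢ (γ j '' Icc 0 1)) := by
      unfold radialDeriv
      refine ContinuousOn.add ?_ ?_
      · exact (ContinuousLinearMap.smulRightL ℝ (Para n) E scalarPart).continuous.comp_continuousOn
          (((hker j b (a + 1) (k + 1)).const_smul (2 * k : ℝ)).sub
            ((hker j b (a - 1) k).const_smul (a : ℝ)))
      · exact ContinuousOn.clm_apply ((ContinuousLinearMap.smulRightL ℝ (Para n)
          E).continuous.comp_continuousOn (continuous_vecInner.comp continuous_fst).continuousOn)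
          ((hker j b a (k + 1)).const_smul (-(2 * k : ℝ)))
    obtain ⟨C, hC⟩ := ((isCompact_closedBall x₀ (ε / 2)).prod
      (h.good j).isCompact).exists_bound_of_continuousOn hcont
    rw [← (h.good j).integral_radialDeriv x₀ (hcD₁ j) (hcD₂ j)]
    refine (h.good j).hasFDerivAt_integral (s := B) (C := C)
      (G := fun x s => kernelFun b a k x s • ψ s)
      (G' := fun x s => radialDeriv x (D₁ x s) (D₂ x s)) (closedBall_mem_nhds _ (by linarith))
      (fun x hx => h.continuousOn_kernelFun_smul hO hψ b a k (hBO x hx) j) ?_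
      (fun t ht x hx => ?_) (fun t ht x hx => hC (x, γ j t) ⟨hx, mem_image_of_mem _ ht⟩)
    · exact hcont.comp (f := fun s => (x₀, s)) (by fun_prop)
        fun s hs => ⟨mem_closedBall_self (by linarith), hs⟩
    · refine ((hasFDerivAt_kernelFun b a k x (γ j t) (h.quad_ne_zero hO (hBO x hx) j
        (mem_image_of_mem _ ht))).smul_const (ψ (γ j t))).congr_fderiv ?_
      ext y
      simp only [D₁, D₂, radialDeriv_apply, ContinuousLinearMap.smulRight_apply,
        ← Complex.coe_smul, smul_eq_mul]
      push_cast
      module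
  have hsum := (HasFDerivAt.fun_sum (u := Finset.univ) fun j _ => hpath j).const_smul
    ((2 * Real.pi * Complex.I : ℂ)⁻¹)
  refine hsum.congr_fderiv ?_
  have e₁ : ∑ j, ∫ t in (0 : ℝ)..1, deriv (γ j) t • D₁ x₀ (γ j t) =
      (2 * k : ℝ) • cycleIntegral γ (fun s => kernelFun b (a + 1) (k + 1) x₀ s • ψ s) -
        (a : ℝ) • cycleIntegral γ (fun s => kernelFun b (a - 1) k x₀ s • ψ s) := by
    rw [← cycleIntegral_real_smul, ← cycleIntegral_real_smul, ← cycleIntegral_sub h.good]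
    · rfl
    · exact fun j => (hc (a + 1) (k + 1) j).const_smul (2 * k : ℝ)
    · exact fun j => (hc (a - 1) k j).const_smul (a : ℝ)
  have e₂ : ∑ j, ∫ t in (0 : ℝ)..1, deriv (γ j) t • D₂ x₀ (γ j t) =
      -(2 * k : ℝ) • cycleIntegral γ (fun s => kernelFun b a (k + 1) x₀ s • ψ s) := by
    rw [← cycleIntegral_real_smul]; rfl
  ext y
  have e₃ : (∑ j, radialDeriv x₀ (∫ t in (0 : ℝ)..1, deriv (γ j) t • D₁ x₀ (γ j t))
      (∫ t in (0 : ℝ)..1, deriv (γ j) t • D₂ x₀ (γ j t))) y =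
      y 0 • (∑ j, ∫ t in (0 : ℝ)..1, deriv (γ j) t • D₁ x₀ (γ j t)) +
      vecInner x₀ y • ∑ j, ∫ t in (0 : ℝ)..1, deriv (γ j) t • D₂ x₀ (γ j t) := by
    simp only [sum_apply, radialDeriv_apply, Finset.sum_add_distrib, Finset.smul_sum]
  rw [smul_apply, e₃, e₁, e₂]
  simp only [kernelIntegral, radialDeriv_apply, smul_add, smul_sub]
  simp only [smul_comm ((2 * Real.pi * Complex.I : ℂ)⁻¹)]

lemma upperPoint_congr {x y : Para n} (h0 : y 0 = x 0) (h1 : vecNormSq y = vecNormSq x) :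
    upperPoint y = upperPoint x := by
  have : ‖vecPart y‖ = ‖vecPart x‖ := by
    rw [vecNormSq_eq, vecNormSq_eq] at h1
    exact (sq_eq_sq₀ (norm_nonneg _) (norm_nonneg _)).mp h1
  rw [upperPoint, upperPoint, h0, this]

lemma IsCauchyCycle.isRadialFamily {m : ℕ} {γ : Fin m → ℝ → ℂ} {V O : Set ℂ}
    (h : IsCauchyCycle γ V O) (hO : ∀ z ∈ O, (starRingEnd ℂ) z ∈ O) {ψ : ℂ → E}
    (hψ : ContinuousOn ψ V) (b : ℕ) :
    IsRadialFamily (upperPoint (n := n) ⁻¹' O) (kernelIntegral γ ψ b) := by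
  refine ⟨h.isOpen.preimage continuous_upperPoint, fun x hx y h0 h1 => ?_,
    fun a k x hx => h.hasFDerivAt_kernelIntegral hO hψ b a k hx, fun a k x hx => ?_,
    fun a k x hx y h0 h1 => ?_⟩
  · rw [mem_preimage, upperPoint_congr h0 h1]; exact hx
  · simp only [kernelIntegral]
    rw [smul_comm (vecNormSq x) ((2 * Real.pi * Complex.I : ℂ)⁻¹), ← smul_sub,
      ← cycleIntegral_real_smul, ← cycleIntegral_sub h.good]
    · congr 1
      refine cycleIntegral_congr fun j t ht => ?_
      rw [kernelFun_sq b a k x _ (h.quad_ne_zero hO hx j (mem_image_of_mem _ ht)), sub_smul,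
        smul_assoc]
    · exact fun j => h.continuousOn_kernelFun_smul hO hψ b a k hx j
    · exact fun j => (h.continuousOn_kernelFun_smul hO hψ b a (k + 1) hx j).const_smul (vecNormSq x)
  · simp only [kernelIntegral, kernelFun, quad, h0, h1]

-- Splitting the factor `s - x₀` trades the exponent `a` for a power of `s` and a product with the
-- coordinate `x₀`, on which `D̄` acts by the Leibniz rule. This is why powers `s^b` enter the
-- kernels.
omit [CompleteSpace E] in
lemma IsCauchyCycle.kernelIntegral_shift {m : ℕ} {γ : Fin m → ℝ → ℂ} {V O : Set ℂ}
    (h : IsCauchyCycle γ V O) (hO : ∀ z ∈ O, (starRingEnd ℂ) z ∈ O) {ψ : ℂ → E}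
    (hψ : ContinuousOn ψ V) (b a k : ℕ) {x : Para n} (hx : upperPoint x ∈ O) :
    kernelIntegral γ ψ b (a + 1) k x =
      kernelIntegral γ ψ (b + 1) a k x - x 0 • kernelIntegral γ ψ b a k x := by
  simp only [kernelIntegral]
  rw [smul_comm (x 0) ((2 * Real.pi * Complex.I : ℂ)⁻¹), ← smul_sub,
    ← cycleIntegral_real_smul, ← cycleIntegral_sub h.good]
  · congr 1
    refine cycleIntegral_congr fun j t ht => ?_
    rw [← smul_assoc, ← sub_smul, Complex.real_smul]
    congr 1
    simp only [kernelFun]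
    ring
  · exact fun j => h.continuousOn_kernelFun_smul hO hψ (b + 1) a k hx j
  · exact fun j => (h.continuousOn_kernelFun_smul hO hψ b a k hx j).const_smul (x 0)

omit [CompleteSpace E] in
lemma IsCauchyCycle.continuousOn_inv_smul {m : ℕ} {γ : Fin m → ℝ → ℂ} {V O : Set ℂ}
    (h : IsCauchyCycle γ V O) {ψ : ℂ → E} (hψ : ContinuousOn ψ V) {z : ℂ} (hz : z ∈ O) (j : Fin m) :
    ContinuousOn (fun s => (s - z)⁻¹ • ψ s) (γ j '' Icc 0 1) := by
  refine ContinuousOn.smul (ContinuousOn.inv₀ (by fun_prop) ?_)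
    (hψ.mono (by rintro _ ⟨t, ht, rfl⟩; exact h.mem j t ht))
  rintro _ ⟨t, ht, rfl⟩ e
  exact h.notMem j t ht (sub_eq_zero.mp e ▸ hz)

/-- Cauchy's formula for the even part. -/
lemma IsCauchyCycle.two_smul_kernelIntegral_one {m : ℕ} {γ : Fin m → ℝ → ℂ} {V O : Set ℂ}
    (h : IsCauchyCycle γ V O) (hV : IsOpen V) (hO : ∀ z ∈ O, (starRingEnd ℂ) z ∈ O) {ψ : ℂ → E}
    (hψ : DifferentiableOn ℂ ψ V) {x : Para n} (hx : upperPoint x ∈ O) :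
    (2 : ℂ) • kernelIntegral γ ψ 0 1 1 x =
      ψ (upperPoint x) + ψ ((starRingEnd ℂ) (upperPoint x)) := by
  have c1 := h.cauchy hV hψ hx
  have c2 := h.cauchy hV hψ (hO _ hx)
  have hpi := Complex.two_pi_I_ne_zero
  rw [kernelIntegral, smul_comm, ← cycleIntegral_smul, inv_smul_eq_iff₀ hpi, smul_add, ← c1, ← c2,
    ← cycleIntegral_add h.good (h.continuousOn_inv_smul hψ.continuousOn hx)
      (h.continuousOn_inv_smul hψ.continuousOn (hO _ hx))]
  refine cycleIntegral_congr fun j t ht => ?_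
  have hq := h.quad_ne_zero hO hx j (mem_image_of_mem _ ht)
  rw [smul_smul, ← add_smul]
  congr 1
  -- Partial fractions: `2(s - x₀)/Q = 1/(s - z) + 1/(s - z̄)` for `z = x₀ + i|x̲|`.
  have hs : (2 : ℂ) * (γ j t - x 0) =
      (γ j t - upperPoint x) + (γ j t - (starRingEnd ℂ) (upperPoint x)) := by
    have := Complex.add_conj (upperPoint x)
    have h0 : (upperPoint x).re = x 0 := rfl
    rw [h0] at this
    push_cast at this
    linear_combination this
  rw [quad_eq] at hq
  obtain ⟨h1, h2⟩ := mul_ne_zero_iff.mp hq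
  rw [kernelFun, quad_eq, pow_zero, one_mul, pow_one, pow_one, ← mul_assoc, hs]
  field_simp
  ring

/-- Cauchy's formula for the odd part. -/
lemma IsCauchyCycle.norm_smul_kernelIntegral_zero {m : ℕ} {γ : Fin m → ℝ → ℂ} {V O : Set ℂ}
    (h : IsCauchyCycle γ V O) (hV : IsOpen V) (hO : ∀ z ∈ O, (starRingEnd ℂ) z ∈ O) {ψ : ℂ → E}
    (hψ : DifferentiableOn ℂ ψ V) {x : Para n} (hx : upperPoint x ∈ O) :
    (2 * Complex.I * ‖vecPart x‖ : ℂ) • kernelIntegral γ ψ 0 0 1 x =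
      ψ (upperPoint x) - ψ ((starRingEnd ℂ) (upperPoint x)) := by
  have c1 := h.cauchy hV hψ hx
  have c2 := h.cauchy hV hψ (hO _ hx)
  have hpi := Complex.two_pi_I_ne_zero
  rw [kernelIntegral, smul_comm, ← cycleIntegral_smul, inv_smul_eq_iff₀ hpi, smul_sub, ← c1, ← c2,
    ← cycleIntegral_sub h.good (h.continuousOn_inv_smul hψ.continuousOn hx)
      (h.continuousOn_inv_smul hψ.continuousOn (hO _ hx))]
  refine cycleIntegral_congr fun j t ht => ?_
  have hq := h.quad_ne_zero hO hx j (mem_image_of_mem _ ht)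
  rw [smul_smul, ← sub_smul]
  congr 1
  -- Partial fractions: `2i|x̲|/Q = 1/(s - z) - 1/(s - z̄)` for `z = x₀ + i|x̲|`.
  have hs : (2 * Complex.I * ‖vecPart x‖ : ℂ) =
      (γ j t - (starRingEnd ℂ) (upperPoint x)) - (γ j t - upperPoint x) := by
    have := Complex.sub_conj (upperPoint x)
    have h0 : (upperPoint x).im = ‖vecPart x‖ := rfl
    rw [h0] at this
    push_cast at this
    linear_combination -this
  rw [quad_eq] at hq
  obtain ⟨h1, h2⟩ := mul_ne_zero_iff.mp hq
  rw [kernelFun, quad_eq, pow_zero, one_mul, pow_zero, pow_one, one_mul, hs]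
  field_simp

end Integrals

/-! ### Linear maps on the Clifford algebra -/

instance : FiniteDimensional ℝ (Cl n) := LinearEquiv.finiteDimensional (coordEquiv n).symm

instance : CompleteSpace (Cl n) := FiniteDimensional.complete ℝ (Cl n)

/-- The multiplication as a continuous bilinear map. -/
def mulCLM : Cl n →L[ℝ] Cl n →L[ℝ] Cl n :=
  LinearMap.toContinuousLinearMap
    ((LinearMap.toContinuousLinearMap (𝕜 := ℝ) (E := Cl n) (F' := Cl n)).toLinearMap ∘ₗ
      LinearMap.mul ℝ (Cl n))

@[simp] lemma mulCLM_apply (a b : Cl n) : mulCLM a b = a * b := rfl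

/-- The vector part, as an element of the Clifford algebra. -/
def vecLM : Para n →ₗ[ℝ] Cl n where
  toFun x := vec (vecPart x)
  map_add' x y := by
    rw [vec, vec, vec, ← map_add]; rfl
  map_smul' c x := by
    rw [vec, vec, RingHom.id_apply, ← map_smul]; rfl

/-- The vector part, as an element of the Clifford algebra. -/
def vecCLM : Para n →L[ℝ] Cl n := LinearMap.toContinuousLinearMap vecLM

lemma vecCLM_apply (x : Para n) : vecCLM x = vec (vecPart x) := rfl

lemma vec_mul_vec (v : EuclideanSpace ℝ (Fin n)) :
    vec v * vec v = algebraMap ℝ (Cl n) (-‖v‖ ^ 2) := by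
  rw [vec, CliffordAlgebra.ι_sq_scalar, EuclideanSpace.real_norm_sq_eq]
  congr 1
  simp [negForm, QuadraticMap.weightedSumSquares_apply, Finset.sum_neg_distrib, sq]

lemma vecCLM_mul_vecCLM (x : Para n) (c : Cl n) :
    vecCLM x * (vecCLM x * c) = -(vecNormSq x • c) := by
  rw [← mul_assoc, vecCLM_apply, vec_mul_vec, vecNormSq_eq, Algebra.smul_def, map_neg, neg_mul]

lemma vecCLM_single_zero : vecCLM (EuclideanSpace.single 0 1 : Para n) = 0 := by
  rw [vecCLM_apply, vec]
  refine (congrArg (CliffordAlgebra.ι (negForm n)) (funext fun i => ?_)).trans (map_zero _)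
  simp [vecPart]

lemma vecCLM_single_succ (i : Fin n) :
    vecCLM (EuclideanSpace.single i.succ 1 : Para n) = imUnit i := by
  rw [vecCLM_apply, vec, imUnit, vec]
  refine congrArg (CliffordAlgebra.ι (negForm n)) (funext fun j => ?_)
  simp [vecPart]

lemma sum_smul_imUnit (x : Para n) : ∑ i : Fin n, x i.succ • imUnit i = vecCLM x := by
  simp only [imUnit, vec, ← map_smul, ← map_sum, vecCLM_apply]
  congr 1
  ext j
  simp [vecPart, Finset.sum_apply]

lemma imUnit_mul_imUnit (i : Fin n) (c : Cl n) : imUnit i * (imUnit i * c) = -c := by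
  rw [← mul_assoc, imUnit, vec_mul_vec]
  simp

/-! ### Differential operators -/

/-- Local linear operators on smooth functions. -/
structure IsLocalOp (T : (Para n → Cl n) → Para n → Cl n) : Prop where
  congr : ∀ {O : Set (Para n)} {f g : Para n → Cl n}, IsOpen O → EqOn f g O → EqOn (T f) (T g) O
  smooth : ∀ {O : Set (Para n)} {f : Para n → Cl n}, IsOpen O → ContDiffOn ℝ ∞ f O →
    ContDiffOn ℝ ∞ (T f) O
  add : ∀ {O : Set (Para n)} {f g : Para n → Cl n}, IsOpen O → ContDiffOn ℝ ∞ f O →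
    ContDiffOn ℝ ∞ g O → EqOn (T (f + g)) (T f + T g) O
  smul : ∀ {O : Set (Para n)} {f : Para n → Cl n} (c : ℝ), IsOpen O → ContDiffOn ℝ ∞ f O →
    EqOn (T (c • f)) (c • T f) O

/-- Operators that commute on smooth functions. -/
structure OpCommute (S T : (Para n → Cl n) → Para n → Cl n) : Prop where
  comm : ∀ {O : Set (Para n)} {f : Para n → Cl n}, IsOpen O → ContDiffOn ℝ ∞ f O →
    EqOn (S (T f)) (T (S f)) O

namespace IsLocalOp

variable {S T : (Para n → Cl n) → Para n → Cl n}

lemma sub (hT : IsLocalOp T) {O : Set (Para n)} {f g : Para n → Cl n} (hO : IsOpen O)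
    (hf : ContDiffOn ℝ ∞ f O) (hg : ContDiffOn ℝ ∞ g O) : EqOn (T (f - g)) (T f - T g) O := by
  intro x hx
  have h1 := hT.add hO hf (hg.const_smul (-1 : ℝ)) hx
  have h2 := hT.smul (-1) hO hg hx
  have e : f - g = f + (-1 : ℝ) • g := by simp [sub_eq_add_neg]
  rw [e, Pi.sub_apply]
  refine h1.trans ?_
  rw [Pi.add_apply]
  refine (congrArg _ h2).trans ?_
  simp [sub_eq_add_neg]

lemma zero (hT : IsLocalOp T) {O : Set (Para n)} (hO : IsOpen O) : EqOn (T 0) 0 O := by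
  intro x hx
  have := hT.smul (f := 0) 0 hO contDiffOn_const hx
  simpa using this

lemma id : IsLocalOp (n := n) _root_.id :=
  ⟨fun _ h => h, fun _ h => h, fun _ _ _ => eqOn_refl _ _, fun _ _ _ => eqOn_refl _ _⟩

lemma comp (hS : IsLocalOp S) (hT : IsLocalOp T) : IsLocalOp (S ∘ T) where
  congr hO h := hS.congr hO (hT.congr hO h)
  smooth hO hf := hS.smooth hO (hT.smooth hO hf)
  add hO hf hg := (hS.congr hO (hT.add hO hf hg)).trans
    (hS.add hO (hT.smooth hO hf) (hT.smooth hO hg))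
  smul c hO hf := (hS.congr hO (hT.smul c hO hf)).trans (hS.smul c hO (hT.smooth hO hf))

lemma iterate (hT : IsLocalOp T) (k : ℕ) : IsLocalOp (T^[k]) := by
  induction k with
  | zero => exact id
  | succ k ih => rw [Function.iterate_succ]; exact ih.comp hT

end IsLocalOp

lemma OpCommute.symm {S T : (Para n → Cl n) → Para n → Cl n} (h : OpCommute S T) :
    OpCommute T S := ⟨fun hO hf => (h.comm hO hf).symm⟩

lemma OpCommute.iterate_right {S T : (Para n → Cl n) → Para n → Cl n} (h : OpCommute S T)
    (hT : IsLocalOp T) (k : ℕ) : OpCommute S (T^[k]) := by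
  induction k with
  | zero => exact ⟨fun _ _ => eqOn_refl _ _⟩
  | succ k ih =>
    refine ⟨fun hO hf => ?_⟩
    rw [Function.iterate_succ']
    exact (h.comm hO ((hT.iterate k).smooth hO hf)).trans (hT.congr hO (ih.comm hO hf))

lemma OpCommute.iterate {S T : (Para n → Cl n) → Para n → Cl n} (h : OpCommute S T)
    (hS : IsLocalOp S) (hT : IsLocalOp T) (j k : ℕ) : OpCommute (S^[j]) (T^[k]) :=
  ((h.iterate_right hT k).symm.iterate_right hS j).symm

/-! ### Partial derivatives and the operators built from them -/

lemma one_add_one_le_infty : (1 + 1 : WithTop ℕ∞) ≤ ∞ :=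
  WithTop.coe_le_coe.mpr (le_top : (1 + 1 : ℕ∞) ≤ ⊤)

lemma contDiffAt_of_contDiffOn {O : Set (Para n)} {f : Para n → Cl n} (hO : IsOpen O)
    (hf : ContDiffOn ℝ ∞ f O) {x : Para n} (hx : x ∈ O) : ContDiffAt ℝ ∞ f x :=
  hf.contDiffAt (hO.mem_nhds hx)

lemma differentiableAt_of_contDiffOn {O : Set (Para n)} {f : Para n → Cl n} (hO : IsOpen O)
    (hf : ContDiffOn ℝ ∞ f O) {x : Para n} (hx : x ∈ O) : DifferentiableAt ℝ f x :=
  (contDiffAt_of_contDiffOn hO hf hx).differentiableAt (by simp)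

lemma isLocalOp_pderiv (i : Fin (n + 1)) : IsLocalOp (pderiv (n := n) i) where
  congr hO h x hx := by
    rw [pderiv, pderiv, (h.eventuallyEq_of_mem (hO.mem_nhds hx)).fderiv_eq]
  smooth hO hf := (hf.fderiv_of_isOpen hO (by simp)).clm_apply contDiffOn_const
  add hO hf hg x hx := by
    rw [pderiv, fderiv_add (differentiableAt_of_contDiffOn hO hf hx)
      (differentiableAt_of_contDiffOn hO hg hx)]
    rfl
  smul c hO hf x hx := by
    rw [pderiv, fderiv_const_smul (differentiableAt_of_contDiffOn hO hf hx)]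
    rfl

lemma opCommute_pderiv (i j : Fin (n + 1)) : OpCommute (pderiv (n := n) i) (pderiv j) := by
  refine ⟨fun {O f} hO hf x hx => ?_⟩
  have hd : DifferentiableAt ℝ (fderiv ℝ f) x :=
    ((hf.fderiv_of_isOpen hO (m := 1) one_add_one_le_infty).contDiffAt (hO.mem_nhds hx)).differentiableAt
      (by simp)
  have key : ∀ i j, pderiv i (pderiv j f) x =
      fderiv ℝ (fderiv ℝ f) x (EuclideanSpace.single i 1) (EuclideanSpace.single j 1) := fun _ j => by
    have : pderiv j f = fun y => fderiv ℝ f y (EuclideanSpace.single j 1) := rfl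
    rw [pderiv, this, fderiv_clm_apply hd (differentiableAt_const _)]
    simp
  rw [key, key]
  exact (contDiffAt_of_contDiffOn hO hf hx).isSymmSndFDerivAt
    (by rw [minSmoothness_of_isRCLikeNormedField, ← one_add_one_eq_two]; exact one_add_one_le_infty) _ _

lemma isLocalOp_sum {ι : Type*} (s : Finset ι) {T : ι → (Para n → Cl n) → Para n → Cl n}
    (h : ∀ i, IsLocalOp (T i)) : IsLocalOp (fun f x => ∑ i ∈ s, T i f x) where
  congr hO hfg x hx := Finset.sum_congr rfl fun i _ => (h i).congr hO hfg hx
  smooth hO hf := ContDiffOn.sum fun i _ => (h i).smooth hO hf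
  add hO hf hg x hx := by
    simp only [Pi.add_apply, ← Finset.sum_add_distrib]
    exact Finset.sum_congr rfl fun i _ => (h i).add hO hf hg hx
  smul c hO hf x hx := by
    simp only [Pi.smul_apply, Finset.smul_sum]
    exact Finset.sum_congr rfl fun i _ => (h i).smul c hO hf hx

lemma isLocalOp_const_mul (c : Cl n) : IsLocalOp (fun f (x : Para n) => c * f x) where
  congr hO h x hx := by simp only [h hx]
  smooth hO hf := (mulCLM c).contDiff.comp_contDiffOn hf
  add hO hf hg x hx := by simp [mul_add]
  smul c hO hf x hx := by simp

lemma IsLocalOp.add_op {S T : (Para n → Cl n) → Para n → Cl n} (hS : IsLocalOp S)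
    (hT : IsLocalOp T) : IsLocalOp (fun f x => S f x + T f x) where
  congr hO h x hx := by simp only [hS.congr hO h hx, hT.congr hO h hx]
  smooth hO hf := (hS.smooth hO hf).add (hT.smooth hO hf)
  add hO hf hg x hx := by
    simp only [hS.add hO hf hg hx, hT.add hO hf hg hx, Pi.add_apply]; abel
  smul c hO hf x hx := by simp only [hS.smul c hO hf hx, hT.smul c hO hf hx, Pi.smul_apply, smul_add]

/-- `∑ eᵢ ∂f/∂xᵢ`. -/
def vecDirac (f : Para n → Cl n) (x : Para n) : Cl n := ∑ i : Fin n, imUnit i * pderiv i.succ f x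

lemma isLocalOp_vecDirac : IsLocalOp (vecDirac (n := n)) :=
  isLocalOp_sum _ fun i => (isLocalOp_const_mul (imUnit i)).comp (isLocalOp_pderiv i.succ)

lemma isLocalOp_dirac : IsLocalOp (dirac (n := n)) :=
  (isLocalOp_pderiv 0).add_op isLocalOp_vecDirac

lemma isLocalOp_diracConj : IsLocalOp (diracConj (n := n)) := by
  have := (isLocalOp_pderiv (n := n) 0).add_op ((isLocalOp_const_mul (-1)).comp isLocalOp_vecDirac)
  convert this using 3 with f x
  simp [diracConj, vecDirac, sub_eq_add_neg]

lemma lap_eq_sum {O : Set (Para n)} {f : Para n → Cl n} (hO : IsOpen O)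
    (hf : ContDiffOn ℝ ∞ f O) {x : Para n} (hx : x ∈ O) :
    lap f x = ∑ i, pderiv i (pderiv i f) x := by
  have hd : DifferentiableAt ℝ (fderiv ℝ f) x :=
    ((hf.fderiv_of_isOpen hO (m := 1) one_add_one_le_infty).contDiffAt (hO.mem_nhds hx)).differentiableAt
      (by simp)
  rw [lap, InnerProductSpace.laplacian_eq_iteratedFDeriv_orthonormalBasis f
    (EuclideanSpace.basisFun (Fin (n + 1)) ℝ)]
  refine Finset.sum_congr rfl fun i _ => ?_
  have : pderiv i f = fun y => fderiv ℝ f y (EuclideanSpace.single i 1) := rfl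
  rw [iteratedFDeriv_two_apply, pderiv, this, fderiv_clm_apply hd (differentiableAt_const _)]
  simp

lemma isLocalOp_lap : IsLocalOp (lap (n := n)) := by
  have hs : IsLocalOp (n := n) (fun f x => ∑ i, (pderiv i ∘ pderiv i) f x) :=
    isLocalOp_sum _ fun i => (isLocalOp_pderiv i).comp (isLocalOp_pderiv i)
  refine ⟨fun hO h x hx => ?_, fun hO hf => ?_, fun hO hf hg x hx => ?_, fun c hO hf x hx => ?_⟩
  · exact (InnerProductSpace.laplacian_congr_nhds
      (h.eventuallyEq_of_mem (hO.mem_nhds hx))).eq_of_nhds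
  · exact (hs.smooth hO hf).congr fun x hx => lap_eq_sum hO hf hx
  · rw [Pi.add_apply, lap_eq_sum (f := _ + _) hO (hf.add hg) hx, lap_eq_sum hO hf hx, lap_eq_sum hO hg hx]
    exact hs.add hO hf hg hx
  · rw [Pi.smul_apply, lap_eq_sum (f := c • _) hO (hf.const_smul c) hx, lap_eq_sum hO hf hx]
    exact hs.smul c hO hf hx

lemma opCommute_pderiv_const_mul (i : Fin (n + 1)) (c : Cl n) :
    OpCommute (pderiv (n := n) i) (fun f x => c * f x) := by
  refine ⟨fun {O f} hO hf x hx => ?_⟩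
  have : (fun x => c * f x) = fun x => mulCLM c (f x) := rfl
  simp only [pderiv]
  have h := (mulCLM c).hasFDerivAt.comp x (differentiableAt_of_contDiffOn hO hf hx).hasFDerivAt
  rw [this, HasFDerivAt.fderiv (f := fun x => mulCLM c (f x)) h]
  rfl

lemma OpCommute.sum {ι : Type*} (s : Finset ι) {S : (Para n → Cl n) → Para n → Cl n}
    (hS : IsLocalOp S) {T : ι → (Para n → Cl n) → Para n → Cl n} (hT : ∀ i, IsLocalOp (T i))
    (h : ∀ i, OpCommute S (T i)) : OpCommute S (fun f x => ∑ i ∈ s, T i f x) := by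
  classical
  refine ⟨fun {O f} hO hf => ?_⟩
  induction s using Finset.induction_on with
  | empty =>
    intro x hx
    simpa using! hS.zero hO hx
  | insert a s ha ih =>
    intro x hx
    simp only [Finset.sum_insert ha]
    have h1 := hS.add hO ((hT a).smooth hO hf) ((isLocalOp_sum s hT).smooth hO hf) hx
    refine h1.trans ?_
    simp only [Pi.add_apply]
    rw [(h a).comm hO hf hx, ih hx]

lemma OpCommute.comp_right {S T T' : (Para n → Cl n) → Para n → Cl n} (h : OpCommute S T)
    (h' : OpCommute S T') (hT : IsLocalOp T) (hT' : IsLocalOp T') : OpCommute S (T ∘ T') :=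
  ⟨fun hO hf => (h.comm hO (hT'.smooth hO hf)).trans (hT.congr hO (h'.comm hO hf))⟩

lemma OpCommute.add_right {S T T' : (Para n → Cl n) → Para n → Cl n} (h : OpCommute S T)
    (h' : OpCommute S T') (hS : IsLocalOp S) (hT : IsLocalOp T) (hT' : IsLocalOp T') :
    OpCommute S (fun f x => T f x + T' f x) := by
  refine ⟨fun hO hf x hx => ?_⟩
  refine (hS.add hO (hT.smooth hO hf) (hT'.smooth hO hf) hx).trans ?_
  rw [Pi.add_apply, h.comm hO hf hx, h'.comm hO hf hx]

lemma opCommute_pderiv_vecDirac (i : Fin (n + 1)) : OpCommute (pderiv (n := n) i) vecDirac :=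
  OpCommute.sum _ (isLocalOp_pderiv i)
    (fun j => (isLocalOp_const_mul (imUnit j)).comp (isLocalOp_pderiv j.succ))
    fun _ => (opCommute_pderiv_const_mul i _).comp_right (opCommute_pderiv i _)
      (isLocalOp_const_mul _) (isLocalOp_pderiv _)

lemma diracConj_eq : diracConj (n := n) =
    fun f x => pderiv 0 f x + ((fun g (x : Para n) => (-1 : Cl n) * g x) ∘ vecDirac) f x := by
  ext f x
  simp [diracConj, vecDirac, sub_eq_add_neg]

lemma opCommute_pderiv_diracConj (i : Fin (n + 1)) : OpCommute (pderiv (n := n) i) diracConj := by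
  rw [diracConj_eq]
  exact (opCommute_pderiv i 0).add_right ((opCommute_pderiv_const_mul i _).comp_right
    (opCommute_pderiv_vecDirac i) (isLocalOp_const_mul _) isLocalOp_vecDirac) (isLocalOp_pderiv i)
    (isLocalOp_pderiv 0) ((isLocalOp_const_mul _).comp isLocalOp_vecDirac)

lemma opCommute_lap {T : (Para n → Cl n) → Para n → Cl n} (hT : IsLocalOp T)
    (h : ∀ i, OpCommute (pderiv i) T) : OpCommute T lap := by
  refine ⟨fun {O f} hO hf => ?_⟩
  have hs : OpCommute T (fun f x => ∑ i, (pderiv i ∘ pderiv i) f x) :=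
    OpCommute.sum _ hT (fun i => (isLocalOp_pderiv i).comp (isLocalOp_pderiv i)) fun i =>
      (h i).symm.comp_right (h i).symm (isLocalOp_pderiv i) (isLocalOp_pderiv i)
  intro x hx
  refine (hT.congr hO (fun y hy => lap_eq_sum hO hf hy) hx).trans ?_
  rw [lap_eq_sum hO (hT.smooth hO hf) hx]
  exact hs.comm hO hf hx

lemma isLocalOp_leftOp (ℓ : ℕ) : IsLocalOp (leftOp (n := n) ℓ) :=
  (isLocalOp_lap.iterate ℓ).comp (isLocalOp_diracConj.iterate (sce n - ℓ))

/-- The Laplacian has to act first: its closed formula concerns `F_{0,k}`, and `D̄` raises the first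
index. -/
lemma leftOp_eq {ℓ : ℕ} {O : Set (Para n)} {f : Para n → Cl n} (hO : IsOpen O)
    (hf : ContDiffOn ℝ ∞ f O) : EqOn (leftOp ℓ f) (diracConj^[sce n - ℓ] (lap^[ℓ] f)) O :=
  (((opCommute_lap isLocalOp_diracConj opCommute_pderiv_diracConj).iterate isLocalOp_diracConj
    isLocalOp_lap _ _).symm.comm hO hf)

/-! ### The factorisation of the Laplacian -/

lemma imUnit_mul_add_swap (i j : Fin n) (hij : i ≠ j) :
    (imUnit i * imUnit j + imUnit j * imUnit i : Cl n) = 0 := by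
  rw [imUnit, imUnit, vec, vec, CliffordAlgebra.ι_mul_ι_add_swap]
  convert map_zero (algebraMap ℝ (Cl n))
  simp only [QuadraticMap.polar, negForm, QuadraticMap.weightedSumSquares_apply,
    ← Finset.sum_sub_distrib]
  refine Finset.sum_eq_zero fun k _ => ?_
  by_cases hk : k = i
  · subst hk
    simp [hij]
  · simp [hk]

/-- When the double sum is added to its transpose, the mixed terms cancel, because the units
anticommute and the partial derivatives commute. -/
lemma vecDirac_vecDirac {O : Set (Para n)} {f : Para n → Cl n} (hO : IsOpen O)
    (hf : ContDiffOn ℝ ∞ f O) {x : Para n} (hx : x ∈ O) :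
    vecDirac (vecDirac f) x = -∑ i : Fin n, pderiv i.succ (pderiv i.succ f) x := by
  have h1 : vecDirac (vecDirac f) x =
      ∑ i : Fin n, ∑ j : Fin n, imUnit i * (imUnit j * pderiv i.succ (pderiv j.succ f) x) := by
    rw [vecDirac]
    refine Finset.sum_congr rfl fun i _ => ?_
    rw [(opCommute_pderiv_vecDirac i.succ).comm hO hf hx, vecDirac, Finset.mul_sum]
    refine Finset.sum_congr rfl fun j _ => ?_
    rw [(opCommute_pderiv j.succ i.succ).comm hO hf hx]
  have h2 : (2 : ℝ) • vecDirac (vecDirac f) x =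
      (2 : ℝ) • -∑ i : Fin n, pderiv i.succ (pderiv i.succ f) x := by
    rw [two_smul]
    nth_rewrite 2 [h1]
    rw [Finset.sum_comm, h1, ← Finset.sum_add_distrib, smul_neg, Finset.smul_sum,
      ← Finset.sum_neg_distrib]
    refine Finset.sum_congr rfl fun i _ => ?_
    rw [← Finset.sum_add_distrib, Finset.sum_eq_single i]
    · rw [imUnit_mul_imUnit, two_smul, neg_add]
    · intro j _ hj
      rw [(opCommute_pderiv j.succ i.succ).comm hO hf hx, ← mul_assoc, ← mul_assoc, ← add_mul,
        imUnit_mul_add_swap i j hj.symm, zero_mul]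
    · simp
  exact smul_right_injective _ (two_ne_zero (α := ℝ)) h2

/-- `D̄ D = Δ`. -/
lemma diracConj_dirac {O : Set (Para n)} {f : Para n → Cl n} (hO : IsOpen O)
    (hf : ContDiffOn ℝ ∞ f O) : EqOn (diracConj (dirac f)) (lap f) O := by
  intro x hx
  have e1 : dirac f = pderiv 0 f + vecDirac f := rfl
  have s0 := (isLocalOp_pderiv 0).smooth hO hf
  have s1 := isLocalOp_vecDirac.smooth hO hf
  have e2 : ∀ g, diracConj g x = pderiv 0 g x - vecDirac g x := fun g => rfl
  rw [e2, e1, (isLocalOp_pderiv 0).add hO s0 s1 hx, isLocalOp_vecDirac.add hO s0 s1 hx,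
    lap_eq_sum hO hf hx, Fin.sum_univ_succ, Pi.add_apply, Pi.add_apply, vecDirac_vecDirac hO hf hx,
    (opCommute_pderiv_vecDirac 0).comm hO hf hx]
  abel

/-! ### The operators on families of axial functions -/

/-- The axial function with the components `q_{a+1,k}` and `q_{a,k}`. -/
def axialFun (q : ℕ → ℕ → Para n → Cl n) (a k : ℕ) (x : Para n) : Cl n :=
  q (a + 1) k x + vecCLM x * q a k x

lemma sum_imUnit_mul_smul (x : Para n) (c : ℝ) (d : Cl n) :
    ∑ i : Fin n, imUnit i * ((c * x i.succ) • d) = c • (vecCLM x * d) := by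
  rw [← sum_smul_imUnit x, Finset.sum_mul, Finset.smul_sum]
  refine Finset.sum_congr rfl fun i _ => ?_
  rw [mul_smul_comm, smul_mul_assoc, smul_smul]

lemma hasFDerivAt_vecCLM_mul {g : Para n → Cl n} {g' : Para n →L[ℝ] Cl n} {x : Para n}
    (hg : HasFDerivAt g g' x) (y : Para n) :
    fderiv ℝ (fun y => vecCLM y * g y) x y = vecCLM x * g' y + vecCLM y * g x := by
  have := mulCLM.hasFDerivAt_of_bilinear (vecCLM.hasFDerivAt (x := x)) hg
  rw [show (fun y => vecCLM y * g y) = fun y => mulCLM (vecCLM y) (g y) from rfl, this.fderiv]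
  simp

lemma contDiffOn_vecCLM_mul {g : Para n → Cl n} {O : Set (Para n)} (hg : ContDiffOn ℝ ∞ g O) :
    ContDiffOn ℝ ∞ (fun y => vecCLM y * g y) O :=
  ContDiffOn.clm_apply (f := fun y => mulCLM (vecCLM y))
    ((mulCLM.contDiff.comp vecCLM.contDiff).contDiffOn) hg

namespace IsRadialFamily

variable {O : Set (Para n)} {q : ℕ → ℕ → Para n → Cl n}

lemma contDiffOn_axialFun (h : IsRadialFamily O q) (a k : ℕ) : ContDiffOn ℝ ∞ (axialFun q a k) O :=
  (h.contDiffOn _ _).add (contDiffOn_vecCLM_mul (h.contDiffOn _ _))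

lemma pderiv_zero (h : IsRadialFamily O q) (a k : ℕ) {x : Para n} (hx : x ∈ O) :
    pderiv 0 (q a k) x = (2 * k : ℝ) • q (a + 1) (k + 1) x - (a : ℝ) • q (a - 1) k x := by
  rw [pderiv, (h.hasFDerivAt a k x hx).fderiv, radialDeriv_apply, vecInner_apply]
  simp

lemma pderiv_succ (h : IsRadialFamily O q) (a k : ℕ) (i : Fin n) {x : Para n} (hx : x ∈ O) :
    pderiv i.succ (q a k) x = (-(2 * k : ℝ) * x i.succ) • q a (k + 1) x := by
  rw [pderiv, (h.hasFDerivAt a k x hx).fderiv, radialDeriv_apply, vecInner_apply]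
  simp [smul_smul, mul_comm]

lemma vecDirac_eq (h : IsRadialFamily O q) (a k : ℕ) {x : Para n} (hx : x ∈ O) :
    vecDirac (q a k) x = -(2 * k : ℝ) • (vecCLM x * q a (k + 1) x) := by
  simp only [vecDirac, h.pderiv_succ a k _ hx, sum_imUnit_mul_smul]

lemma pderiv_zero_axialFun (h : IsRadialFamily O q) (a k : ℕ) {x : Para n} (hx : x ∈ O) :
    pderiv 0 (axialFun q a k) x = ((2 * k : ℝ) • q (a + 2) (k + 1) x - (a + 1 : ℝ) • q a k x) +
      vecCLM x * ((2 * k : ℝ) • q (a + 1) (k + 1) x - (a : ℝ) • q (a - 1) k x) := by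
  have e : axialFun q a k = q (a + 1) k + fun x => vecCLM x * q a k x := rfl
  rw [e, (isLocalOp_pderiv 0).add h.isOpen (h.contDiffOn _ _)
    (contDiffOn_vecCLM_mul (h.contDiffOn _ _)) hx, Pi.add_apply, h.pderiv_zero _ _ hx, pderiv,
    hasFDerivAt_vecCLM_mul (h.hasFDerivAt a k x hx), vecCLM_single_zero, zero_mul, add_zero,
    ← (h.hasFDerivAt a k x hx).fderiv]
  have := h.pderiv_zero a k hx
  rw [pderiv] at this
  rw [this]
  simp

lemma pderiv_succ_axialFun (h : IsRadialFamily O q) (a k : ℕ) (i : Fin n) {x : Para n}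
    (hx : x ∈ O) :
    pderiv i.succ (axialFun q a k) x = (-(2 * k : ℝ) * x i.succ) • q (a + 1) (k + 1) x +
      (vecCLM x * ((-(2 * k : ℝ) * x i.succ) • q a (k + 1) x) + imUnit i * q a k x) := by
  have e : axialFun q a k = q (a + 1) k + fun x => vecCLM x * q a k x := rfl
  rw [e, (isLocalOp_pderiv i.succ).add h.isOpen (h.contDiffOn _ _)
    (contDiffOn_vecCLM_mul (h.contDiffOn _ _)) hx, Pi.add_apply, h.pderiv_succ _ _ _ hx, pderiv,
    hasFDerivAt_vecCLM_mul (h.hasFDerivAt a k x hx), vecCLM_single_succ,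
    ← (h.hasFDerivAt a k x hx).fderiv]
  have := h.pderiv_succ a k i hx
  rw [pderiv] at this
  rw [this]

/-- The coefficient `-n` is `∑ eᵢ eᵢ`. The square of `x̲` produces `|x̲|² q_{a,k+1}`, which the
relation `sq` turns back into members of the family. -/
lemma vecDirac_axialFun (h : IsRadialFamily O q) (a k : ℕ) {x : Para n} (hx : x ∈ O) :
    vecDirac (axialFun q a k) x = -(2 * k : ℝ) • (vecCLM x * q (a + 1) (k + 1) x) +
      ((2 * k : ℝ) • (q a k x - q (a + 2) (k + 1) x) - (n : ℝ) • q a k x) := by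
  simp only [vecDirac, h.pderiv_succ_axialFun a k _ hx, mul_add, Finset.sum_add_distrib,
    sum_imUnit_mul_smul, imUnit_mul_imUnit]
  congr 1
  have e1 : ∑ i : Fin n, imUnit i * (vecCLM x * ((-(2 * k : ℝ) * x i.succ) • q a (k + 1) x)) =
      (2 * k : ℝ) • (vecNormSq x • q a (k + 1) x) := by
    have := sum_imUnit_mul_smul x (-(2 * k : ℝ)) (vecCLM x * q a (k + 1) x)
    rw [vecCLM_mul_vecCLM] at this
    simp only [mul_smul_comm] at this ⊢
    rw [this, smul_neg, neg_smul, neg_neg]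
  rw [e1, h.sq a k x hx, Finset.sum_neg_distrib, Finset.sum_const, Finset.card_univ,
    Fintype.card_fin, sub_sub_cancel, ← Nat.cast_smul_eq_nsmul ℝ, sub_eq_add_neg]

/-- The terms with `q_{a+2,k+1}` and with `x̲ q_{a+1,k+1}` cancel. The scalar remainder disappears
for `2k = n + 1`, the exponent in the kernels. -/
lemma dirac_axialFun (h : IsRadialFamily O q) (a k : ℕ) {x : Para n} (hx : x ∈ O) :
    dirac (axialFun q a k) x = -(a : ℝ) • axialFun q (a - 1) k x + (2 * k - n - 1 : ℝ) • q a k x := by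
  have e : dirac (axialFun q a k) x = pderiv 0 (axialFun q a k) x + vecDirac (axialFun q a k) x := rfl
  rw [e, h.pderiv_zero_axialFun a k hx, h.vecDirac_axialFun a k hx, mul_sub, mul_smul_comm,
    mul_smul_comm]
  rcases a with _ | a
  · simp only [Nat.cast_zero]
    module
  · simp only [axialFun, Nat.add_sub_cancel]
    module

lemma diracConj_axialFun (h : IsRadialFamily O q) (a k : ℕ) {x : Para n} (hx : x ∈ O) :
    diracConj (axialFun q a k) x = (4 * k : ℝ) • axialFun q (a + 1) (k + 1) x -
      (a : ℝ) • axialFun q (a - 1) k x + (n - 2 * k - 1 : ℝ) • q a k x := by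
  have e : diracConj (axialFun q a k) x =
    pderiv 0 (axialFun q a k) x - vecDirac (axialFun q a k) x := rfl
  rw [e, h.pderiv_zero_axialFun a k hx, h.vecDirac_axialFun a k hx, mul_sub, mul_smul_comm,
    mul_smul_comm]
  rcases a with _ | a
  · simp only [Nat.cast_zero, axialFun]
    module
  · simp only [axialFun, Nat.add_sub_cancel]
    push_cast
    module

lemma diracConj_eq (h : IsRadialFamily O q) (a k : ℕ) {x : Para n} (hx : x ∈ O) :
    diracConj (q a k) x = (2 * k : ℝ) • axialFun q a (k + 1) x - (a : ℝ) • q (a - 1) k x := by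
  have e : diracConj (q a k) x = pderiv 0 (q a k) x - vecDirac (q a k) x := rfl
  rw [e, h.pderiv_zero a k hx, h.vecDirac_eq a k hx]
  simp only [axialFun]
  module

lemma dirac_iterate_axialFun (h : IsRadialFamily O q) {k : ℕ} (hk : n + 1 = 2 * k) (a : ℕ) :
    EqOn (dirac^[a + 1] (axialFun q a k)) 0 O := by
  have hk' : (2 * k - n - 1 : ℝ) = 0 := by
    have : (n + 1 : ℝ) = 2 * k := by exact_mod_cast hk
    linarith
  induction a with
  | zero =>
    intro x hx
    rw [zero_add, Function.iterate_one, h.dirac_axialFun 0 k hx, hk']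
    simp
  | succ a ih =>
    intro x hx
    have e : EqOn (dirac (axialFun q (a + 1) k)) (-((a + 1 : ℕ) : ℝ) • axialFun q a k) O :=
      fun y hy => by
        rw [h.dirac_axialFun (a + 1) k hy, hk', zero_smul, add_zero]; rfl
    rw [Function.iterate_succ_apply, (isLocalOp_dirac.iterate (a + 1)).congr h.isOpen e hx,
      (isLocalOp_dirac.iterate (a + 1)).smul _ h.isOpen (h.contDiffOn_axialFun a k) hx,
      Pi.smul_apply, ih hx]
    simp

/-- For `a = 0` only the scalar term survives under `D`, and `D̄` maps `q_{0,k}` back to an axial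
function. -/
lemma lap_axialFun (h : IsRadialFamily O q) (k : ℕ) :
    EqOn (lap (axialFun q 0 k)) (((2 * k - n - 1) * (2 * k) : ℝ) • axialFun q 0 (k + 1)) O := by
  intro x hx
  have e : EqOn (dirac (axialFun q 0 k)) ((2 * k - n - 1 : ℝ) • q 0 k) O := fun y hy => by
    rw [h.dirac_axialFun 0 k hy]
    simp
  rw [← diracConj_dirac h.isOpen (h.contDiffOn_axialFun 0 k) hx,
    isLocalOp_diracConj.congr h.isOpen e hx,
    isLocalOp_diracConj.smul _ h.isOpen (h.contDiffOn 0 k) hx, Pi.smul_apply,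
    h.diracConj_eq 0 k hx]
  simp [smul_smul]

lemma lap_iterate_axialFun (h : IsRadialFamily O q) {s : ℕ} (hs : n = 2 * s + 1) {l : ℕ}
    (hl : l ≤ s) :
    EqOn (lap^[l] (axialFun q 0 1))
      (((-4) ^ l * l.factorial * s.descFactorial l : ℝ) • axialFun q 0 (l + 1)) O := by
  induction l with
  | zero => intro x hx; simp
  | succ l ih =>
    intro x hx
    have hc : ((2 * ((l + 1 : ℕ) : ℝ) - n - 1) * (2 * ((l + 1 : ℕ) : ℝ)) : ℝ) =
        -4 * (l + 1) * ((s - l : ℕ) : ℝ) := by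
      rw [Nat.cast_sub (by omega), hs]
      push_cast
      ring
    rw [Function.iterate_succ_apply', isLocalOp_lap.congr h.isOpen (ih (by omega)) hx,
      isLocalOp_lap.smul _ h.isOpen (h.contDiffOn_axialFun 0 _) hx, Pi.smul_apply,
      h.lap_axialFun (l + 1) hx, hc, Pi.smul_apply, Pi.smul_apply, smul_smul]
    congr 1
    rw [Nat.descFactorial_succ, Nat.factorial_succ, pow_succ]
    push_cast
    ring

end IsRadialFamily

/-! ### The Leibniz rule for `D̄` and the coordinate `x₀` -/

lemma isLocalOp_diracConj_coord_smul {O : Set (Para n)} {g : Para n → Cl n} (hO : IsOpen O)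
    (hg : ContDiffOn ℝ ∞ g O) :
    EqOn (diracConj (fun x => x 0 • g x)) (fun x => x 0 • diracConj g x + g x) O := by
  intro x hx
  have hd := (differentiableAt_of_contDiffOn hO hg hx).hasFDerivAt
  have key : ∀ i, pderiv i (fun x : Para n => x 0 • g x) x =
      x 0 • pderiv i g x + (EuclideanSpace.single i (1 : ℝ) : Para n) 0 • g x := fun i => by
    have h2 : HasFDerivAt (fun x : Para n => x 0 • g x) _ x :=
      ((scalarPart (n := n)).hasFDerivAt (x := x)).smul hd
    rw [pderiv, h2.fderiv]
    simp [pderiv]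
  simp only [diracConj, key]
  have h0 : ∀ i : Fin n, (EuclideanSpace.single i.succ (1 : ℝ) : Para n) 0 = 0 := fun i => by
    simp [(Fin.succ_ne_zero i).symm]
  simp only [h0, zero_smul, add_zero, PiLp.single_apply, if_true, one_smul,
    mul_smul_comm, ← Finset.smul_sum, smul_sub]
  abel

lemma contDiffOn_coord_smul {O : Set (Para n)} {g : Para n → Cl n} (hg : ContDiffOn ℝ ∞ g O) :
    ContDiffOn ℝ ∞ (fun x => x 0 • g x) O :=
  (scalarPart (n := n)).contDiff.contDiffOn.smul hg

lemma diracConj_iterate_coord_smul {O : Set (Para n)} {g : Para n → Cl n} (hO : IsOpen O)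
    (hg : ContDiffOn ℝ ∞ g O) (j : ℕ) :
    EqOn (diracConj^[j] (fun x => x 0 • g x))
      (fun x => x 0 • diracConj^[j] g x + (j : ℝ) • diracConj^[j - 1] g x) O := by
  induction j with
  | zero => intro x hx; simp
  | succ j ih =>
    intro x hx
    have s1 := (isLocalOp_diracConj.iterate j).smooth hO hg
    have s2 := (isLocalOp_diracConj.iterate (j - 1)).smooth hO hg
    rw [Function.iterate_succ_apply', isLocalOp_diracConj.congr hO ih hx]
    have e := isLocalOp_diracConj.add hO (contDiffOn_coord_smul s1) (s2.const_smul (j : ℝ)) hx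
    refine e.trans ?_
    rw [Pi.add_apply, isLocalOp_diracConj_coord_smul hO s1 hx]
    have e2 := isLocalOp_diracConj.smul (j : ℝ) hO s2 hx
    refine (congrArg _ e2).trans ?_
    simp only [Pi.smul_apply, ← Function.iterate_succ_apply' diracConj]
    rcases j with _ | j
    · simp
    · simp only [Nat.succ_eq_add_one, Nat.add_sub_cancel]
      push_cast
      module

/-- Families of radial functions that behave like the integrals over `s` of
`s^b (s - x₀)^a ((s - x₀)² + |x̲|²)^(-k)` against a fixed measure. -/
structure IsKernelFamily (O : Set (Para n)) (q : ℕ → ℕ → ℕ → Para n → Cl n) : Prop where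
  radial : ∀ b, IsRadialFamily O (q b)
  shift : ∀ b a k, ∀ x ∈ O, q b (a + 1) k x = q (b + 1) a k x - x 0 • q b a k x

namespace IsKernelFamily

variable {O : Set (Para n)} {q : ℕ → ℕ → ℕ → Para n → Cl n}

lemma axialFun_shift (h : IsKernelFamily O q) (b a k : ℕ) {x : Para n} (hx : x ∈ O) :
    axialFun (q b) (a + 1) k x = axialFun (q (b + 1)) a k x - x 0 • axialFun (q b) a k x := by
  simp only [axialFun, h.shift b _ k x hx, mul_sub, mul_smul_comm, smul_add, smul_sub]
  abel

/-- One `D̄` yields `4k F_{1,k+1}` and a scalar term. Writing `F_{1,k+1}` through the shift in `b`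
as a combination of functions `F_{0,k+1}`, one stays at `a = 0`, where the induction hypothesis
applies for all `b`. -/
lemma diracConj_iterate_axialFun (h : IsKernelFamily O q) (m : ℕ) :
    ∀ b k : ℕ, n + 1 = 2 * (k + m) → EqOn (diracConj^[m] (axialFun (q b) 0 k))
      ((4 ^ m * k.ascFactorial m : ℝ) • axialFun (q b) m (k + m)) O := by
  induction m with
  | zero => intro b k _ x hx; simp
  | succ m ih =>
    intro b k hk x hx
    have hO := (h.radial b).isOpen
    have hD := isLocalOp_diracConj (n := n)
    have sF := fun b => (h.radial b).contDiffOn_axialFun 0 (k + 1)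
    have hk' : (n - 2 * k - 1 : ℝ) = 2 * m := by
      have : (n + 1 : ℝ) = 2 * (k + (m + 1)) := by exact_mod_cast hk
      linarith
    have e1 : EqOn (diracConj (axialFun (q b) 0 k))
        ((4 * k : ℝ) • (axialFun (q (b + 1)) 0 (k + 1) - fun x => x 0 • axialFun (q b) 0 (k + 1) x) +
          (2 * m : ℝ) • q b 0 k) O := fun y hy => by
      rw [(h.radial b).diracConj_axialFun 0 k hy, hk', h.axialFun_shift b 0 (k + 1) hy]
      simp
    -- The scalar term with coefficient `n - 2k - 1 = 2m` cancels the Leibniz term `4km D̄^(m-1)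
    -- F_{0,k+1}`. For `m = 0` both sides vanish, so the truncated `m - 1` does no harm.
    have e2 : (m : ℝ) • diracConj^[m] (q b 0 k) x =
        (m : ℝ) • ((2 * k : ℝ) • diracConj^[m - 1] (axialFun (q b) 0 (k + 1)) x) := by
      rcases m with _ | m
      · simp
      · congr 1
        have e3 : EqOn (diracConj (q b 0 k)) ((2 * k : ℝ) • axialFun (q b) 0 (k + 1)) O :=
          fun y hy => by
            rw [(h.radial b).diracConj_eq 0 k hy]
            simp
        rw [Function.iterate_succ_apply, (hD.iterate m).congr hO e3 hx,
          (hD.iterate m).smul _ hO (sF b) hx]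
        rfl
    have hm := hD.iterate m
    have s0 := contDiffOn_coord_smul (sF b)
    have s1 : ContDiffOn ℝ ∞ (axialFun (q (b + 1)) 0 (k + 1) -
      fun x => x 0 • axialFun (q b) 0 (k + 1) x) O := (sF (b + 1)).sub s0
    have s2 := (h.radial b).contDiffOn 0 k
    rw [Function.iterate_succ_apply, hm.congr hO e1 hx,
      hm.add (f := (4 * k : ℝ) • _) (g := (2 * m : ℝ) • _) hO (s1.const_smul (4 * k : ℝ)) (s2.const_smul (2 * m : ℝ)) hx, Pi.add_apply,
      hm.smul _ hO s1 hx, hm.smul _ hO s2 hx, Pi.smul_apply, Pi.smul_apply, hm.sub hO (sF _) s0 hx,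
      Pi.sub_apply, diracConj_iterate_coord_smul hO (sF b) m hx, mul_smul (2 : ℝ) (m : ℝ), e2]
    beta_reduce
    rw [ih (b + 1) (k + 1) (by omega) hx, ih b (k + 1) (by omega) hx, Pi.smul_apply, Pi.smul_apply,
      Pi.smul_apply, h.axialFun_shift b m (k + (m + 1)) hx, show k + 1 + m = k + (m + 1) by ring]
    have hasc : (k * (k + 1).ascFactorial m : ℝ) = k.ascFactorial (m + 1) := by
      have := Nat.succ_ascFactorial k m
      rw [Nat.ascFactorial_succ]
      exact_mod_cast this
    rw [← hasc, pow_succ]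
    module

lemma leftOp_axialFun (h : IsKernelFamily O q) {ℓ : ℕ} (hn : Odd n) (hℓ : ℓ ≤ sce n) :
    EqOn (leftOp ℓ (axialFun (q 0) 0 1))
      ((gammaConst n * kernelConst n ℓ) • axialFun (q 0) (sce n - ℓ) (sce n + 1)) O := by
  intro x hx
  obtain ⟨s, hs⟩ := hn
  have hsce : sce n = s := by rw [sce, hs]; omega
  have hO := (h.radial 0).isOpen
  have hm := (isLocalOp_diracConj (n := n)).iterate (sce n - ℓ)
  rw [leftOp_eq hO ((h.radial 0).contDiffOn_axialFun 0 1) hx,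
    hm.congr hO ((h.radial 0).lap_iterate_axialFun hs (hsce ▸ hℓ)) hx,
    hm.smul _ hO ((h.radial 0).contDiffOn_axialFun 0 _) hx, Pi.smul_apply,
    h.diracConj_iterate_axialFun _ 0 (ℓ + 1) (by omega) hx, Pi.smul_apply, Pi.smul_apply, smul_smul,
    show ℓ + 1 + (sce n - ℓ) = sce n + 1 by omega]
  congr 1
  rw [hsce] at hℓ ⊢
  obtain ⟨m, rfl⟩ := Nat.exists_eq_add_of_le hℓ
  -- With `sce n = ℓ + m`, both products of factorials equal `(ℓ + m)!`, which is also the Gamma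
  -- value; hence its square in `gammaConst` and the `m!` in the denominator of `kernelConst`.
  have h1 : (ℓ.factorial * (ℓ + 1).ascFactorial m : ℝ) = (ℓ + m).factorial := by
    exact_mod_cast Nat.factorial_mul_ascFactorial ℓ m
  have h2 : (m.factorial * (ℓ + m).descFactorial ℓ : ℝ) = (ℓ + m).factorial := by
    have := Nat.factorial_mul_descFactorial (n := ℓ + m) (k := ℓ) (by omega)
    rw [Nat.add_sub_cancel_left] at this
    exact_mod_cast this
  have hmf : (m.factorial : ℝ) ≠ 0 := by exact_mod_cast m.factorial_ne_zero
  have hG : Real.Gamma (((n : ℝ) + 1) / 2) = (ℓ + m).factorial := by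
    rw [← Real.Gamma_nat_eq_factorial]
    congr 1
    rw [hs]
    push_cast
    ring
  have hz : (-1 : ℝ) ^ ((ℓ : ℤ) - ((ℓ + m : ℕ) : ℤ)) = (-1) ^ m := by
    rw [show (ℓ : ℤ) - ((ℓ + m : ℕ) : ℤ) = -(m : ℤ) by push_cast; ring, zpow_neg, zpow_natCast,
      ← inv_pow]
    norm_num
  have hm2 : (-1 : ℝ) ^ m * (-1) ^ m = 1 := by rw [← mul_pow]; norm_num
  rw [gammaConst, kernelConst, hsce, hG, hz, Nat.add_sub_cancel_left,
    show n - 1 = 2 * (ℓ + m) by omega, pow_mul]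
  rw [eq_comm, ← mul_div_assoc, div_eq_iff hmf]
  have h4 : (-4 : ℝ) ^ ℓ = (-1) ^ ℓ * 4 ^ ℓ := by rw [← mul_pow]; norm_num
  rw [h4, pow_add (-1 : ℝ), show (2 : ℝ) ^ 2 = 4 by norm_num, pow_add (4 : ℝ)]
  linear_combination (-1 : ℝ) ^ ℓ * 4 ^ ℓ * 4 ^ m * ((ℓ + m).factorial : ℝ) ^ 2 * hm2 -
    (-1 : ℝ) ^ ℓ * 4 ^ ℓ * 4 ^ m * (m.factorial * (ℓ + m).descFactorial ℓ) * h1 -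
    (-1 : ℝ) ^ ℓ * 4 ^ ℓ * 4 ^ m * (ℓ + m).factorial * h2

end IsKernelFamily

/-! ### Complexification -/

/-- The complexification of `Cl n`, in coordinates. -/
abbrev ComplexCl (n : ℕ) : Type := Finset (Fin n) → ℂ

/-- The embedding of `Cl n` into its complexification. -/
def toComplexCl : Cl n →L[ℝ] ComplexCl n := LinearMap.toContinuousLinearMap
  { toFun := fun a A => (coordEquiv n a A : ℂ)
    map_add' := fun a b => by ext A; simp
    map_smul' := fun c a => by ext A; simp }

/-- The real part of an element of the complexification. -/
def reCl : ComplexCl n →L[ℝ] Cl n := LinearMap.toContinuousLinearMap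
  { toFun := fun e => (coordEquiv n).symm (WithLp.toLp 2 fun A => (e A).re)
    map_add' := fun a b => by rw [← map_add]; congr 1
    map_smul' := fun c a => by
      rw [RingHom.id_apply, ← map_smul]; congr 1; ext A; simp }

/-- The imaginary part of an element of the complexification. -/
def imCl : ComplexCl n →L[ℝ] Cl n := LinearMap.toContinuousLinearMap
  { toFun := fun e => (coordEquiv n).symm (WithLp.toLp 2 fun A => (e A).im)
    map_add' := fun a b => by rw [← map_add]; congr 1
    map_smul' := fun c a => by
      rw [RingHom.id_apply, ← map_smul]; congr 1; ext A; simp }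

lemma reCl_apply (e : ComplexCl n) :
    reCl e = (coordEquiv n).symm (WithLp.toLp 2 fun A => (e A).re) := rfl

lemma imCl_apply (e : ComplexCl n) :
    imCl e = (coordEquiv n).symm (WithLp.toLp 2 fun A => (e A).im) := rfl

lemma toComplexCl_apply (a : Cl n) (A : Finset (Fin n)) :
    toComplexCl a A = (coordEquiv n a A : ℂ) := rfl

@[simp] lemma reCl_toComplexCl (a : Cl n) : reCl (toComplexCl a) = a := by
  simp [reCl_apply, toComplexCl_apply]

@[simp] lemma imCl_toComplexCl (a : Cl n) : imCl (toComplexCl a) = 0 := by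
  simp only [imCl_apply, toComplexCl_apply, Complex.ofReal_im]
  exact map_zero (coordEquiv n).symm

@[simp] lemma reCl_I_smul (e : ComplexCl n) : reCl (Complex.I • e) = -imCl e := by
  rw [reCl_apply, imCl_apply, ← map_neg]
  congr 1
  ext A
  simp

@[simp] lemma imCl_I_smul (e : ComplexCl n) : imCl (Complex.I • e) = reCl e := by
  rw [reCl_apply, imCl_apply]
  congr 1
  ext A
  simp

lemma complex_smul_eq (c : ℂ) (e : ComplexCl n) :
    c • e = c.re • e + c.im • (Complex.I • e) := by
  nth_rewrite 1 [← Complex.re_add_im c]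
  rw [add_smul, mul_smul, Complex.coe_smul, Complex.coe_smul]

/-- The holomorphic function with the components `α` and `β`. -/
def stem (α β : ℝ × ℝ → Cl n) (z : ℂ) : ComplexCl n :=
  toComplexCl (α (z.re, z.im)) + Complex.I • toComplexCl (β (z.re, z.im))

/-- The Cauchy-Riemann equations say that the real derivative at `i` is `i` times the one at `1`,
i.e. that it is complex linear. -/
lemma differentiableAt_stem {α β : ℝ × ℝ → Cl n} {z : ℂ}
    (hα : DifferentiableAt ℝ α (z.re, z.im)) (hβ : DifferentiableAt ℝ β (z.re, z.im))
    (h1 : fderiv ℝ α (z.re, z.im) (1, 0) - fderiv ℝ β (z.re, z.im) (0, 1) = 0)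
    (h2 : fderiv ℝ α (z.re, z.im) (0, 1) + fderiv ℝ β (z.re, z.im) (1, 0) = 0) :
    DifferentiableAt ℂ (stem α β) z := by
  have key : ∀ α : ℝ × ℝ → Cl n, DifferentiableAt ℝ α (z.re, z.im) →
      HasFDerivAt (fun z : ℂ => toComplexCl (α (z.re, z.im)))
        (toComplexCl ∘L (fderiv ℝ α (z.re, z.im)) ∘L Complex.equivRealProdCLM.toContinuousLinearMap)
        z := fun α hα => by
    have e : HasFDerivAt (fun z : ℂ => (z.re, z.im))
        Complex.equivRealProdCLM.toContinuousLinearMap z := Complex.equivRealProdCLM.hasFDerivAt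
    exact toComplexCl.hasFDerivAt.comp z (hα.hasFDerivAt.comp z e)
  have hst : HasFDerivAt (stem α β) _ z := (key α hα).add ((key β hβ).const_smul Complex.I)
  rw [differentiableAt_complex_iff_differentiableAt_real]
  refine ⟨hst.differentiableAt, ?_⟩
  rw [hst.fderiv]
  simp only [add_apply, smul_apply, ContinuousLinearMap.comp_apply,
    ContinuousLinearEquiv.coe_coe, Complex.equivRealProdCLM_apply, Complex.I_re, Complex.I_im,
    Complex.one_re, Complex.one_im]
  rw [sub_eq_zero.mp h1, eq_neg_of_add_eq_zero_left h2, map_neg, smul_add, smul_smul,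
    Complex.I_mul_I]
  simp [add_comm]

/-! ### Points of slices -/

lemma vecPart_slicePoint (I : EuclideanSpace ℝ (Fin n)) (u v : ℝ) :
    vecPart (slicePoint I u v) = v • I := by
  ext i
  simp [vecPart, slicePoint]

@[simp] lemma slicePoint_zero (I : EuclideanSpace ℝ (Fin n)) (u v : ℝ) :
    slicePoint I u v 0 = u := by
  simp [slicePoint]

lemma para_ext {x y : Para n} (h0 : x 0 = y 0) (h : vecPart x = vecPart y) : x = y := by
  ext i
  refine Fin.cases h0 (fun j => ?_) i
  exact congrArg (fun v : EuclideanSpace ℝ (Fin n) => v j) h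

lemma norm_of_mem_unitSphere {I : EuclideanSpace ℝ (Fin n)} (hI : I ∈ unitSphere n) : ‖I‖ = 1 := by
  simpa [unitSphere] using hI

lemma neg_mem_unitSphere {I : EuclideanSpace ℝ (Fin n)} (hI : I ∈ unitSphere n) :
    -I ∈ unitSphere n := by
  simpa [unitSphere] using hI

lemma slicePoint_neg (I : EuclideanSpace ℝ (Fin n)) (u v : ℝ) :
    slicePoint (-I) u v = slicePoint I u (-v) :=
  para_ext (by simp) (by simp [vecPart_slicePoint])

lemma AxiallySymmetric.slicePoint_mem {W : Set (Para n)} (hW : AxiallySymmetric W)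
    {I J : EuclideanSpace ℝ (Fin n)} (hI : I ∈ unitSphere n) (hJ : J ∈ unitSphere n) {u v : ℝ}
    (h : slicePoint I u v ∈ W) : slicePoint J u v ∈ W := by
  have hn : ‖vecPart (slicePoint I u v)‖ = |v| := by
    rw [vecPart_slicePoint, norm_smul, norm_of_mem_unitSphere hI, mul_one, Real.norm_eq_abs]
  refine hW _ h ?_
  rcases abs_choice v with hv | hv
  · exact ⟨J, hJ, by rw [hn, hv, slicePoint_zero]⟩
  · exact ⟨-J, neg_mem_unitSphere hJ, by rw [hn, hv, slicePoint_zero, slicePoint_neg, neg_neg]⟩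

lemma mem_paramSet_iff {W : Set (Para n)} (hW : AxiallySymmetric W)
    {I : EuclideanSpace ℝ (Fin n)} (hI : I ∈ unitSphere n) {p : ℝ × ℝ} :
    p ∈ paramSet W ↔ slicePoint I p.1 p.2 ∈ W :=
  ⟨fun h => h I hI, fun h _ hJ => hW.slicePoint_mem hI hJ h⟩

lemma continuous_slicePoint (I : EuclideanSpace ℝ (Fin n)) :
    Continuous fun z : ℂ => slicePoint I z.re z.im := by
  unfold slicePoint
  refine (PiLp.continuous_toLp 2 _).comp (continuous_pi fun i => ?_)
  refine Fin.cases ?_ (fun j => ?_) i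
  · simpa using Complex.continuous_re
  · simp only [Fin.cons_succ]
    fun_prop

lemma isOpen_sliceSet {W : Set (Para n)} (hW : IsOpen W) (I : EuclideanSpace ℝ (Fin n)) :
    IsOpen (sliceSet I W) := hW.preimage (continuous_slicePoint I)

lemma conj_mem_sliceSet {W : Set (Para n)} (hW : AxiallySymmetric W)
    {I : EuclideanSpace ℝ (Fin n)} (hI : I ∈ unitSphere n) {z : ℂ} (hz : z ∈ sliceSet I W) :
    (starRingEnd ℂ) z ∈ sliceSet I W := by
  have : slicePoint (-I) z.re z.im ∈ W := hW.slicePoint_mem hI (neg_mem_unitSphere hI) hz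
  rw [slicePoint_neg] at this
  exact this

lemma exists_eq_slicePoint {I : EuclideanSpace ℝ (Fin n)} (hI : I ∈ unitSphere n) (x : Para n) :
    ∃ J ∈ unitSphere n, x = slicePoint J (x 0) ‖vecPart x‖ := by
  by_cases h : vecPart x = 0
  · exact ⟨I, hI, para_ext (by simp) (by simp [vecPart_slicePoint, h])⟩
  · have hn : ‖vecPart x‖ ≠ 0 := norm_ne_zero_iff.mpr h
    refine ⟨‖vecPart x‖⁻¹ • vecPart x, ?_, para_ext (by simp) ?_⟩
    · simp [unitSphere, norm_smul, hn]
    · rw [vecPart_slicePoint, smul_smul, mul_inv_cancel₀ hn, one_smul]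

lemma upperPoint_mem_sliceSet_iff {W : Set (Para n)} (hW : AxiallySymmetric W)
    {I : EuclideanSpace ℝ (Fin n)} (hI : I ∈ unitSphere n) {x : Para n} :
    upperPoint x ∈ sliceSet I W ↔ x ∈ W := by
  obtain ⟨J, hJ, hx⟩ := exists_eq_slicePoint hI x
  nth_rewrite 2 [hx]
  exact ⟨fun h => hW.slicePoint_mem hI hJ h, fun h => hW.slicePoint_mem hJ hI h⟩

/-! ### Slice hyperholomorphic functions as kernel integrals -/

lemma isKernelFamily_kernelIntegral {m : ℕ} {γ : Fin m → ℝ → ℂ} {V O : Set ℂ}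
    (h : IsCauchyCycle γ V O) (hO : ∀ z ∈ O, (starRingEnd ℂ) z ∈ O) {ψ : ℂ → ComplexCl n}
    (hψ : ContinuousOn ψ V) (L : ComplexCl n →L[ℝ] Cl n) :
    IsKernelFamily (upperPoint (n := n) ⁻¹' O) fun b a k x => L (kernelIntegral γ ψ b a k x) :=
  ⟨fun b => (h.isRadialFamily hO hψ b).comp L, fun b a k x hx => by
    rw [h.kernelIntegral_shift hO hψ b a k hx, map_sub, map_smul]⟩

/-! ### Recovering the function from its stem -/

section Representation

variable {W : Set (Para n)} {f : Para n → Cl n} {α β : ℝ × ℝ → Cl n}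
  {I : EuclideanSpace ℝ (Fin n)}

lemma differentiableOn_stem (hW : AxiallySymmetric W) (hI : I ∈ unitSphere n)
    (hcr : CauchyRiemann (paramSet W) α β) : DifferentiableOn ℂ (stem α β) (sliceSet I W) :=
  fun z hz => by
    obtain ⟨h1, h2, h3, h4⟩ := hcr (z.re, z.im) ((mem_paramSet_iff hW hI).mpr hz)
    exact (differentiableAt_stem h1 h2 h3 h4).differentiableWithinAt

variable {m : ℕ} {γ : Fin m → ℝ → ℂ} {O : Set ℂ}

/-- By parity the stem takes the values `α ± iβ` at the two conjugate points; their half sum and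
half difference isolate `α` and `iβ`. The factor `‖vecPart x‖` avoids a division on the real axis.
-/
lemma kernelIntegral_stem (hWo : IsOpen W) (hW : AxiallySymmetric W) (hI : I ∈ unitSphere n)
    (heo : EvenOdd (paramSet W) α β) (hcr : CauchyRiemann (paramSet W) α β)
    (h : IsCauchyCycle γ (sliceSet I W) O) (hO : ∀ z ∈ O, (starRingEnd ℂ) z ∈ O) {x : Para n}
    (hx : upperPoint x ∈ O) :
    kernelIntegral γ (stem α β) 0 1 1 x = toComplexCl (α (x 0, ‖vecPart x‖)) ∧
      ‖vecPart x‖ • kernelIntegral γ (stem α β) 0 0 1 x = toComplexCl (β (x 0, ‖vecPart x‖)) := by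
  have hV := isOpen_sliceSet hWo I
  have hψ := differentiableOn_stem hW hI hcr
  have h1 := h.two_smul_kernelIntegral_one hV hO hψ hx
  have h2 := h.norm_smul_kernelIntegral_zero hV hO hψ hx
  obtain ⟨ha, hb⟩ := heo (x 0, ‖vecPart x‖) ((mem_paramSet_iff hW hI).mpr (h.subset hx))
  have e1 : stem α β (upperPoint x) = toComplexCl (α (x 0, ‖vecPart x‖)) +
      Complex.I • toComplexCl (β (x 0, ‖vecPart x‖)) := rfl
  have e2 : stem α β ((starRingEnd ℂ) (upperPoint x)) = toComplexCl (α (x 0, ‖vecPart x‖)) -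
      Complex.I • toComplexCl (β (x 0, ‖vecPart x‖)) := by
    have : stem α β ((starRingEnd ℂ) (upperPoint x)) = toComplexCl (α (x 0, -‖vecPart x‖)) +
      Complex.I • toComplexCl (β (x 0, -‖vecPart x‖)) := rfl
    rw [this, ha, hb, map_neg, smul_neg, sub_eq_add_neg]
  rw [e1, e2] at h1 h2
  constructor
  · refine smul_right_injective _ (two_ne_zero (α := ℂ)) (h1.trans ?_)
    module
  · have h2I : (2 * Complex.I : ℂ) ≠ 0 := mul_ne_zero two_ne_zero Complex.I_ne_zero
    refine smul_right_injective _ h2I ?_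
    refine Eq.trans ?_ (h2.trans ?_)
    · simp only [mul_smul, Complex.coe_smul]
    · module

lemma eqOn_axialFun_reCl (hWo : IsOpen W) (hW : AxiallySymmetric W) (hI : I ∈ unitSphere n)
    (hf : LeftForm W f α β) (heo : EvenOdd (paramSet W) α β)
    (hcr : CauchyRiemann (paramSet W) α β) (h : IsCauchyCycle γ (sliceSet I W) O)
    (hO : ∀ z ∈ O, (starRingEnd ℂ) z ∈ O) :
    EqOn f (axialFun (fun a k x => reCl (kernelIntegral γ (stem α β) 0 a k x)) 0 1)
      (upperPoint ⁻¹' O) := by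
  intro x hx
  obtain ⟨h1, h2⟩ := kernelIntegral_stem hWo hW hI heo hcr h hO hx
  obtain ⟨J, hJ, hxJ⟩ := exists_eq_slicePoint hI x
  have hp : (x 0, ‖vecPart x‖) ∈ paramSet W := (mem_paramSet_iff hW hI).mpr (h.subset hx)
  have hv : vecCLM x = ‖vecPart x‖ • vec J := by
    nth_rewrite 1 [hxJ]
    rw [vecCLM_apply, vecPart_slicePoint, vec, vec, ← map_smul]
    rfl
  have h3 := congrArg reCl h2
  rw [map_smul, reCl_toComplexCl] at h3
  rw [axialFun, zero_add, h1, reCl_toComplexCl, hv, smul_mul_assoc, ← mul_smul_comm, h3]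
  nth_rewrite 1 [hxJ]
  exact hf _ hp J hJ

/-- The components recovered by Cauchy's formula are real. The imaginary parts thus form a family
representing zero, to which the operators can be applied. -/
lemma eqOn_axialFun_imCl (hWo : IsOpen W) (hW : AxiallySymmetric W) (hI : I ∈ unitSphere n)
    (heo : EvenOdd (paramSet W) α β)
    (hcr : CauchyRiemann (paramSet W) α β) (h : IsCauchyCycle γ (sliceSet I W) O)
    (hO : ∀ z ∈ O, (starRingEnd ℂ) z ∈ O) :
    EqOn (axialFun (fun a k x => imCl (kernelIntegral γ (stem α β) 0 a k x)) 0 1) 0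
      (upperPoint ⁻¹' O) := by
  intro x hx
  obtain ⟨h1, h2⟩ := kernelIntegral_stem hWo hW hI heo hcr h hO hx
  obtain ⟨J, hJ, hxJ⟩ := exists_eq_slicePoint hI x
  have hv : vecCLM x = ‖vecPart x‖ • vec J := by
    nth_rewrite 1 [hxJ]
    rw [vecCLM_apply, vecPart_slicePoint, vec, vec, ← map_smul]
    rfl
  have h3 := congrArg imCl h2
  rw [map_smul, imCl_toComplexCl] at h3
  rw [axialFun, zero_add, h1, imCl_toComplexCl, hv, smul_mul_assoc, ← mul_smul_comm, h3]
  simp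

end Representation

/-- The point with the opposite vector part. -/
def reflectVec (x : Para n) : Para n := WithLp.toLp 2 (Fin.cons (x 0) fun i => -x i.succ)

lemma reflectVec_zero (x : Para n) : reflectVec x 0 = x 0 := rfl

lemma vecPart_reflectVec (x : Para n) : vecPart (reflectVec x) = -vecPart x := by
  ext i
  simp [vecPart, reflectVec]

lemma vecNormSq_reflectVec (x : Para n) : vecNormSq (reflectVec x) = vecNormSq x := by
  rw [vecNormSq_eq, vecNormSq_eq, vecPart_reflectVec, norm_neg]

lemma vecCLM_reflectVec (x : Para n) : vecCLM (reflectVec x) = -vecCLM x := by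
  rw [vecCLM_apply, vecCLM_apply, vecPart_reflectVec, vec, vec, ← map_neg]
  rfl

lemma vecCLM_eq_zero {x : Para n} (h : vecNormSq x = 0) : vecCLM x = 0 := by
  have h2 : vecPart x = 0 := by
    rw [vecNormSq_eq] at h
    simpa using h
  rw [vecCLM_apply, h2, vec]
  exact map_zero _

/-- The components of an axial function vanish if the function does. -/
lemma IsRadialFamily.components_eq_zero {O : Set (Para n)} {q : ℕ → ℕ → Para n → Cl n}
    (h : IsRadialFamily O q) {a k : ℕ} (h0 : EqOn (axialFun q a k) 0 O) {x : Para n} (hx : x ∈ O) :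
    q (a + 1) k x = 0 ∧ (vecNormSq x ≠ 0 → q a k x = 0) := by
  have h1 := h0 hx
  -- The reflected point gives the same two components with the sign of `x̲` changed; sum and
  -- difference separate them.
  have h2 := h0 (h.reflect x hx _ (reflectVec_zero x) (vecNormSq_reflectVec x))
  simp only [axialFun, Pi.zero_apply] at h1 h2
  rw [h.axial _ _ x hx _ (reflectVec_zero x) (vecNormSq_reflectVec x),
    h.axial _ _ x hx _ (reflectVec_zero x) (vecNormSq_reflectVec x), vecCLM_reflectVec,
    neg_mul] at h2
  have h3 : (2 : ℝ) • q (a + 1) k x = 0 := by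
    have := congrArg₂ (· + ·) h1 h2
    simp only [add_zero] at this
    rw [← this]
    module
  have h4 : q (a + 1) k x = 0 := (smul_eq_zero.mp h3).resolve_left two_ne_zero
  refine ⟨h4, fun hne => ?_⟩
  rw [h4, zero_add] at h1
  have h5 := vecCLM_mul_vecCLM x (q a k x)
  rw [h1, mul_zero, eq_comm, neg_eq_zero] at h5
  exact (smul_eq_zero.mp h5).resolve_left hne

/-! ### The integral representation -/

/-! ### The planes `ℂ_I` inside the Clifford algebra -/

section Embedding

variable {I : EuclideanSpace ℝ (Fin n)}

lemma vec_mul_vec_of_mem (hI : I ∈ unitSphere n) : vec I * vec I = -1 := by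
  rw [vec_mul_vec, norm_of_mem_unitSphere hI]
  simp

/-- The embedding of `ℂ` onto `ℂ_I`. -/
def sliceHom (hI : I ∈ unitSphere n) : ℂ →ₐ[ℝ] Cl n :=
  Complex.liftAux (vec I) (vec_mul_vec_of_mem hI)

lemma sliceHom_apply (hI : I ∈ unitSphere n) (z : ℂ) :
    sliceHom hI z = algebraMap ℝ (Cl n) z.re + z.im • vec I := Complex.liftAux_apply _ _ z

lemma toCl_eq (x : Para n) : toCl x = algebraMap ℝ (Cl n) (x 0) + vecCLM x := rfl

lemma toClConj_eq (x : Para n) : toClConj x = algebraMap ℝ (Cl n) (x 0) - vecCLM x := rfl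

lemma vecCLM_slicePoint (I : EuclideanSpace ℝ (Fin n)) (u v : ℝ) :
    vecCLM (slicePoint I u v) = v • vec I := by
  rw [vecCLM_apply, vecPart_slicePoint, vec, vec, ← map_smul]
  rfl

lemma toCl_slicePoint (hI : I ∈ unitSphere n) (z : ℂ) :
    toCl (slicePoint I z.re z.im) = sliceHom hI z := by
  rw [toCl_eq, vecCLM_slicePoint, slicePoint_zero, sliceHom_apply]

lemma sliceHom_ofReal (hI : I ∈ unitSphere n) (r : ℝ) :
    sliceHom hI (r : ℂ) = algebraMap ℝ (Cl n) r := by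
  rw [sliceHom_apply]
  simp

lemma sliceHom_I (hI : I ∈ unitSphere n) : sliceHom hI Complex.I = vec I := by
  simp [sliceHom_apply]

lemma norm_sq_eq_add (x : Para n) : ‖x‖ ^ 2 = x 0 ^ 2 + vecNormSq x := by
  rw [EuclideanSpace.real_norm_sq_eq, Fin.sum_univ_succ, vecNormSq]

lemma pseudoCauchy_slicePoint (hI : I ∈ unitSphere n) (s : ℂ) (x : Para n) :
    pseudoCauchy (slicePoint I s.re s.im) x = sliceHom hI (quad x s) := by
  rw [pseudoCauchy, toCl_slicePoint hI, norm_sq_eq_add, ← sliceHom_ofReal hI, ← map_pow,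
    ← map_smul, ← map_sub, ← map_add]
  congr 1
  rw [quad, Complex.real_smul]
  push_cast
  ring

lemma inverse_sliceHom (hI : I ∈ unitSphere n) {q : ℂ} (hq : q ≠ 0) :
    Ring.inverse (sliceHom hI q) = sliceHom hI q⁻¹ :=
  Ring.inverse_unit (Units.map (sliceHom hI : ℂ →* Cl n) (Units.mk0 q hq))

/-- The identification of the complexification with `Cl n` that multiplies the imaginary part by
`I` from the left. -/
def sliceCLM (I : EuclideanSpace ℝ (Fin n)) : ComplexCl n →L[ℝ] Cl n :=
  reCl + mulCLM (vec I) ∘L imCl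

lemma sliceCLM_apply (I : EuclideanSpace ℝ (Fin n)) (e : ComplexCl n) :
    sliceCLM I e = reCl e + vec I * imCl e := rfl

/-- Complex scalars turn into left factors from `ℂ_I`; this transports complex integrands to
Clifford-valued ones without any commutation with the values of `f`. -/
lemma sliceCLM_smul (hI : I ∈ unitSphere n) (c : ℂ) (e : ComplexCl n) :
    sliceCLM I (c • e) = sliceHom hI c * sliceCLM I e := by
  rw [complex_smul_eq, map_add, map_smul, map_smul, sliceHom_apply, add_mul, ← Algebra.smul_def,
    smul_mul_assoc]
  congr 2
  rw [sliceCLM_apply, sliceCLM_apply, reCl_I_smul, imCl_I_smul, mul_add, ← mul_assoc,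
    vec_mul_vec_of_mem hI]
  simp [add_comm]

lemma sliceCLM_stem (I : EuclideanSpace ℝ (Fin n)) (α β : ℝ × ℝ → Cl n) (z : ℂ) :
    sliceCLM I (stem α β z) = α (z.re, z.im) + vec I * β (z.re, z.im) := by
  simp [sliceCLM_apply, stem]

end Embedding

/-! ### The kernel integrand as the image of a complex integrand -/

section Integrand

variable {I : EuclideanSpace ℝ (Fin n)} {W : Set (Para n)} {f : Para n → Cl n}
  {α β : ℝ × ℝ → Cl n}

/-- The linear map that assembles the integrand from its components. -/
def assembleCLM (I : EuclideanSpace ℝ (Fin n)) (x : Para n) :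
    ComplexCl n × ComplexCl n →L[ℝ] Cl n :=
  sliceCLM I ∘L ContinuousLinearMap.fst ℝ _ _ +
    mulCLM (vecCLM x) ∘L sliceCLM I ∘L ContinuousLinearMap.snd ℝ _ _

lemma assembleCLM_apply (I : EuclideanSpace ℝ (Fin n)) (x : Para n) (e : ComplexCl n × ComplexCl n) :
    assembleCLM I x e = sliceCLM I e.1 + vecCLM x * sliceCLM I e.2 := rfl

/-- In `s - x̄ = (s - x₀) + x̲` the vector `x̲` does not commute with `I`, but it stands leftmost;
the remaining kernel factors and `ds_I` lie in the commutative plane `ℂ_I`. -/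
lemma leftIntegrand_eq (hn : Odd n) (hI : I ∈ unitSphere n) (hf : LeftForm W f α β) (ℓ : ℕ)
    (x : Para n) {γ : ℝ → ℂ} {t : ℝ} (ht : ((γ t).re, (γ t).im) ∈ paramSet W)
    (hq : quad x (γ t) ≠ 0) :
    leftIntegrand ℓ I γ f x t = (gammaConst n * kernelConst n ℓ) • assembleCLM I x
      (-Complex.I • (deriv γ t • (kernelFun 0 (sce n - ℓ + 1) (sce n + 1) x (γ t) •
          stem α β (γ t))),
        -Complex.I • (deriv γ t • (kernelFun 0 (sce n - ℓ) (sce n + 1) x (γ t) •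
          stem α β (γ t)))) := by
  have hexp : (n + 1) / 2 = sce n + 1 := by
    obtain ⟨s, hs⟩ := hn
    rw [sce, hs]; omega
  have hw : toCl (slicePoint I (γ t).re (γ t).im) - algebraMap ℝ (Cl n) (x 0) =
      sliceHom hI (γ t - x 0) := by
    rw [toCl_slicePoint hI, map_sub, sliceHom_ofReal]
  have hw' : toCl (slicePoint I (γ t).re (γ t).im) - toClConj x =
      sliceHom hI (γ t - x 0) + vecCLM x := by
    rw [← hw, toClConj_eq]; abel
  have hd : dsI I γ t = sliceHom hI (deriv γ t * -Complex.I) := by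
    rw [dsI, toCl_slicePoint hI, map_mul, map_neg, sliceHom_I]
  have hfs : f (slicePoint I (γ t).re (γ t).im) = sliceCLM I (stem α β (γ t)) := by
    rw [sliceCLM_stem]; exact hf _ ht I hI
  rw [leftIntegrand, leftP, leftF, curvePoint, hd, hfs, hw, hw', pseudoCauchy_slicePoint hI,
    inverse_sliceHom hI hq, hexp, assembleCLM_apply, sliceCLM_smul hI, sliceCLM_smul hI,
    sliceCLM_smul hI, sliceCLM_smul hI, sliceCLM_smul hI, sliceCLM_smul hI, smul_mul_assoc,
    smul_mul_assoc, smul_mul_assoc, smul_mul_assoc, smul_mul_assoc, smul_smul, mul_comm (gammaConst n),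
    ← map_pow, ← map_pow]
  congr 1
  simp only [add_mul, ← mul_assoc, kernelFun, pow_zero, one_mul]
  simp only [mul_assoc (vecCLM x), ← map_mul]
  refine congrArg₂ (· + ·) (congrArg (· * _) (congrArg _ ?_))
    (congrArg (vecCLM x * ·) (congrArg (· * _) (congrArg _ ?_))) <;> ring

lemma continuousOn_stem (hW : AxiallySymmetric W) (hI : I ∈ unitSphere n)
    (hcr : CauchyRiemann (paramSet W) α β) : ContinuousOn (stem α β) (sliceSet I W) :=
  (differentiableOn_stem hW hI hcr).continuousOn

variable {m : ℕ} {γ : Fin m → ℝ → ℂ} {O : Set ℂ}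

lemma intervalIntegrable_leftIntegrand (hn : Odd n) (hW : AxiallySymmetric W)
    (hI : I ∈ unitSphere n) (hf : LeftForm W f α β) (hcr : CauchyRiemann (paramSet W) α β)
    (h : IsCauchyCycle γ (sliceSet I W) O) (hO : ∀ z ∈ O, (starRingEnd ℂ) z ∈ O) (ℓ : ℕ)
    {x : Para n} (hx : upperPoint x ∈ O) (j : Fin m) :
    IntervalIntegrable (leftIntegrand ℓ I (γ j) f x) volume 0 1 ∧
    ∫ t in (0 : ℝ)..1, leftIntegrand ℓ I (γ j) f x t =
      (gammaConst n * kernelConst n ℓ) • assembleCLM I x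
      (-Complex.I • (∫ t in (0 : ℝ)..1, deriv (γ j) t •
        (kernelFun 0 (sce n - ℓ + 1) (sce n + 1) x (γ j t) • stem α β (γ j t))),
       -Complex.I • (∫ t in (0 : ℝ)..1, deriv (γ j) t •
        (kernelFun 0 (sce n - ℓ) (sce n + 1) x (γ j t) • stem α β (γ j t)))) := by
  have hψ := continuousOn_stem hW hI hcr
  have hint := fun a => (h.good j).intervalIntegrable
    (h.continuousOn_kernelFun_smul hO hψ 0 a (sce n + 1) hx j)
  set F : ℝ → ComplexCl n × ComplexCl n := fun t =>
    (-Complex.I • (deriv (γ j) t •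
        (kernelFun 0 (sce n - ℓ + 1) (sce n + 1) x (γ j t) • stem α β (γ j t))),
     -Complex.I • (deriv (γ j) t •
        (kernelFun 0 (sce n - ℓ) (sce n + 1) x (γ j t) • stem α β (γ j t)))) with hF
  have hFi : IntervalIntegrable F volume 0 1 := by
    have h1 := (hint (sce n - ℓ + 1)).smul (-Complex.I)
    have h2 := (hint (sce n - ℓ)).smul (-Complex.I)
    exact ⟨h1.1.prodMk h2.1, h1.2.prodMk h2.2⟩
  have heq : ∀ t ∈ Icc (0 : ℝ) 1, leftIntegrand ℓ I (γ j) f x t =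
      (gammaConst n * kernelConst n ℓ) • assembleCLM I x (F t) := fun t ht =>
    leftIntegrand_eq hn hI hf ℓ x ((mem_paramSet_iff hW hI).mpr (h.mem j t ht))
      (h.quad_ne_zero hO hx j (mem_image_of_mem _ ht))
  have hLi : IntervalIntegrable (fun t => assembleCLM I x (F t)) volume 0 1 :=
    ⟨(assembleCLM I x).integrable_comp hFi.1, (assembleCLM I x).integrable_comp hFi.2⟩
  constructor
  · refine (intervalIntegrable_congr fun t ht => ?_).mpr
      (hLi.smul (gammaConst n * kernelConst n ℓ))
    exact heq t (uIoc_zero_one_subset ht)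
  · rw [intervalIntegral.integral_congr (g := fun t =>
        (gammaConst n * kernelConst n ℓ) • assembleCLM I x (F t)),
      intervalIntegral.integral_smul, ContinuousLinearMap.intervalIntegral_comp_comm _ hFi]
    · congr 2
      have h1 := (ContinuousLinearMap.fst ℝ (ComplexCl n) (ComplexCl n)).intervalIntegral_comp_comm hFi
      have h2 := (ContinuousLinearMap.snd ℝ (ComplexCl n) (ComplexCl n)).intervalIntegral_comp_comm hFi
      refine Prod.ext (h1.symm.trans ?_) (h2.symm.trans ?_)
      · exact intervalIntegral.integral_smul (-Complex.I) (fun t => deriv (γ j) t •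
          (kernelFun 0 (sce n - ℓ + 1) (sce n + 1) x (γ j t) • stem α β (γ j t)))
      · exact intervalIntegral.integral_smul (-Complex.I) (fun t => deriv (γ j) t •
          (kernelFun 0 (sce n - ℓ) (sce n + 1) x (γ j t) • stem α β (γ j t)))
    · intro t ht
      rw [uIcc_of_le zero_le_one] at ht
      exact heq t ht

lemma leftIntegral_eq (hn : Odd n) (hW : AxiallySymmetric W)
    (hI : I ∈ unitSphere n) (hf : LeftForm W f α β) (hcr : CauchyRiemann (paramSet W) α β)
    (h : IsCauchyCycle γ (sliceSet I W) O) (hO : ∀ z ∈ O, (starRingEnd ℂ) z ∈ O) (ℓ : ℕ)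
    {x : Para n} (hx : upperPoint x ∈ O) :
    leftIntegral ℓ I γ f x = (gammaConst n * kernelConst n ℓ) • assembleCLM I x
      (kernelIntegral γ (stem α β) 0 (sce n - ℓ + 1) (sce n + 1) x,
        kernelIntegral γ (stem α β) 0 (sce n - ℓ) (sce n + 1) x) := by
  have key := fun j => (intervalIntegrable_leftIntegrand hn hW hI hf hcr h hO ℓ hx j).2
  rw [leftIntegral, Finset.sum_congr rfl fun j _ => key j, ← Finset.smul_sum, ← map_sum,
    smul_comm, ← map_smul]
  congr 2
  -- The `-i` of `ds_I` and the factor `1/(2π)` combine to the Cauchy constant `1/(2πi)`.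
  have hc : ∀ e : ComplexCl n, (1 / (2 * Real.pi)) • (-Complex.I • e) =
      (2 * Real.pi * Complex.I : ℂ)⁻¹ • e := fun e => by
    rw [← Complex.coe_smul, smul_smul]
    congr 1
    rw [mul_inv, Complex.inv_I]
    push_cast
    ring
  refine Prod.ext ?_ ?_
  · rw [Prod.smul_fst, Prod.fst_sum, ← Finset.smul_sum, hc]
    rfl
  · rw [Prod.smul_snd, Prod.snd_sum, ← Finset.smul_sum, hc]
    rfl

lemma gammaConst_mul_kernelConst_ne_zero (n ℓ : ℕ) : gammaConst n * kernelConst n ℓ ≠ 0 := by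
  refine mul_ne_zero (mul_ne_zero (mul_ne_zero (pow_ne_zero _ ?_) (by positivity)) ?_)
    (div_ne_zero ?_ ?_)
  · exact (Real.Gamma_pos_of_pos (by positivity)).ne'
  · exact pow_ne_zero _ (by norm_num)
  · exact zpow_ne_zero _ (by norm_num)
  · exact_mod_cast Nat.factorial_ne_zero _

lemma leftOp_eqOn_axialFun (hn : Odd n) {ℓ : ℕ} (hℓ : ℓ ≤ sce n) (hWo : IsOpen W)
    (hW : AxiallySymmetric W) (hI : I ∈ unitSphere n) (hf : LeftForm W f α β)
    (heo : EvenOdd (paramSet W) α β) (hcr : CauchyRiemann (paramSet W) α β)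
    (h : IsCauchyCycle γ (sliceSet I W) O) (hO : ∀ z ∈ O, (starRingEnd ℂ) z ∈ O) :
    EqOn (leftOp ℓ f) ((gammaConst n * kernelConst n ℓ) •
      axialFun (fun a k x => reCl (kernelIntegral γ (stem α β) 0 a k x)) (sce n - ℓ) (sce n + 1))
      (upperPoint ⁻¹' O) := by
  have hfam := isKernelFamily_kernelIntegral (n := n) h hO (continuousOn_stem hW hI hcr) reCl
  exact ((isLocalOp_leftOp ℓ).congr (hfam.radial 0).isOpen
    (eqOn_axialFun_reCl hWo hW hI hf heo hcr h hO)).trans (hfam.leftOp_axialFun hn hℓ)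

/-- The operator is applied to a function that is zero, and its constant factor is nonzero. No
symmetry of the paths under conjugation is needed. -/
lemma axialFun_imCl_eq_zero (hn : Odd n) {ℓ : ℕ} (hℓ : ℓ ≤ sce n) (hWo : IsOpen W)
    (hW : AxiallySymmetric W) (hI : I ∈ unitSphere n)
    (heo : EvenOdd (paramSet W) α β) (hcr : CauchyRiemann (paramSet W) α β)
    (h : IsCauchyCycle γ (sliceSet I W) O) (hO : ∀ z ∈ O, (starRingEnd ℂ) z ∈ O) :
    EqOn (axialFun (fun a k x => imCl (kernelIntegral γ (stem α β) 0 a k x))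
      (sce n - ℓ) (sce n + 1)) 0 (upperPoint ⁻¹' O) := by
  have hfam := isKernelFamily_kernelIntegral (n := n) h hO (continuousOn_stem hW hI hcr) imCl
  have hop := isLocalOp_leftOp (n := n) ℓ
  have ho := (hfam.radial 0).isOpen
  intro x hx
  have h1 := hfam.leftOp_axialFun hn hℓ hx
  rw [hop.congr ho (eqOn_axialFun_imCl hWo hW hI heo hcr h hO) hx, hop.zero ho hx, Pi.zero_apply,
    eq_comm, Pi.smul_apply] at h1
  exact (smul_eq_zero.mp h1).resolve_left (gammaConst_mul_kernelConst_ne_zero n ℓ)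

/-- The integral consists of the axial function of the real parts, which is the operator side, and
of terms with the imaginary parts, which vanish. -/
theorem leftOp_eq_leftIntegral (hn : Odd n) {ℓ : ℕ} (hℓ : ℓ ≤ sce n) (hWo : IsOpen W)
    (hW : AxiallySymmetric W) (hI : I ∈ unitSphere n) (hf : LeftForm W f α β)
    (heo : EvenOdd (paramSet W) α β) (hcr : CauchyRiemann (paramSet W) α β)
    (h : IsCauchyCycle γ (sliceSet I W) O) (hO : ∀ z ∈ O, (starRingEnd ℂ) z ∈ O) {x : Para n}
    (hx : upperPoint x ∈ O) : leftOp ℓ f x = leftIntegral ℓ I γ f x := by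
  have hfam := isKernelFamily_kernelIntegral (n := n) h hO (continuousOn_stem hW hI hcr) imCl
  obtain ⟨h1, h2⟩ := (hfam.radial 0).components_eq_zero
    (axialFun_imCl_eq_zero hn hℓ hWo hW hI heo hcr h hO) hx
  rw [leftOp_eqOn_axialFun hn hℓ hWo hW hI hf heo hcr h hO hx,
    leftIntegral_eq hn hW hI hf hcr h hO ℓ hx, assembleCLM_apply, sliceCLM_apply,
    sliceCLM_apply, h1, mul_zero, add_zero, Pi.smul_apply, axialFun, mul_add]
  congr 2
  -- On the real axis the second imaginary component is not known to vanish, but it is multiplied by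
  -- `x̲ = 0`.
  by_cases hv : vecNormSq x = 0
  · rw [vecCLM_eq_zero hv]; simp
  · rw [h2 hv]; simp

end Integrand

/-! ### Left slice hyperholomorphic functions -/

lemma exists_mem_unitSphere (hn : Odd n) : ∃ I : EuclideanSpace ℝ (Fin n), I ∈ unitSphere n :=
  ⟨EuclideanSpace.single ⟨0, hn.pos⟩ 1, by simp [unitSphere]⟩

section Left

variable {W : Set (Para n)} {f : Para n → Cl n}

/-- Locally, a left slice hyperholomorphic function and its images under the operators
`Δ^ℓ D̄^(hₙ - ℓ)` are given by one radial family. -/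
lemma LeftSliceHyperholomorphic.exists_isRadialFamily (hn : Odd n)
    (hf : LeftSliceHyperholomorphic W f) {x : Para n} (hx : x ∈ W) :
    ∃ (O : Set (Para n)) (q : ℕ → ℕ → Para n → Cl n), IsRadialFamily O q ∧ x ∈ O ∧ O ⊆ W ∧
      EqOn f (axialFun q 0 1) O ∧ ∀ ℓ ≤ sce n, EqOn (leftOp ℓ f)
        ((gammaConst n * kernelConst n ℓ) • axialFun q (sce n - ℓ) (sce n + 1)) O := by
  obtain ⟨hWo, hW, α, β, hfo, heo, hcr⟩ := hf
  obtain ⟨I, hI⟩ := exists_mem_unitSphere hn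
  obtain ⟨m, γ, O, h, hxO, hO⟩ := exists_isCauchyCycle (isOpen_sliceSet hWo I)
    (fun z hz => conj_mem_sliceSet hW hI hz) ((upperPoint_mem_sliceSet_iff hW hI).mpr hx)
    (show 0 ≤ (upperPoint x).im from norm_nonneg _)
  refine ⟨upperPoint ⁻¹' O, fun a k x => reCl (kernelIntegral γ (stem α β) 0 a k x),
    (isKernelFamily_kernelIntegral h hO (continuousOn_stem hW hI hcr) reCl).radial 0, hxO,
    fun y hy => (upperPoint_mem_sliceSet_iff hW hI).mp (h.subset hy),
    eqOn_axialFun_reCl hWo hW hI hfo heo hcr h hO, fun ℓ hℓ =>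
    leftOp_eqOn_axialFun hn hℓ hWo hW hI hfo heo hcr h hO⟩

lemma LeftSliceHyperholomorphic.contDiffOn (hn : Odd n) (hf : LeftSliceHyperholomorphic W f) :
    ContDiffOn ℝ ∞ f W := by
  intro x hx
  obtain ⟨O, q, hq, hxO, -, h1, -⟩ := hf.exists_isRadialFamily hn hx
  exact (((hq.contDiffOn_axialFun 0 1).congr h1).contDiffAt
    (hq.isOpen.mem_nhds hxO)).contDiffWithinAt

/-- The radial families exist only locally. Even and odd part of `g` along one fixed `I` give global
components, and they have the right form because each sphere lies in the domain of a single family.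
-/
lemma exists_leftForm (hn : Odd n) {g : Para n → Cl n}
    (h : ∀ x ∈ W, ∃ (O : Set (Para n)) (q : ℕ → ℕ → Para n → Cl n) (a k : ℕ) (c : ℝ),
      IsRadialFamily O q ∧ x ∈ O ∧ EqOn g (c • axialFun q a k) O) :
    ∃ A B : ℝ × ℝ → Cl n, LeftForm W g A B ∧ EvenOdd (paramSet W) A B := by
  obtain ⟨I, hI⟩ := exists_mem_unitSphere hn
  refine ⟨fun p => (1 / 2 : ℝ) • (g (slicePoint I p.1 p.2) + g (slicePoint I p.1 (-p.2))),
    fun p => -(1 / 2 : ℝ) • (vec I * (g (slicePoint I p.1 p.2) - g (slicePoint I p.1 (-p.2)))),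
    fun p hp J hJ => ?_, fun p _ => ⟨?_, ?_⟩⟩
  · obtain ⟨O, q, a, k, c, hq, hxO, hg⟩ := h _ (hp I hI)
    have key : ∀ K ∈ unitSphere n, ∀ v, v = p.2 ∨ v = -p.2 → g (slicePoint K p.1 v) =
        c • (q (a + 1) k (slicePoint I p.1 p.2) +
          v • (vec K * q a k (slicePoint I p.1 p.2))) := fun K hK v hv => by
      have h0 : slicePoint K p.1 v 0 = slicePoint I p.1 p.2 0 := by simp
      have h1 : vecNormSq (slicePoint K p.1 v) = vecNormSq (slicePoint I p.1 p.2) := by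
        rw [vecNormSq_eq, vecNormSq_eq, vecPart_slicePoint, vecPart_slicePoint, norm_smul,
          norm_smul, norm_of_mem_unitSphere hI, norm_of_mem_unitSphere hK]
        rcases hv with rfl | rfl <;> simp
      rw [hg (hq.reflect _ hxO _ h0 h1), Pi.smul_apply, axialFun, hq.axial _ _ _ hxO _ h0 h1,
        hq.axial _ _ _ hxO _ h0 h1, vecCLM_slicePoint, smul_mul_assoc]
    rw [key J hJ _ (Or.inl rfl)]
    simp only [key I hI _ (Or.inl rfl), key I hI _ (Or.inr rfl)]
    set P := q (a + 1) k (slicePoint I p.1 p.2)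
    set Q := q a k (slicePoint I p.1 p.2)
    have e : vec I * (c • (P + p.2 • (vec I * Q)) - c • (P + -p.2 • (vec I * Q))) =
        (-(2 * c * p.2)) • Q := by
      rw [show c • (P + p.2 • (vec I * Q)) - c • (P + -p.2 • (vec I * Q)) =
        (2 * c * p.2) • (vec I * Q) by module, mul_smul_comm, ← mul_assoc, vec_mul_vec_of_mem hI]
      simp
    rw [e, mul_smul_comm, mul_smul_comm]
    module
  · simp only [neg_neg, add_comm]
  · simp only [neg_neg]
    rw [← neg_sub, mul_neg, smul_neg]

theorem LeftSliceHyperholomorphic.leftAxiallyPolyanalytic (hn : Odd n) {ℓ : ℕ} (hℓ : ℓ ≤ sce n)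
    (hf : LeftSliceHyperholomorphic W f) :
    LeftAxiallyPolyanalytic (sce n - ℓ + 1) W (leftOp ℓ f) := by
  refine ⟨contDiffOn_infty.mp ((isLocalOp_leftOp ℓ).smooth hf.1 (hf.contDiffOn hn)) _,
    exists_leftForm hn fun x hx => ?_, fun x hx => ?_⟩
  · obtain ⟨O, q, hq, hxO, -, -, h⟩ := hf.exists_isRadialFamily hn hx
    exact ⟨O, q, _, _, _, hq, hxO, h ℓ hℓ⟩
  · obtain ⟨O, q, hq, hxO, -, -, h⟩ := hf.exists_isRadialFamily hn hx
    have hD := isLocalOp_dirac.iterate (n := n) (sce n - ℓ + 1)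
    have hk : n + 1 = 2 * (sce n + 1) := by
      obtain ⟨s, hs⟩ := hn
      rw [sce]; omega
    rw [hD.congr hq.isOpen (h ℓ hℓ) hxO, hD.smul _ hq.isOpen (hq.contDiffOn_axialFun _ _) hxO,
      Pi.smul_apply, hq.dirac_iterate_axialFun hk _ hxO, Pi.zero_apply, smul_zero]

lemma isBounded_sliceSet {U : Set (Para n)} (hU : Bornology.IsBounded U)
    {I : EuclideanSpace ℝ (Fin n)} (hI : I ∈ unitSphere n) :
    Bornology.IsBounded (sliceSet I U) := by
  obtain ⟨C, hC⟩ := hU.exists_norm_le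
  refine isBounded_iff_forall_norm_le.mpr ⟨C, fun z hz => ?_⟩
  refine le_trans (le_of_eq ?_) (hC _ hz)
  have h1 : ‖slicePoint I z.re z.im‖ ^ 2 = ‖z‖ ^ 2 := by
    rw [norm_sq_eq_add, vecNormSq_eq, vecPart_slicePoint, norm_smul, norm_of_mem_unitSphere hI,
      slicePoint_zero, mul_one, Real.norm_eq_abs, sq_abs, Complex.sq_norm, Complex.normSq_apply]
    ring
  exact ((sq_eq_sq₀ (norm_nonneg _) (norm_nonneg _)).mp h1).symm

theorem LeftSliceHyperholomorphic.integral_representation (hn : Odd n) {ℓ : ℕ} (hℓ : ℓ ≤ sce n)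
    (hf : LeftSliceHyperholomorphic W f) {U : Set (Para n)} (hb : Bornology.IsBounded U)
    (hU : IsSliceCauchyDomain U) (hUW : closure U ⊆ W) {I : EuclideanSpace ℝ (Fin n)}
    (hI : I ∈ unitSphere n) {m : ℕ} {γ : Fin m → ℝ → ℂ} (hγ : IsOrientedBoundary γ (sliceSet I U))
    {x : Para n} (hx : x ∈ U) :
    (∀ j, IntervalIntegrable (leftIntegrand ℓ I (γ j) f x) volume 0 1) ∧
      leftOp ℓ f x = leftIntegral ℓ I γ f x := by
  obtain ⟨hWo, hW, α, β, hfo, heo, hcr⟩ := hf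
  have hV : closure (sliceSet I U) ⊆ sliceSet I W :=
    ((continuous_slicePoint I).closure_preimage_subset U).trans (preimage_mono hUW)
  have h := hγ.isCauchyCycle (isOpen_sliceSet hU.1 I) (isBounded_sliceSet hb hI) hV
  have hO : ∀ z ∈ sliceSet I U, (starRingEnd ℂ) z ∈ sliceSet I U :=
    fun z hz => conj_mem_sliceSet hU.2.1 hI hz
  have hx' : upperPoint x ∈ sliceSet I U := (upperPoint_mem_sliceSet_iff hU.2.1 hI).mpr hx
  exact ⟨fun j => (intervalIntegrable_leftIntegrand hn hW hI hfo hcr h hO ℓ hx' j).1,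
    leftOp_eq_leftIntegral hn hℓ hWo hW hI hfo heo hcr h hO hx'⟩

end Left

/-! ### Reversion: from left to right -/

/-- The reversion of the Clifford algebra, the linear anti-automorphism that fixes the
1-vectors. -/
def rev : Cl n ≃L[ℝ] Cl n :=
  (LinearEquiv.ofInvolutive CliffordAlgebra.reverse
    CliffordAlgebra.reverse_involutive).toContinuousLinearEquiv

@[simp] lemma rev_rev (a : Cl n) : rev (rev a) = a := CliffordAlgebra.reverse_reverse a

@[simp] lemma rev_mul (a b : Cl n) : rev (a * b) = rev b * rev a := CliffordAlgebra.reverse.map_mul a b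

@[simp] lemma rev_one : rev (1 : Cl n) = 1 := CliffordAlgebra.reverse.map_one

@[simp] lemma rev_vec (v : EuclideanSpace ℝ (Fin n)) : rev (vec v) = vec v :=
  CliffordAlgebra.reverse_ι _

@[simp] lemma rev_algebraMap (r : ℝ) : rev (algebraMap ℝ (Cl n) r) = algebraMap ℝ (Cl n) r :=
  CliffordAlgebra.reverse.commutes r

@[simp] lemma rev_imUnit (i : Fin n) : rev (imUnit i) = imUnit i := rev_vec _

@[simp] lemma rev_toCl (x : Para n) : rev (toCl x) = toCl x := by simp [toCl]

@[simp] lemma rev_toClConj (x : Para n) : rev (toClConj x) = toClConj x := by simp [toClConj]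

@[simp] lemma rev_pow (a : Cl n) (k : ℕ) : rev (a ^ k) = rev a ^ k := by
  induction k with
  | zero => simp
  | succ k ih => rw [pow_succ, rev_mul, ih, pow_succ']

lemma rev_inverse {a : Cl n} (ha : rev a = a) : rev (Ring.inverse a) = Ring.inverse a := by
  by_cases hu : IsUnit a
  · have h1 : rev (Ring.inverse a) * a = 1 := by
      nth_rewrite 2 [← ha]
      rw [← rev_mul, Ring.mul_inverse_cancel a hu, rev_one]
    calc rev (Ring.inverse a) = rev (Ring.inverse a) * (a * Ring.inverse a) := by
          rw [Ring.mul_inverse_cancel a hu, mul_one]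
      _ = Ring.inverse a := by rw [← mul_assoc, h1, one_mul]
  · rw [Ring.inverse_non_unit a hu, map_zero]

/-- The reversion of the values of a function. -/
def revFun (f : Para n → Cl n) (x : Para n) : Cl n := rev (f x)

lemma pderiv_revFun (i : Fin (n + 1)) (f : Para n → Cl n) (x : Para n) :
    pderiv i (revFun f) x = rev (pderiv i f x) := by
  have : fderiv ℝ (rev ∘ f) x = _ := rev.comp_fderiv
  rw [pderiv, show revFun f = rev ∘ f from rfl, this]
  rfl

lemma revFun_diracRight (f : Para n → Cl n) : revFun (diracRight f) = dirac (revFun f) := by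
  ext x
  simp [revFun, diracRight, dirac, ← pderiv_revFun]

lemma revFun_diracConjRight (f : Para n → Cl n) :
    revFun (diracConjRight f) = diracConj (revFun f) := by
  ext x
  simp [revFun, diracConjRight, diracConj, ← pderiv_revFun]

lemma revFun_lap (f : Para n → Cl n) : revFun (lap f) = lap (revFun f) := by
  ext x
  exact (congrFun (InnerProductSpace.laplacian_CLE_comp_left (f := f) (l := rev)) x).symm

/-- Reversion exchanges the left and right versions of `D̄`. The resulting order of `Δ` and `D̄`
differs from that in `leftOp`, whence the smoothness assumption. -/
lemma revFun_rightOp {ℓ : ℕ} {O : Set (Para n)} {f : Para n → Cl n} (hO : IsOpen O)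
    (hf : ContDiffOn ℝ ∞ (revFun f) O) : EqOn (revFun (rightOp ℓ f)) (leftOp ℓ (revFun f)) O := by
  have h1 : Function.Semiconj revFun (diracConjRight (n := n)) diracConj := revFun_diracConjRight
  have h2 : Function.Semiconj revFun (lap (n := n)) lap := revFun_lap
  rw [rightOp, (h1.iterate_right _).eq, (h2.iterate_right _).eq]
  exact (leftOp_eq hO hf).symm

lemma contDiffOn_revFun {O : Set (Para n)} {f : Para n → Cl n} (hf : ContDiffOn ℝ ∞ f O) :
    ContDiffOn ℝ ∞ (revFun f) O := rev.contDiff.comp_contDiffOn hf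

lemma rightOp_sub {ℓ : ℕ} {O : Set (Para n)} {f g : Para n → Cl n} (hO : IsOpen O)
    (hf : ContDiffOn ℝ ∞ f O) (hg : ContDiffOn ℝ ∞ g O) :
    EqOn (rightOp ℓ (f - g)) (rightOp ℓ f - rightOp ℓ g) O := fun x hx => by
  have hs : revFun (f - g) = revFun f - revFun g := by
    ext y
    simp [revFun]
  refine rev.injective ?_
  have h1 := revFun_rightOp (ℓ := ℓ) hO (contDiffOn_revFun (f := f - g) (hf.sub hg)) hx
  have h2 := revFun_rightOp (ℓ := ℓ) hO (contDiffOn_revFun hf) hx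
  have h3 := revFun_rightOp (ℓ := ℓ) hO (contDiffOn_revFun hg) hx
  rw [hs, (isLocalOp_leftOp ℓ).sub hO (contDiffOn_revFun hf) (contDiffOn_revFun hg) hx,
    Pi.sub_apply, ← h2, ← h3] at h1
  rw [Pi.sub_apply, map_sub]
  exact h1

section Right

variable {W : Set (Para n)} {f : Para n → Cl n}

lemma LeftForm.revFun_of_rightForm {A B : ℝ × ℝ → Cl n} (h : RightForm W f A B) :
    LeftForm W (revFun f) (fun p => rev (A p)) (fun p => rev (B p)) := fun p hp I hI => by
  rw [revFun, h p hp I hI]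
  simp

lemma RightForm.of_leftForm {A B : ℝ × ℝ → Cl n} (h : LeftForm W (revFun f) A B) :
    RightForm W f (fun p => rev (A p)) (fun p => rev (B p)) := fun p hp I hI => by
  rw [← rev_rev (f _)]
  have := h p hp I hI
  rw [revFun] at this
  rw [this]
  simp

lemma EvenOdd.rev {𝒰 : Set (ℝ × ℝ)} {A B : ℝ × ℝ → Cl n} (h : EvenOdd 𝒰 A B) :
    EvenOdd 𝒰 (fun p => rev (A p)) (fun p => rev (B p)) := fun p hp => by
  simp only [(h p hp).1, (h p hp).2, map_neg]
  exact ⟨trivial, trivial⟩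

lemma CauchyRiemann.rev {𝒰 : Set (ℝ × ℝ)} {A B : ℝ × ℝ → Cl n} (h : CauchyRiemann 𝒰 A B) :
    CauchyRiemann 𝒰 (fun p => rev (A p)) (fun p => rev (B p)) := fun p hp => by
  obtain ⟨h1, h2, h3, h4⟩ := h p hp
  have key : ∀ A : ℝ × ℝ → Cl n, ∀ v, fderiv ℝ (fun p => Polyanalytic.rev (A p)) p v =
      Polyanalytic.rev (fderiv ℝ A p v) := fun A v => by
    have : fderiv ℝ (Polyanalytic.rev ∘ A) p = _ := Polyanalytic.rev.comp_fderiv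
    exact congrArg (· v) this
  refine ⟨Polyanalytic.rev.differentiableAt.comp p h1, Polyanalytic.rev.differentiableAt.comp p h2,
    ?_, ?_⟩
  · rw [key, key, ← map_sub, h3, map_zero]
  · rw [key, key, ← map_add, h4, map_zero]

lemma RightSliceHyperholomorphic.revFun (h : RightSliceHyperholomorphic W f) :
    LeftSliceHyperholomorphic W (revFun f) := by
  obtain ⟨h1, h2, α, β, h3, h4, h5⟩ := h
  exact ⟨h1, h2, _, _, .revFun_of_rightForm h3, h4.rev, h5.rev⟩

lemma RightSliceHyperholomorphic.contDiffOn (hn : Odd n) (h : RightSliceHyperholomorphic W f) :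
    ContDiffOn ℝ ∞ f W := by
  have := Polyanalytic.rev.contDiff.comp_contDiffOn (h.revFun.contDiffOn hn)
  convert this using 1
  ext x
  simp [Polyanalytic.revFun]

lemma RightSliceHyperholomorphic.rightOp_eq (hn : Odd n) (h : RightSliceHyperholomorphic W f)
    (ℓ : ℕ) : EqOn (rightOp ℓ f) (Polyanalytic.revFun (leftOp ℓ (Polyanalytic.revFun f))) W :=
  fun x hx => by
    rw [Polyanalytic.revFun, ← revFun_rightOp h.1 (h.revFun.contDiffOn hn) hx, Polyanalytic.revFun,
      rev_rev]

lemma LeftAxiallyPolyanalytic.congr {m : ℕ} {g : Para n → Cl n} (hW : IsOpen W)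
    (h : LeftAxiallyPolyanalytic m W f) (hg : EqOn g f W) : LeftAxiallyPolyanalytic m W g := by
  obtain ⟨h1, ⟨A, B, h2, h3⟩, h4⟩ := h
  refine ⟨h1.congr hg, ⟨A, B, fun p hp I hI => ?_, h3⟩, fun x hx => ?_⟩
  · rw [hg (hp I hI), h2 p hp I hI]
  · rw [(isLocalOp_dirac.iterate m).congr hW hg hx, h4 x hx]

lemma RightAxiallyPolyanalytic.of_revFun {m : ℕ}
    (h : LeftAxiallyPolyanalytic m W (revFun f)) : RightAxiallyPolyanalytic m W f := by
  obtain ⟨h1, ⟨A, B, h2, h3⟩, h4⟩ := h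
  refine ⟨?_, ⟨_, _, .of_leftForm h2, h3.rev⟩, fun x hx => ?_⟩
  · have := rev.contDiff.comp_contDiffOn h1
    convert this using 1
    ext x
    simp [revFun]
  · have hs : Function.Semiconj revFun (diracRight (n := n)) dirac := revFun_diracRight
    have := h4 x hx
    rw [← (hs.iterate_right m).eq, revFun] at this
    exact (map_eq_zero_iff rev rev.injective).mp this

theorem RightSliceHyperholomorphic.rightAxiallyPolyanalytic (hn : Odd n) {ℓ : ℕ} (hℓ : ℓ ≤ sce n)
    (hf : RightSliceHyperholomorphic W f) :
    RightAxiallyPolyanalytic (sce n - ℓ + 1) W (rightOp ℓ f) :=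
  .of_revFun ((hf.revFun.leftAxiallyPolyanalytic hn hℓ).congr hf.1
    (revFun_rightOp hf.1 (hf.revFun.contDiffOn hn)))

lemma rev_pseudoCauchy (s x : Para n) : rev (pseudoCauchy s x) = pseudoCauchy s x := by
  simp [pseudoCauchy]

lemma rev_leftP (ℓ : ℕ) (s x : Para n) : rev (leftP ℓ s x) = rightP ℓ s x := by
  simp [leftP, rightP, leftF, rightF, rev_inverse (rev_pseudoCauchy s x)]

/-- Both factors of `ds(-I)` are fixed by reversion and commute, as they lie in `ℂ_I`. -/
lemma rev_dsI (I : EuclideanSpace ℝ (Fin n)) (γ : ℝ → ℂ) (t : ℝ) :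
    rev (dsI I γ t) = dsI I γ t := by
  simp only [dsI, rev_mul, rev_toCl, map_neg, rev_vec]
  rw [toCl_eq, vecCLM_slicePoint, mul_add, add_mul, Algebra.commutes, smul_mul_assoc,
    mul_smul_comm, neg_mul, mul_neg, neg_mul]

lemma rightIntegrand_eq (ℓ : ℕ) (I : EuclideanSpace ℝ (Fin n)) (γ : ℝ → ℂ) (f : Para n → Cl n)
    (x : Para n) : rightIntegrand ℓ I γ f x = fun t => rev (leftIntegrand ℓ I γ (revFun f) x t) := by
  ext t
  simp [leftIntegrand, rightIntegrand, rev_leftP, rev_dsI, revFun, mul_assoc]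

lemma rightIntegral_eq (ℓ : ℕ) (I : EuclideanSpace ℝ (Fin n)) {m : ℕ} (γ : Fin m → ℝ → ℂ)
    (f : Para n → Cl n) (x : Para n) :
    rightIntegral ℓ I γ f x = rev (leftIntegral ℓ I γ (revFun f) x) := by
  simp only [rightIntegral, leftIntegral, map_smul, map_sum, rightIntegrand_eq]
  congr 1
  refine Finset.sum_congr rfl fun j _ => ?_
  simp only [intervalIntegral, map_sub, ContinuousLinearEquiv.integral_comp_comm]

theorem RightSliceHyperholomorphic.integral_representation (hn : Odd n) {ℓ : ℕ} (hℓ : ℓ ≤ sce n)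
    (hf : RightSliceHyperholomorphic W f) {U : Set (Para n)} (hb : Bornology.IsBounded U)
    (hU : IsSliceCauchyDomain U) (hUW : closure U ⊆ W) {I : EuclideanSpace ℝ (Fin n)}
    (hI : I ∈ unitSphere n) {m : ℕ} {γ : Fin m → ℝ → ℂ} (hγ : IsOrientedBoundary γ (sliceSet I U))
    {x : Para n} (hx : x ∈ U) :
    (∀ j, IntervalIntegrable (rightIntegrand ℓ I (γ j) f x) volume 0 1) ∧
      rightOp ℓ f x = rightIntegral ℓ I γ f x := by
  obtain ⟨h1, h2⟩ := hf.revFun.integral_representation hn hℓ hb hU hUW hI hγ hx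
  constructor
  · intro j
    rw [rightIntegrand_eq]
    exact ⟨rev.toContinuousLinearMap.integrable_comp (h1 j).1,
      rev.toContinuousLinearMap.integrable_comp (h1 j).2⟩
  · rw [hf.rightOp_eq hn ℓ (hUW (subset_closure hx)), Polyanalytic.revFun, h2, rightIntegral_eq]

end Right

/-! ### Polynomials and the operators -/

/-- The smooth functions all of whose partial derivatives of order `d` vanish. -/
def PderivNilpotent : ℕ → (Para n → Cl n) → Prop
  | 0, f => f = 0
  | d + 1, f => ContDiff ℝ ∞ f ∧ ∀ i, PderivNilpotent d (pderiv i f)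

namespace PderivNilpotent

lemma contDiff : ∀ {d : ℕ} {f : Para n → Cl n}, PderivNilpotent d f → ContDiff ℝ ∞ f
  | 0, _, h => by
    rw [PderivNilpotent] at h
    rw [h]
    exact contDiff_const
  | _ + 1, _, h => h.1

lemma contDiffOn {d : ℕ} {f : Para n → Cl n} (h : PderivNilpotent d f) :
    ContDiffOn ℝ ∞ f univ := h.contDiff.contDiffOn

lemma zero : ∀ d : ℕ, PderivNilpotent d (0 : Para n → Cl n)
  | 0 => rfl
  | d + 1 => ⟨contDiff_const, fun i => by
      have : pderiv i (0 : Para n → Cl n) = 0 :=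
        funext fun x => (isLocalOp_pderiv i).zero isOpen_univ (mem_univ x)
      rw [this]
      exact zero d⟩

lemma const (c : Cl n) : PderivNilpotent 1 (fun _ : Para n => c) :=
  ⟨contDiff_const, fun i => by ext x; simp [pderiv]⟩

lemma succ : ∀ {d : ℕ} {f : Para n → Cl n}, PderivNilpotent d f → PderivNilpotent (d + 1) f
  | 0, f, h => by
    rw [PderivNilpotent] at h
    rw [h]
    exact zero 1
  | _ + 1, _, h => ⟨h.1, fun i => (h.2 i).succ⟩

lemma mono {d e : ℕ} (hde : d ≤ e) {f : Para n → Cl n} (h : PderivNilpotent d f) :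
    PderivNilpotent e f := by
  induction hde with
  | refl => exact h
  | step _ ih => exact ih.succ

lemma add : ∀ {d : ℕ} {f g : Para n → Cl n}, PderivNilpotent d f → PderivNilpotent d g →
    PderivNilpotent d (fun x => f x + g x)
  | 0, f, g, hf, hg => by
    rw [PderivNilpotent] at hf hg ⊢
    rw [hf, hg]
    ext x
    simp
  | d + 1, f, g, hf, hg => ⟨hf.1.add hg.1, fun i => by
      have : pderiv i (fun x => f x + g x) = fun x => pderiv i f x + pderiv i g x :=
        funext fun x => (isLocalOp_pderiv i).add isOpen_univ hf.contDiffOn hg.contDiffOn (mem_univ x)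
      rw [this]
      exact (hf.2 i).add (hg.2 i)⟩

lemma const_mul (c : Cl n) : ∀ {d : ℕ} {f : Para n → Cl n}, PderivNilpotent d f →
    PderivNilpotent d (fun x => c * f x)
  | 0, f, hf => by
    rw [PderivNilpotent] at hf ⊢
    rw [hf]
    ext x
    simp
  | d + 1, f, hf => ⟨(mulCLM c).contDiff.comp hf.1, fun i => by
      have : pderiv i (fun x => c * f x) = fun x => c * pderiv i f x :=
        funext fun x => (opCommute_pderiv_const_mul i c).comm isOpen_univ hf.contDiffOn (mem_univ x)
      rw [this]
      exact (hf.2 i).const_mul c⟩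

lemma sum {ι : Type*} (s : Finset ι) {d : ℕ} {f : ι → Para n → Cl n}
    (h : ∀ i ∈ s, PderivNilpotent d (f i)) : PderivNilpotent d (fun x => ∑ i ∈ s, f i x) := by
  classical
  induction s using Finset.induction_on with
  | empty => simpa using! zero d
  | insert a s ha ih =>
    simp only [Finset.sum_insert ha]
    exact (h a (Finset.mem_insert_self a s)).add
      (ih fun i hi => h i (Finset.mem_insert_of_mem hi))

lemma pderiv (i : Fin (n + 1)) : ∀ {d : ℕ} {f : Para n → Cl n}, PderivNilpotent d f →
    PderivNilpotent (d - 1) (pderiv i f)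
  | 0, f, h => by
    rw [PderivNilpotent] at h
    rw [h]
    exact (zero (n := n) 1).2 i
  | _ + 1, _, h => h.2 i

lemma diracConj {d : ℕ} {f : Para n → Cl n} (h : PderivNilpotent d f) :
    PderivNilpotent (d - 1) (diracConj f) := by
  rw [diracConj_eq]
  exact (h.pderiv 0).add ((sum _ fun i _ => (h.pderiv i.succ).const_mul _).const_mul _)

lemma lap {d : ℕ} {f : Para n → Cl n} (h : PderivNilpotent d f) :
    PderivNilpotent (d - 2) (lap f) := by
  rw [show Polyanalytic.lap f = fun x => ∑ i, Polyanalytic.pderiv i (Polyanalytic.pderiv i f) x from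
    funext fun x => lap_eq_sum isOpen_univ h.contDiffOn (mem_univ x)]
  exact sum _ fun i _ => (h.pderiv i).pderiv i

lemma diracConj_iterate {d : ℕ} {f : Para n → Cl n} (h : PderivNilpotent d f) (k : ℕ) :
    PderivNilpotent (d - k) (Polyanalytic.diracConj^[k] f) := by
  induction k with
  | zero => exact h
  | succ k ih =>
    rw [Function.iterate_succ_apply', Nat.sub_add_eq]
    exact ih.diracConj

lemma lap_iterate {d : ℕ} {f : Para n → Cl n} (h : PderivNilpotent d f) (k : ℕ) :
    PderivNilpotent (d - 2 * k) (Polyanalytic.lap^[k] f) := by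
  induction k with
  | zero => exact h
  | succ k ih =>
    rw [Function.iterate_succ_apply', Nat.mul_succ, Nat.sub_add_eq]
    exact ih.lap

/-- The operator has order `(h - ℓ) + 2ℓ = h + ℓ`. -/
lemma leftOp_eq_zero {ℓ : ℕ} (hℓ : ℓ ≤ sce n) {f : Para n → Cl n}
    (h : PderivNilpotent (sce n + ℓ) f) : leftOp ℓ f = 0 := by
  have := (h.diracConj_iterate (sce n - ℓ)).lap_iterate ℓ
  rwa [show sce n + ℓ - (sce n - ℓ) - 2 * ℓ = 0 by omega] at this

end PderivNilpotent

/-- The embedding of the paravectors as a linear map. -/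
def toClCLM : Para n →L[ℝ] Cl n :=
  (scalarPart (n := n)).smulRight 1 + vecCLM

lemma toClCLM_apply (x : Para n) : toClCLM x = toCl x := by
  simp [toClCLM, toCl_eq, Algebra.algebraMap_eq_smul_one]

lemma contDiff_toCl_mul {f : Para n → Cl n} (hf : ContDiff ℝ ∞ f) :
    ContDiff ℝ ∞ (fun x => toCl x * f x) := by
  simp only [← toClCLM_apply]
  exact ContDiff.clm_apply (f := fun x => mulCLM (toClCLM x))
    (mulCLM.contDiff.comp toClCLM.contDiff) hf

lemma pderiv_toCl_mul (i : Fin (n + 1)) {f : Para n → Cl n} (hf : ContDiff ℝ ∞ f) :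
    pderiv i (fun x => toCl x * f x) =
      fun x => toCl x * pderiv i f x + toCl (EuclideanSpace.single i 1) * f x := by
  ext x
  have := mulCLM.hasFDerivAt_of_bilinear (toClCLM.hasFDerivAt (x := x))
    (hf.differentiable (by simp) x).hasFDerivAt
  simp only [← toClCLM_apply]
  rw [pderiv, show (fun y => toClCLM y * f y) = fun y => mulCLM (toClCLM y) (f y) from rfl,
    this.fderiv]
  simp [pderiv]

lemma PderivNilpotent.toCl_mul : ∀ {d : ℕ} {f : Para n → Cl n}, PderivNilpotent d f →
    PderivNilpotent (d + 1) (fun x => toCl x * f x)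
  | 0, f, h => by
    rw [PderivNilpotent] at h
    simpa [h] using! zero (n := n) 1
  | d + 1, f, h => ⟨contDiff_toCl_mul h.1, fun i => by
      rw [pderiv_toCl_mul i h.1]
      exact (h.2 i).toCl_mul.add (h.const_mul _)⟩

lemma pderivNilpotent_toCl_pow_mul (ν : ℕ) (c : Cl n) :
    PderivNilpotent (ν + 1) (fun x : Para n => toCl x ^ ν * c) := by
  induction ν with
  | zero => simpa using PderivNilpotent.const c
  | succ ν ih =>
    simp only [pow_succ', mul_assoc]
    exact ih.toCl_mul

lemma toCl_single_zero : toCl (EuclideanSpace.single 0 1 : Para n) = 1 := by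
  rw [toCl_eq, vecCLM_single_zero]
  simp

lemma pderiv_zero_toCl_pow_mul (ν : ℕ) (c : Cl n) :
    pderiv 0 (fun x : Para n => toCl x ^ (ν + 1) * c) =
      fun x => toCl x ^ ν * ((ν + 1 : ℝ) • c) := by
  induction ν with
  | zero =>
    have := pderiv_toCl_mul 0 (n := n) (f := fun _ => c) contDiff_const
    simp only [zero_add, pow_one, this, toCl_single_zero]
    ext x
    simp [pderiv]
  | succ ν ih =>
    have e : (fun x : Para n => toCl x ^ (ν + 1 + 1) * c) =
        fun x => toCl x * (toCl x ^ (ν + 1) * c) := by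
      ext x; rw [pow_succ', mul_assoc]
    rw [e, pderiv_toCl_mul 0 (pderivNilpotent_toCl_pow_mul (ν + 1) c).contDiff, ih,
      toCl_single_zero]
    ext x
    rw [← mul_assoc, ← pow_succ', one_mul, mul_smul_comm, mul_smul_comm]
    push_cast
    module

lemma pderiv_zero_iterate_toCl_pow_mul (ν : ℕ) : ∀ c : Cl n,
    (pderiv 0)^[ν] (fun x : Para n => toCl x ^ ν * c) = fun _ => (ν.factorial : ℝ) • c := by
  induction ν with
  | zero => intro c; simp
  | succ ν ih =>
    intro c
    rw [Function.iterate_succ_apply, pderiv_zero_toCl_pow_mul, ih, smul_smul, Nat.factorial_succ]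
    push_cast
    simp only [mul_comm]

/-! ### Monomials and differences as slice hyperholomorphic functions -/

section Monomials

variable {W : Set (Para n)} {f g : Para n → Cl n}

/-- On each `ℂ_I` the power is the complex power `z^ν`, so its real and imaginary parts times `c`
serve as components. -/
lemma leftSliceHyperholomorphic_toCl_pow_mul (hWo : IsOpen W) (hW : AxiallySymmetric W) (ν : ℕ)
    (c : Cl n) : LeftSliceHyperholomorphic W (fun x => toCl x ^ ν * c) := by
  set Z : ℝ × ℝ →L[ℝ] ℂ := Complex.equivRealProdCLM.symm.toContinuousLinearMap with hZ
  have hZa : ∀ p, Z p = ⟨p.1, p.2⟩ := fun p => rfl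
  have hd : ∀ p, HasFDerivAt (fun p => Z p ^ ν) ((ν * Z p ^ (ν - 1) : ℂ) • Z) p := fun p => by
    have := (Z.hasFDerivAt (x := p)).pow ν
    simpa [nsmul_eq_mul] using! this
  have key : ∀ (L : ℂ →L[ℝ] ℝ) (p : ℝ × ℝ), HasFDerivAt (fun p => L (Z p ^ ν) • c)
      ((L ∘L ((ν * Z p ^ (ν - 1) : ℂ) • Z)).smulRight c) p := fun L p =>
    (L.hasFDerivAt.comp p (hd p)).smul_const c
  refine ⟨hWo, hW, fun p => Complex.reCLM (Z p ^ ν) • c, fun p => Complex.imCLM (Z p ^ ν) • c,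
    fun p _ I hI => ?_, fun p _ => ?_, fun p _ => ⟨(key _ p).differentiableAt,
      (key _ p).differentiableAt, ?_, ?_⟩⟩
  · have := toCl_slicePoint hI (Z p)
    rw [hZa] at this
    simp only [this, ← map_pow]
    rw [sliceHom_apply, add_mul, ← Algebra.smul_def, smul_mul_assoc, mul_smul_comm]
    rfl
  · have hc : Z (p.1, -p.2) = (starRingEnd ℂ) (Z p) := by
      rw [hZa, hZa]; rfl
    simp only [hc, ← map_pow, Complex.reCLM_apply, Complex.imCLM_apply, Complex.conj_re,
      Complex.conj_im, neg_smul, and_self]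
  · rw [(key _ p).fderiv, (key _ p).fderiv]
    simp [hZa]
  · rw [(key _ p).fderiv, (key _ p).fderiv]
    simp [hZa]

lemma LeftSliceHyperholomorphic.sub (hf : LeftSliceHyperholomorphic W f)
    (hg : LeftSliceHyperholomorphic W g) : LeftSliceHyperholomorphic W (f - g) := by
  obtain ⟨h1, h2, α, β, h3, h4, h5⟩ := hf
  obtain ⟨-, -, α', β', k3, k4, k5⟩ := hg
  refine ⟨h1, h2, α - α', β - β', fun p hp I hI => ?_, fun p hp => ?_, fun p hp => ?_⟩
  · rw [Pi.sub_apply, h3 p hp I hI, k3 p hp I hI, Pi.sub_apply, Pi.sub_apply, mul_sub]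
    abel
  · simp only [Pi.sub_apply, (h4 p hp).1, (h4 p hp).2, (k4 p hp).1, (k4 p hp).2]
    exact ⟨trivial, by abel⟩
  · obtain ⟨a1, a2, a3, a4⟩ := h5 p hp
    obtain ⟨b1, b2, b3, b4⟩ := k5 p hp
    refine ⟨a1.sub b1, a2.sub b2, ?_, ?_⟩
    · rw [fderiv_sub a1 b1, fderiv_sub a2 b2]
      simp only [sub_apply]
      rw [← sub_eq_zero.mpr (a3.trans b3.symm)]
      abel
    · rw [fderiv_sub a1 b1, fderiv_sub a2 b2]
      simp only [sub_apply]
      rw [← sub_eq_zero.mpr (a4.trans b4.symm)]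
      abel

end Monomials

/-! ### The kernel of the operators -/

/-- The complement of a coordinate hyperplane is dense, so relations between continuous functions
may be divided by a coordinate. -/
lemma eqOn_zero_of_coord_ne_zero {O : Set (Para n)} {g : Para n → Cl n} (hO : IsOpen O)
    (hg : ContinuousOn g O) (i : Fin n) (h : ∀ x ∈ O, x i.succ ≠ 0 → g x = 0) : EqOn g 0 O := by
  have hd : Dense {x : Para n | x i.succ ≠ 0} := by
    have hop : IsOpenMap (EuclideanSpace.proj i.succ : Para n →L[ℝ] ℝ) :=
      (EuclideanSpace.proj i.succ : Para n →L[ℝ] ℝ).isOpenMap fun c =>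
        ⟨EuclideanSpace.single i.succ c, by simp⟩
    exact (dense_compl_singleton (0 : ℝ)).preimage hop
  refine EqOn.of_subset_closure (s := O ∩ {x | x i.succ ≠ 0}) (fun x hx => h x hx.1 hx.2) hg
    continuousOn_const inter_subset_left (hd.open_subset_closure_inter hO)

/-- The family of the derivatives `∂/∂x₀` of the members of a radial family. -/
def timeDeriv (q : ℕ → ℕ → Para n → Cl n) (a k : ℕ) (x : Para n) : Cl n :=
  (2 * k : ℝ) • q (a + 1) (k + 1) x - (a : ℝ) • q (a - 1) k x

/-- The members `q_{a,k}` with `a + C ≤ 2 k` vanish. -/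
def VanishesBelow (O : Set (Para n)) (C : ℕ) (q : ℕ → ℕ → Para n → Cl n) : Prop :=
  ∀ a k, a + C ≤ 2 * k → EqOn (q a k) 0 O

/-- Both members in the derivative, `q_{a+1,k+1}` and `q_{a-1,k}`, have a difference `2k - a` larger
by one than that of `q_{a,k}`. -/
lemma VanishesBelow.timeDeriv {O : Set (Para n)} {C : ℕ} {q : ℕ → ℕ → Para n → Cl n}
    (h : VanishesBelow O (C + 1) q) : VanishesBelow O C (timeDeriv q) := fun a k hak x hx => by
  rw [Polyanalytic.timeDeriv, h (a + 1) (k + 1) (by omega) hx]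
  rcases a with _ | a
  · simp
  · rw [h (a + 1 - 1) k (by omega) hx]
    simp

lemma VanishesBelow.timeDeriv_iterate {O : Set (Para n)} {C : ℕ} (j : ℕ) :
    ∀ {q : ℕ → ℕ → Para n → Cl n}, VanishesBelow O (C + j) q →
      VanishesBelow O C (Polyanalytic.timeDeriv^[j] q) := by
  induction j with
  | zero => intro q h; exact h
  | succ j ih =>
    intro q h
    rw [Function.iterate_succ_apply]
    exact ih h.timeDeriv

namespace IsRadialFamily

variable {O : Set (Para n)} {q : ℕ → ℕ → Para n → Cl n}

/-- The relations of a family survive differentiation in `x₀`. Hence every `∂₀^j f` is again an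
axial function of a family. -/
lemma timeDeriv (h : IsRadialFamily O q) : IsRadialFamily O (timeDeriv q) where
  isOpen := h.isOpen
  reflect := h.reflect
  hasFDerivAt a k x hx := by
    refine (((h.hasFDerivAt (a + 1) (k + 1) x hx).const_smul (2 * k : ℝ)).sub
      ((h.hasFDerivAt (a - 1) k x hx).const_smul (a : ℝ))).congr_fderiv ?_
    ext y
    simp only [sub_apply, smul_apply, radialDeriv_apply, Polyanalytic.timeDeriv]
    rcases a with _ | a
    · simp only [Nat.add_sub_cancel]
      push_cast
      module
    · simp only [Nat.add_sub_cancel]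
      push_cast
      module
  sq a k x hx := by
    simp only [Polyanalytic.timeDeriv, Nat.add_succ_sub_one]
    have h1 := h.sq (a + 1) (k + 1) x hx
    rw [show a + 2 + 1 = a + 1 + 2 by ring, h1]
    rcases a with _ | a
    · push_cast
      module
    · have h2 := h.sq a k x hx
      simp only [Nat.add_sub_cancel]
      rw [show a + 1 + 1 = a + 2 by ring, h2]
      push_cast
      module
  axial a k x hx y h0 h1 := by
    simp only [Polyanalytic.timeDeriv, h.axial _ _ x hx y h0 h1]

lemma timeDeriv_iterate (h : IsRadialFamily O q) (j : ℕ) :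
    IsRadialFamily O (Polyanalytic.timeDeriv^[j] q) := by
  induction j with
  | zero => exact h
  | succ j ih => rw [Function.iterate_succ_apply']; exact ih.timeDeriv

lemma pderiv_zero_axialFun_eq (h : IsRadialFamily O q) (k : ℕ) :
    EqOn (pderiv 0 (axialFun q 0 k)) (axialFun (Polyanalytic.timeDeriv q) 0 k) O := fun x hx => by
  rw [h.pderiv_zero_axialFun 0 k hx]
  simp [axialFun, Polyanalytic.timeDeriv]

lemma pderiv_zero_iterate_axialFun (h : IsRadialFamily O q) (k j : ℕ) :
    EqOn ((pderiv 0)^[j] (axialFun q 0 k)) (axialFun (Polyanalytic.timeDeriv^[j] q) 0 k) O := by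
  induction j with
  | zero => exact eqOn_refl _ _
  | succ j ih =>
    rw [Function.iterate_succ_apply', Function.iterate_succ_apply']
    exact ((isLocalOp_pderiv 0).congr h.isOpen ih).trans
      ((h.timeDeriv_iterate j).pderiv_zero_axialFun_eq k)

lemma continuousOn (h : IsRadialFamily O q) (a k : ℕ) : ContinuousOn (q a k) O :=
  (h.contDiffOn a k).continuousOn

lemma eqOn_zero_of_axialFun (h : IsRadialFamily O q) (i : Fin n) {a k : ℕ}
    (h0 : EqOn (axialFun q a k) 0 O) : EqOn (q (a + 1) k) 0 O ∧ EqOn (q a k) 0 O :=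
  ⟨fun _ hx => (h.components_eq_zero h0 hx).1,
    eqOn_zero_of_coord_ne_zero h.isOpen (h.continuousOn a k) i fun _ hx hi =>
      (h.components_eq_zero h0 hx).2 fun hv => hi (pow_eq_zero_iff two_ne_zero |>.mp
        ((Finset.sum_eq_zero_iff_of_nonneg fun _ _ => sq_nonneg _).mp hv i (Finset.mem_univ i)))⟩

/-- The derivative in `xᵢ` is `-2k xᵢ q_{a,k+1}`, and `xᵢ` can be cancelled by density. -/
lemma eqOn_zero_succ (h : IsRadialFamily O q) (i : Fin n) {a k : ℕ} (hk : k ≠ 0)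
    (h0 : EqOn (q a k) 0 O) : EqOn (q a (k + 1)) 0 O := by
  refine eqOn_zero_of_coord_ne_zero h.isOpen (h.continuousOn a (k + 1)) i fun x hx hi => ?_
  have h1 := h.pderiv_succ a k i hx
  rw [(isLocalOp_pderiv i.succ).congr h.isOpen h0 hx, (isLocalOp_pderiv i.succ).zero h.isOpen hx,
    Pi.zero_apply, eq_comm] at h1
  refine (smul_eq_zero.mp h1).resolve_left (mul_ne_zero (neg_ne_zero.mpr ?_) hi)
  exact mul_ne_zero two_ne_zero (Nat.cast_ne_zero.mpr hk)

lemma timeDeriv_eqOn_zero (h : IsRadialFamily O q) {a k : ℕ} (h0 : EqOn (q a k) 0 O) :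
    EqOn (Polyanalytic.timeDeriv q a k) 0 O := fun x hx => by
  rw [Polyanalytic.timeDeriv, ← h.pderiv_zero a k hx, (isLocalOp_pderiv 0).congr h.isOpen h0 hx,
    (isLocalOp_pderiv 0).zero h.isOpen hx]

/-- Descent in `a`: if `q_{a+1,k}` and `q_{a+2,k}` vanish, so does `q_{a+2,k+1}`, and the
`x₀`-derivative of `q_{a+1,k}` leaves only `(a + 1) q_{a,k}`. -/
lemma eqOn_zero_of_le (h : IsRadialFamily O q) (i : Fin n) {m k : ℕ} (hk : k ≠ 0)
    (h0 : EqOn (axialFun q m k) 0 O) {a : ℕ} (ha : a ≤ m + 1) : EqOn (q a k) 0 O := by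
  obtain ⟨h1, h2⟩ := h.eqOn_zero_of_axialFun i h0
  have key : ∀ j, ∀ a, a + j = m → EqOn (q (a + 1) k) 0 O ∧ EqOn (q a k) 0 O := by
    intro j
    induction j with
    | zero =>
      intro a haj
      obtain rfl : a = m := by omega
      exact ⟨h1, h2⟩
    | succ j ih =>
      intro a haj
      obtain ⟨h3, h4⟩ := ih (a + 1) (by omega)
      refine ⟨h4, fun x hx => ?_⟩
      have h5 := h.timeDeriv_eqOn_zero h4 hx
      rw [Polyanalytic.timeDeriv, h.eqOn_zero_succ i hk h3 hx, Pi.zero_apply, smul_zero, zero_sub,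
        neg_eq_zero] at h5
      exact (smul_eq_zero.mp h5).resolve_left (by positivity)
  rcases Nat.lt_or_ge m a with h6 | h6
  · obtain rfl : a = m + 1 := by omega
    exact h1
  · exact (key (m - a) a (by omega)).2

/-- The row at level `k` vanishes for `a ≤ m + 1`, the edge of the region. Above that row, `a = 0,
1` come from differentiation in `xᵢ` and larger `a` from `sq` in steps of two; below it, `sq` is
read backwards. -/
lemma vanishesBelow (h : IsRadialFamily O q) (i : Fin n) {m k C : ℕ} (hk : k ≠ 0)
    (h0 : EqOn (axialFun q m k) 0 O) (hC : m + 1 + C = 2 * k) : VanishesBelow O C q := by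
  have up : ∀ e a, a ≤ m + 1 + 2 * e → EqOn (q a (k + e)) 0 O := by
    intro e
    induction e with
    | zero => intro a ha; exact h.eqOn_zero_of_le i hk h0 (by omega)
    | succ e ih =>
      intro a
      induction a using Nat.twoStepInduction with
      | zero => intro _; exact h.eqOn_zero_succ (k := k + e) i (by omega) (ih 0 (by omega))
      | one => intro _; exact h.eqOn_zero_succ (k := k + e) i (by omega) (ih 1 (by omega))
      | more a ih1 _ =>
        intro ha x hx
        rw [← add_assoc, h.sq a (k + e) x hx, ih a (by omega) hx]
        have := ih1 (by omega) hx
        rw [← add_assoc] at this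
        rw [this]
        simp
  have down : ∀ e a k', k' + e = k → a + 2 * e ≤ m + 1 → EqOn (q a k') 0 O := by
    intro e
    induction e with
    | zero =>
      intro a k' hk' ha
      obtain rfl : k' = k := by omega
      exact h.eqOn_zero_of_le i hk h0 (by omega)
    | succ e ih =>
      intro a k' hk' ha x hx
      have h1 := h.sq a k' x hx
      rw [ih (a + 2) (k' + 1) (by omega) (by omega) hx, ih a (k' + 1) (by omega) (by omega) hx] at h1
      simpa using h1.symm
  intro a k' hak
  rcases le_total k k' with h1 | h1
  · obtain ⟨e, rfl⟩ := Nat.exists_eq_add_of_le h1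
    exact up e a (by omega)
  · exact down (k - k') a k' (by omega) (by omega)

lemma contDiffOn_vecNormSq_smul (h : IsRadialFamily O q) (a k : ℕ) :
    ContDiffOn ℝ ∞ (fun x => vecNormSq x • q a k x) O := by
  have hv : ContDiff ℝ ∞ (vecNormSq (n := n)) := by
    unfold vecNormSq
    fun_prop
  exact hv.contDiffOn.smul (h.contDiffOn a k)

lemma pderiv_succ_vecNormSq_smul (h : IsRadialFamily O q) (a k : ℕ) (i : Fin n) {x : Para n}
    (hx : x ∈ O) : pderiv i.succ (fun x => vecNormSq x • q a k x) x =
      vecNormSq x • pderiv i.succ (q a k) x + (2 * x i.succ) • q a k x := by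
  have e : HasFDerivAt (fun x => vecNormSq x • q a k x) _ x :=
    (hasFDerivAt_vecNormSq x).smul (h.hasFDerivAt a k x hx)
  rw [pderiv, e.fderiv, pderiv, (h.hasFDerivAt a k x hx).fderiv]
  simp [vecInner_apply]

/-- This is the relation for `k` differentiated in `xᵢ` and divided by `-2(k + 1) xᵢ`; the
derivative of `|x̲|²` raises the left coefficient from `2k + 1` to `2k + 3`. -/
lemma smul_eqOn_smul_vecNormSq_smul_succ (h : IsRadialFamily O q) (i : Fin n) {k : ℕ}
    (hk : EqOn ((2 * k + 1 : ℝ) • q 0 (k + 1))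
      ((2 * (k + 1) : ℝ) • fun x => vecNormSq x • q 0 (k + 2) x) O) :
    EqOn ((2 * (k + 1 : ℕ) + 1 : ℝ) • q 0 (k + 1 + 1))
      ((2 * ((k + 1 : ℕ) + 1) : ℝ) • fun x => vecNormSq x • q 0 (k + 1 + 2) x) O := by
  have hc := (((h.contDiffOn 0 (k + 1 + 1)).const_smul (2 * (k + 1 : ℕ) + 1 : ℝ)).sub
    ((h.contDiffOn_vecNormSq_smul 0 (k + 1 + 2)).const_smul
      (2 * ((k + 1 : ℕ) + 1) : ℝ))).continuousOn
  have hz := eqOn_zero_of_coord_ne_zero h.isOpen hc i fun x hx hi => ?_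
  · exact fun x hx => sub_eq_zero.mp (hz hx)
  have d1 := (isLocalOp_pderiv i.succ).congr h.isOpen hk hx
  rw [(isLocalOp_pderiv i.succ).smul _ h.isOpen (h.contDiffOn _ _) hx,
    (isLocalOp_pderiv i.succ).smul _ h.isOpen (h.contDiffOn_vecNormSq_smul _ _) hx,
    Pi.smul_apply, Pi.smul_apply, h.pderiv_succ_vecNormSq_smul 0 (k + 2) i hx,
    h.pderiv_succ 0 (k + 1) i hx, h.pderiv_succ 0 (k + 2) i hx, ← sub_eq_zero] at d1
  refine (smul_eq_zero.mp (Eq.trans ?_ d1)).resolve_left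
    (mul_ne_zero (neg_ne_zero.mpr (by positivity : (2 * (k + 1) : ℝ) ≠ 0)) hi)
  push_cast
  module

/-- An axial function that does not depend on `x₀` has vanishing partial derivatives, provided that
a higher member of its family vanishes. -/
lemma pderiv_eqOn_zero (h : IsRadialFamily O q) (i : Fin n) {K : ℕ} (hK : EqOn (q 0 (K + 1)) 0 O)
    (h0 : EqOn (axialFun (Polyanalytic.timeDeriv q) 0 1) 0 O) (j : Fin (n + 1)) :
    EqOn (pderiv j (axialFun q 0 1)) 0 O := by
  obtain ⟨h1, h2⟩ := h.timeDeriv.eqOn_zero_of_axialFun i h0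
  have e12 : EqOn (q 1 2) 0 O := fun x hx => by
    have := h2 hx
    simp only [Polyanalytic.timeDeriv, zero_add, Nat.cast_zero, zero_smul, sub_zero,
      Nat.cast_one, mul_one, Pi.zero_apply] at this
    exact (smul_eq_zero.mp this).resolve_left two_ne_zero
  have e01 : ∀ x ∈ O, (2 : ℝ) • q 2 2 x = q 0 1 x := fun x hx => by
    have := h1 hx
    simp only [Polyanalytic.timeDeriv, zero_add, Nat.cast_one, mul_one, one_smul,
      Pi.zero_apply, Nat.sub_self] at this
    exact sub_eq_zero.mp this
  -- Off the real axis the only other candidates are `c + ωd` with `ω = x̲/|x̲|` and local constants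
  -- `c, d`, that is `q_{0,1} = d/|x̲|`; the recursion is the one its family satisfies. Since
  -- `q_{0,K+1} = 0`, running it backwards excludes `d ≠ 0`.
  have hrec : ∀ k : ℕ, EqOn ((2 * k + 1 : ℝ) • q 0 (k + 1))
      ((2 * (k + 1) : ℝ) • fun x => vecNormSq x • q 0 (k + 2) x) O := by
    intro k
    induction k with
    | zero =>
      intro x hx
      have h3 := h.sq 0 1 x hx
      have h4 := e01 x hx
      rw [zero_add] at h3
      rw [h3] at h4
      simp only [Nat.cast_zero, zero_add, mul_zero, mul_one, one_smul, Pi.smul_apply]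
      rw [← sub_eq_zero] at h4 ⊢
      rw [← h4]
      module
    | succ k ih => exact h.smul_eqOn_smul_vecNormSq_smul_succ i ih
  have hz : ∀ e k, k + e = K → EqOn (q 0 (k + 1)) 0 O := by
    intro e
    induction e with
    | zero =>
      intro k hk
      obtain rfl : k = K := by omega
      exact hK
    | succ e ih =>
      intro k hk x hx
      have h3 := hrec k hx
      simp only [Pi.smul_apply, ih (k + 1) (by omega) hx, Pi.zero_apply, smul_zero] at h3
      exact (smul_eq_zero.mp h3).resolve_left (by positivity)
  have z1 := hz K 0 (by omega)
  have hF : EqOn (axialFun q 0 1) (q 1 1) O := fun x hx => by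
    rw [axialFun, z1 hx]
    simp
  intro x hx
  rw [(isLocalOp_pderiv j).congr h.isOpen hF hx]
  refine Fin.cases ?_ (fun j => ?_) j
  · rw [h.pderiv_zero 1 1 hx]
    exact h1 hx
  · rw [h.pderiv_succ 1 1 j hx, e12 hx, Pi.zero_apply, smul_zero]

end IsRadialFamily

/-! ### From vanishing families to polynomials -/

section Kernel

variable {W : Set (Para n)} {f : Para n → Cl n}

lemma fderiv_eq_zero_of_pderiv {g : Para n → Cl n} {x : Para n} (h : ∀ i, pderiv i g x = 0) :
    fderiv ℝ g x = 0 := by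
  refine ContinuousLinearMap.coe_injective
    ((EuclideanSpace.basisFun (Fin (n + 1)) ℝ).toBasis.ext fun i => ?_)
  simpa [pderiv] using h i

lemma leftOp_sum_toCl_pow_mul_eq_zero {ℓ : ℕ} (hℓ : ℓ ≤ sce n) {j : ℕ} (hj : j ≤ sce n + ℓ)
    (a : Fin j → Cl n) : leftOp ℓ (fun x => ∑ ν : Fin j, toCl x ^ (ν : ℕ) * a ν) = 0 :=
  PderivNilpotent.leftOp_eq_zero hℓ <| .sum _ fun ν _ =>
    (pderivNilpotent_toCl_pow_mul ν (a ν)).mono (by omega)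

lemma LeftSliceHyperholomorphic.exists_vanishesBelow (hn : Odd n) {ℓ : ℕ} (hℓ : ℓ ≤ sce n)
    (hf : LeftSliceHyperholomorphic W f) (h0 : ∀ x ∈ W, leftOp ℓ f x = 0) {x : Para n}
    (hx : x ∈ W) :
    ∃ (O : Set (Para n)) (q : ℕ → ℕ → Para n → Cl n), IsRadialFamily O q ∧ x ∈ O ∧ O ⊆ W ∧
      EqOn f (axialFun q 0 1) O ∧ VanishesBelow O (sce n + ℓ + 1) q := by
  obtain ⟨O, q, hq, hxO, hOW, h1, h2⟩ := hf.exists_isRadialFamily hn hx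
  refine ⟨O, q, hq, hxO, hOW, h1, hq.vanishesBelow ⟨0, hn.pos⟩ (m := sce n - ℓ) (k := sce n + 1)
    (by omega) (fun y hy => ?_) (by omega)⟩
  have := h2 ℓ hℓ hy
  rw [h0 y (hOW hy), eq_comm, Pi.smul_apply] at this
  exact (smul_eq_zero.mp this).resolve_left (gammaConst_mul_kernelConst_ne_zero n ℓ)

lemma LeftSliceHyperholomorphic.pderiv_zero_iterate_eq_zero (hn : Odd n) {ℓ : ℕ} (hℓ : ℓ ≤ sce n)
    (hf : LeftSliceHyperholomorphic W f) (h0 : ∀ x ∈ W, leftOp ℓ f x = 0) {x : Para n}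
    (hx : x ∈ W) : (pderiv 0)^[sce n + ℓ] f x = 0 := by
  obtain ⟨O, q, hq, hxO, hOW, h1, h2⟩ := hf.exists_vanishesBelow hn hℓ h0 hx
  -- With the bound `1` left after all derivatives, both components `q_{1,1}` and `q_{0,1}` fall
  -- into the vanishing region.
  have h3 := VanishesBelow.timeDeriv_iterate (C := 1) (sce n + ℓ) (by rwa [add_comm])
  rw [((isLocalOp_pderiv 0).iterate _).congr hq.isOpen h1 hxO,
    hq.pderiv_zero_iterate_axialFun 1 _ hxO, axialFun, h3 _ _ (by omega) hxO,
    h3 _ _ (by omega) hxO]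
  simp

/-- Locally `∂₀^j f` is an axial function independent of `x₀`, and the hypothesis on the operator
supplies the vanishing member that `pderiv_eqOn_zero` requires. Connectedness makes the constant
global. -/
lemma LeftSliceHyperholomorphic.exists_eq_const (hn : Odd n) {ℓ : ℕ} (hℓ : ℓ ≤ sce n)
    (hW : IsPreconnected W) (hf : LeftSliceHyperholomorphic W f)
    (h0 : ∀ x ∈ W, leftOp ℓ f x = 0) {j : ℕ} (hj : j < sce n + ℓ)
    (h1 : EqOn ((pderiv 0)^[j + 1] f) 0 W) : ∃ c, ∀ x ∈ W, (pderiv 0)^[j] f x = c := by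
  have hs := ((isLocalOp_pderiv 0).iterate j).smooth hf.1 (hf.contDiffOn hn)
  refine hf.1.exists_is_const_of_fderiv_eq_zero hW (hs.differentiableOn (by simp)) fun x hx =>
    fderiv_eq_zero_of_pderiv fun i => ?_
  obtain ⟨O, q, hq, hxO, hOW, h2, h3⟩ := hf.exists_vanishesBelow hn hℓ h0 hx
  have e := fun j => (((isLocalOp_pderiv 0).iterate j).congr hq.isOpen h2).trans
    (hq.pderiv_zero_iterate_axialFun 1 j)
  -- The bound `h + ℓ + 1 - j` is at most `2(h + 1)`, so `q_{0,h+1}` of the `j`-th derived family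
  -- vanishes.
  have h4 := VanishesBelow.timeDeriv_iterate (O := O) (q := q) (C := sce n + ℓ + 1 - j) j
    (by rwa [Nat.sub_add_cancel (by omega)])
  rw [(isLocalOp_pderiv i).congr hq.isOpen (e j) hxO]
  refine (hq.timeDeriv_iterate j).pderiv_eqOn_zero ⟨0, hn.pos⟩ (K := sce n)
    (h4 _ _ (by omega)) ?_ i hxO
  rw [← Function.iterate_succ_apply' timeDeriv]
  exact fun y hy => (e (j + 1) hy).symm.trans (h1 (hOW hy))

/-- Subtracting `x^j c / j!`, where `c` is the constant value of `∂₀^j f`, lowers the order in `x₀`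
by one. The difference stays slice hyperholomorphic and in the kernel of the operator, because `j <
h + ℓ`. -/
lemma LeftSliceHyperholomorphic.exists_eq_sum (hn : Odd n) {ℓ : ℕ} (hℓ : ℓ ≤ sce n)
    (hW : IsPreconnected W) {j : ℕ} (hj : j ≤ sce n + ℓ) : ∀ {f : Para n → Cl n},
    LeftSliceHyperholomorphic W f → (∀ x ∈ W, leftOp ℓ f x = 0) → EqOn ((pderiv 0)^[j] f) 0 W →
      ∃ a : Fin j → Cl n, ∀ x ∈ W, f x = ∑ ν : Fin j, toCl x ^ (ν : ℕ) * a ν := by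
  induction j with
  | zero => intro f _ _ h; exact ⟨Fin.elim0, fun x hx => by simpa using h hx⟩
  | succ j ih =>
    intro f hf h0 h1
    obtain ⟨c, hc⟩ := hf.exists_eq_const hn hℓ hW h0 (by omega) h1
    set b := ((j.factorial : ℝ)⁻¹) • c with hb
    set g : Para n → Cl n := fun x => toCl x ^ j * b with hg
    have hgs : LeftSliceHyperholomorphic W g :=
      leftSliceHyperholomorphic_toCl_pow_mul hf.1 hf.2.1 j b
    have hg0 : leftOp ℓ g = 0 := PderivNilpotent.leftOp_eq_zero hℓ
      ((pderivNilpotent_toCl_pow_mul j b).mono (by omega))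
    have hfs := hf.contDiffOn hn
    have hgs' := hgs.contDiffOn hn
    obtain ⟨a, ha⟩ := ih (by omega) (hf.sub hgs) (fun x hx => by
        rw [(isLocalOp_leftOp ℓ).sub hf.1 hfs hgs' hx, Pi.sub_apply, h0 x hx, hg0]
        simp) (fun x hx => by
        rw [((isLocalOp_pderiv 0).iterate j).sub hf.1 hfs hgs' hx, Pi.sub_apply, hc x hx, hg,
          pderiv_zero_iterate_toCl_pow_mul, hb, smul_smul,
          mul_inv_cancel₀ (by exact_mod_cast j.factorial_ne_zero), one_smul, sub_self]
        rfl)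
    refine ⟨Fin.snoc a b, fun x hx => ?_⟩
    rw [Fin.sum_univ_castSucc]
    simp only [Fin.snoc_castSucc, Fin.snoc_last, Fin.val_castSucc, Fin.val_last]
    rw [← ha x hx]
    simp [hg]

theorem LeftSliceHyperholomorphic.leftOp_eq_zero_iff (hn : Odd n) {ℓ : ℕ} (hℓ : ℓ ≤ sce n)
    (hW : IsPreconnected W) (hf : LeftSliceHyperholomorphic W f) :
    (∀ x ∈ W, leftOp ℓ f x = 0) ↔ ∃ a : Fin (sce n + ℓ) → Cl n,
      ∀ x ∈ W, f x = ∑ ν : Fin (sce n + ℓ), toCl x ^ (ν : ℕ) * a ν := by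
  refine ⟨fun h => hf.exists_eq_sum hn hℓ hW le_rfl h fun x hx =>
    hf.pderiv_zero_iterate_eq_zero hn hℓ h hx, fun ⟨a, ha⟩ x hx => ?_⟩
  rw [(isLocalOp_leftOp ℓ).congr hf.1 (show EqOn f _ W from ha) hx,
    leftOp_sum_toCl_pow_mul_eq_zero hℓ le_rfl]
  rfl

theorem RightSliceHyperholomorphic.rightOp_eq_zero_iff (hn : Odd n) {ℓ : ℕ} (hℓ : ℓ ≤ sce n)
    (hW : IsPreconnected W) (hf : RightSliceHyperholomorphic W f) :
    (∀ x ∈ W, rightOp ℓ f x = 0) ↔ ∃ a : Fin (sce n + ℓ) → Cl n,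
      ∀ x ∈ W, f x = ∑ ν : Fin (sce n + ℓ), a ν * toCl x ^ (ν : ℕ) := by
  have h1 : (∀ x ∈ W, rightOp ℓ f x = 0) ↔ ∀ x ∈ W, leftOp ℓ (Polyanalytic.revFun f) x = 0 :=
    forall₂_congr fun x hx => by
      rw [hf.rightOp_eq hn ℓ hx, Polyanalytic.revFun, map_eq_zero_iff rev rev.injective]
  rw [h1, hf.revFun.leftOp_eq_zero_iff hn hℓ hW]
  constructor
  · rintro ⟨a, ha⟩
    refine ⟨fun ν => rev (a ν), fun x hx => ?_⟩
    have := congrArg rev (ha x hx)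
    simpa [Polyanalytic.revFun] using this
  · rintro ⟨a, ha⟩
    refine ⟨fun ν => rev (a ν), fun x hx => ?_⟩
    rw [Polyanalytic.revFun, ha x hx]
    simp

end Kernel

end Polyanalytic

end

theorem mainTheorem6 (n : ℕ) (hn : Odd n) (ℓ : ℕ) (hℓ : ℓ < sce n) :
    -- left slice hyperholomorphic functions: regularity and integral representation
    (∀ (U W : Set (Para n)) (f : Para n → Cl n),
      Bornology.IsBounded U → IsSliceCauchyDomain U → closure U ⊆ W →
      LeftSliceHyperholomorphic W f →
        ContDiffOn ℝ ∞ f W ∧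
        LeftAxiallyPolyanalytic (sce n - ℓ + 1) W (leftOp ℓ f) ∧
        ∀ I ∈ unitSphere n, ∀ (m : ℕ) (γ : Fin m → ℝ → ℂ),
          IsOrientedBoundary γ (sliceSet I U) → ∀ x ∈ U,
            (∀ j, IntervalIntegrable (leftIntegrand ℓ I (γ j) f x) MeasureTheory.volume 0 1) ∧
            leftOp ℓ f x = leftIntegral ℓ I γ f x) ∧
    -- right slice hyperholomorphic functions: regularity and integral representation
    (∀ (U W : Set (Para n)) (f : Para n → Cl n),
      Bornology.IsBounded U → IsSliceCauchyDomain U → closure U ⊆ W →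
      RightSliceHyperholomorphic W f →
        ContDiffOn ℝ ∞ f W ∧
        RightAxiallyPolyanalytic (sce n - ℓ + 1) W (rightOp ℓ f) ∧
        ∀ I ∈ unitSphere n, ∀ (m : ℕ) (γ : Fin m → ℝ → ℂ),
          IsOrientedBoundary γ (sliceSet I U) → ∀ x ∈ U,
            (∀ j, IntervalIntegrable (rightIntegrand ℓ I (γ j) f x) MeasureTheory.volume 0 1) ∧
            rightOp ℓ f x = rightIntegral ℓ I γ f x) ∧
    -- independence of `U` and of `I`
    (∀ (U U' W : Set (Para n)),
      Bornology.IsBounded U → IsSliceCauchyDomain U → closure U ⊆ W →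
      Bornology.IsBounded U' → IsSliceCauchyDomain U' → closure U' ⊆ W →
      ∀ I ∈ unitSphere n, ∀ I' ∈ unitSphere n,
      ∀ (m m' : ℕ) (γ : Fin m → ℝ → ℂ) (γ' : Fin m' → ℝ → ℂ),
        IsOrientedBoundary γ (sliceSet I U) → IsOrientedBoundary γ' (sliceSet I' U') →
        ∀ (f : Para n → Cl n), ∀ x ∈ U ∩ U',
          (LeftSliceHyperholomorphic W f →
            leftIntegral ℓ I γ f x = leftIntegral ℓ I' γ' f x) ∧
          (RightSliceHyperholomorphic W f →
            rightIntegral ℓ I γ f x = rightIntegral ℓ I' γ' f x)) ∧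
    -- independence of the kernel of the operator
    (∀ (U W W' : Set (Para n)),
      Bornology.IsBounded U → IsSliceCauchyDomain U → closure U ⊆ W → closure U ⊆ W' →
      ∀ I ∈ unitSphere n, ∀ (m : ℕ) (γ : Fin m → ℝ → ℂ),
        IsOrientedBoundary γ (sliceSet I U) →
        ∀ (f g : Para n → Cl n),
          (LeftSliceHyperholomorphic W f → LeftSliceHyperholomorphic W' g →
            (∀ y ∈ U, leftOp ℓ (f - g) y = 0) →
            ∀ x ∈ U, leftIntegral ℓ I γ f x = leftIntegral ℓ I γ g x) ∧
          (RightSliceHyperholomorphic W f → RightSliceHyperholomorphic W' g →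
            (∀ y ∈ U, rightOp ℓ (f - g) y = 0) →
            ∀ x ∈ U, rightIntegral ℓ I γ f x = rightIntegral ℓ I γ g x)) ∧
    -- description of the kernel of the operator
    (∀ (W : Set (Para n)) (f : Para n → Cl n), IsConnected W →
      (LeftSliceHyperholomorphic W f →
        ((∀ x ∈ W, leftOp ℓ f x = 0) ↔
          ∃ a : Fin (sce n + ℓ) → Cl n, ∀ x ∈ W, f x = ∑ ν : Fin (sce n + ℓ), toCl x ^ (ν : ℕ) * a ν)) ∧
      (RightSliceHyperholomorphic W f →
        ((∀ x ∈ W, rightOp ℓ f x = 0) ↔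
          ∃ a : Fin (sce n + ℓ) → Cl n, ∀ x ∈ W, f x = ∑ ν : Fin (sce n + ℓ), a ν * toCl x ^ (ν : ℕ)))) := by
  refine ⟨fun U W f hb hU hUW hf => ⟨hf.contDiffOn hn, hf.leftAxiallyPolyanalytic hn hℓ.le,
      fun I hI m γ hγ x hx => hf.integral_representation hn hℓ.le hb hU hUW hI hγ hx⟩,
    fun U W f hb hU hUW hf => ⟨hf.contDiffOn hn, hf.rightAxiallyPolyanalytic hn hℓ.le,
      fun I hI m γ hγ x hx => hf.integral_representation hn hℓ.le hb hU hUW hI hγ hx⟩,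
    fun U U' W hb hU hUW hb' hU' hUW' I hI I' hI' m m' γ γ' hγ hγ' f x hx =>
      ⟨fun hf => ?_, fun hf => ?_⟩,
    fun U W W' hb hU hUW hUW' I hI m γ hγ f g =>
      ⟨fun hf hg h0 x hx => ?_, fun hf hg h0 x hx => ?_⟩,
    fun W f hW => ⟨fun hf => hf.leftOp_eq_zero_iff hn hℓ.le hW.isPreconnected,
      fun hf => hf.rightOp_eq_zero_iff hn hℓ.le hW.isPreconnected⟩⟩
  -- Both integrals equal the value at `x` of the same differential operator applied to `f`.
  · rw [← (hf.integral_representation hn hℓ.le hb hU hUW hI hγ hx.1).2,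
      ← (hf.integral_representation hn hℓ.le hb' hU' hUW' hI' hγ' hx.2).2]
  · rw [← (hf.integral_representation hn hℓ.le hb hU hUW hI hγ hx.1).2,
      ← (hf.integral_representation hn hℓ.le hb' hU' hUW' hI' hγ' hx.2).2]
  · rw [← (hf.integral_representation hn hℓ.le hb hU hUW hI hγ hx).2,
      ← (hg.integral_representation hn hℓ.le hb hU hUW' hI hγ hx).2, ← sub_eq_zero, ← h0 x hx]
    exact ((isLocalOp_leftOp ℓ).sub hU.1 ((hf.contDiffOn hn).mono (subset_closure.trans hUW))
      ((hg.contDiffOn hn).mono (subset_closure.trans hUW')) hx).symm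
  · rw [← (hf.integral_representation hn hℓ.le hb hU hUW hI hγ hx).2,
      ← (hg.integral_representation hn hℓ.le hb hU hUW' hI hγ hx).2, ← sub_eq_zero, ← h0 x hx]
    exact (rightOp_sub hU.1 ((hf.contDiffOn hn).mono (subset_closure.trans hUW))
      ((hg.contDiffOn hn).mono (subset_closure.trans hUW')) hx).symm
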